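/- Let $n\ge 1$, $m=n+1$, and let $X$ be a smooth (Hausdorff, $\sigma$-compact) manifold of dimension $2m=2n+2$ with boundary $\iota\colon M\hookrightarrow X$ and interior $\mathring X$. A *defining function* of $X$ is a $\rho\in C^\infty(X)$ with $\mathring X=\{\rho>0\}$ and $d\rho\ne0$ on $M$. Let $[\Theta]$ be a $\Theta$-structure on $X$, i.e. the class, modulo multiplication by positive functions, of a smooth section $\Theta$ of $T^*X|_M$ such that $\iota^*\Theta$ vanishes nowhere. The $\Theta$-tangent bundle ${}^\Theta TX$ is the bundle with the local frames $(\rho N,\rho^2T,\rho Y_1,\dots,\rho Y_{2n})$, where $(N,T,Y_1,\dots,Y_{2n})$ is a local frame of $TX$ such that, along $M$, $\Theta(N)=0$, the fields $T,Y_i$ are tangent to $M$ and $(Y_i)$ is a frame of $\ker\iota^*\Theta$. A $\Theta$-metric is a smooth bundle metric of ${}^\Theta TX$; it is a Riemannian metric on $\mathring X$. A partially integrable CR structure on $M$ is a complex rank-$n$ subbundle $T^{1,0}M\subset T^{\mathbb C}M$ with $T^{1,0}M\cap T^{0,1}M=0$ and $[\Gamma(T^{1,0}M),\Gamma(T^{1,0}M)]\subset\Gamma(T^{1,0}M\oplus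 T^{0,1}M)$, where $T^{0,1}M=\overline{T^{1,0}M}$. A contact form is a nowhere vanishing real $1$-form $\theta$ on $M$ annihilating $\operatorname{Re}T^{1,0}M$ whose Levi form $L_\theta(Z,\overline W)=-\sqrt{-1}\,d\theta(Z,\overline W)$ on $T^{1,0}M$ is positive definite. A $\Theta$-metric $g$ on $X$ is an *ACH metric* with CR structure at infinity $T^{1,0}M$ if $T^{1,0}M$ is a partially integrable CR structure on $M$ for which $\iota^*\Theta$ is a contact form, and there are a contact form $\theta_0$ with Reeb field $T$ and a diffeomorphism $\Psi$ from an open neighbourhood of $\{0\}\times M$ in $[0,\infty)_r\times M$ onto an open neighbourhood of $M$ in $X$, with $\Psi(0,q)=q$ and with $\Psi^*\Theta$ a positive multiple of the pullback of $\theta_0$ along $\{0\}\times M$, such that for $Z_\infty=r\partial_r$, $Z_0=r^2T$ and $Z_\alpha=rW_\alpha$, where $(W_\alpha)$ is a local frame of $T^{1,0}M$, the components $g_{IJ}=(\Psi^*g)(Z_I,Z_J)$ have at $r=0$ the values $g_{\infty\infty}=4$, $g_{\infty0}=g_{\infty\alpha}=g_{0\alpha}=g_{\alpha\beta}=0$,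 $g_{00}=1$, $g_{\alpha\overline\beta}=L_{\theta_0}(W_\alpha,\overline{W_\beta})$. Let $g$ be an ACH metric on $(X,[\Theta])$ with CR structure at infinity $T^{1,0}M$, and let $\Delta=-\operatorname{div}\operatorname{grad}$ be its non-negative Laplacian on $\mathring X$. A defining function $\rho$ is *normalized by* a contact form $\theta$ if $\iota^*(\rho^4g)=\theta\otimes\theta$ (the tensor $\rho^4g$ extends to the boundary). Fix any defining function $\rho$, put $x=2\rho^2$, and for real $a$ let $O(x^a)$ denote a function $x^af$ on $\mathring X$ with $f\in C^\infty(X)$ (this does not depend on the choice of $\rho$). **Proposition.** For every contact form $\theta$ on $M$ there is a defining function $\widetilde\rho$ of $X$ normalized by $\theta$ such that $\widetilde x=2\widetilde\rho^{\,2}$ satisfies $$\Delta\log\widetilde x=m+O(x^m).$$ Moreover $\widetilde\rho$ is unique modulo $O(x^{(2m+1)/2})$ and $\widetilde x$ is unique modulo $O(x^{m+1})$: if $\rho_1,\rho_2$ are two such functions, then $\rho_1-\rho_2=O(x^{(2m+1)/2})$ and $2\rho_1^2-2\rho_2^2=O(x^{m+1})$. -/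

import Mathlib

open scoped Manifold ContDiff Topology TensorProduct
open Bundle Filter

namespace ACH

noncomputable section

/-! ### Vector fields, one-forms, metrics and the Laplacian on a manifold -/

section General

variable {d : ℕ} {H : Type*} [TopologicalSpace H]
  (I : ModelWithCorners ℝ (EuclideanSpace ℝ (Fin d)) H)
  {N : Type*} [TopologicalSpace N] [ChartedSpace H N] [IsManifold I ∞ N]

/-- `V` is a smooth vector field on the set `U`. -/
def SmoothVF (U : Set N) (V : ∀ p : N, TangentSpace I p) : Prop :=
  ContMDiffOn I I.tangent ∞ (fun p => (⟨p, V p⟩ : TangentBundle I N)) U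

/-- `θ` is a smooth real one-form on `N`. -/
def SmoothOneForm (θ : ∀ p : N, TangentSpace I p →L[ℝ] ℝ) : Prop :=
  ContMDiff I (I.prod 𝓘(ℝ, EuclideanSpace ℝ (Fin d) →L[ℝ] ℝ)) ∞
    (fun p => TotalSpace.mk' (EuclideanSpace ℝ (Fin d) →L[ℝ] ℝ)
      (E := fun p : N => TangentSpace I p →L[ℝ] ℝ) p (θ p))

/-- `g` is a smooth Riemannian metric on the set `U` (to be used with `U` open; nothing is asked of
the values of `g` outside `U`). -/
structure IsRiemannianMetricOn (U : Set N)
    (g : ∀ p : N, TangentSpace I p →L[ℝ] TangentSpace I p →L[ℝ] ℝ) : Prop where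
  smooth : ContMDiffOn I
    (I.prod 𝓘(ℝ, EuclideanSpace ℝ (Fin d) →L[ℝ] EuclideanSpace ℝ (Fin d) →L[ℝ] ℝ)) ∞
    (fun p => TotalSpace.mk'
      (EuclideanSpace ℝ (Fin d) →L[ℝ] EuclideanSpace ℝ (Fin d) →L[ℝ] ℝ)
      (E := fun p : N => TangentSpace I p →L[ℝ] TangentSpace I p →L[ℝ] ℝ) p (g p)) U
  symm : ∀ p ∈ U, ∀ v w : TangentSpace I p, g p v w = g p w v
  pos : ∀ p ∈ U, ∀ v : TangentSpace I p, v ≠ 0 → 0 < g p v v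

/-- The exterior derivative of a one-form, evaluated on two vector fields:
`dθ(V, W) = V(θ(W)) - W(θ(V)) - θ([V, W])`. -/
def dOne (θ : ∀ p : N, TangentSpace I p →L[ℝ] ℝ) (V W : ∀ p : N, TangentSpace I p) (p : N) : ℝ :=
  mvfderiv I (fun q => θ q (W q)) p (V p) - mvfderiv I (fun q => θ q (V q)) p (W p)
    - θ p (VectorField.mlieBracket I V W p)

/-- The basis of `T_p N` given by the standard basis of the model vector space. -/
def stdVec (p : N) (i : Fin d) : TangentSpace I p :=
  (EuclideanSpace.single i (1 : ℝ) : EuclideanSpace ℝ (Fin d))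

/-- The Gram matrix of `g` at `p` in the basis `stdVec`. -/
def gram (g : ∀ p : N, TangentSpace I p →L[ℝ] TangentSpace I p →L[ℝ] ℝ) (p : N) :
    Matrix (Fin d) (Fin d) ℝ :=
  Matrix.of fun i j => g p (stdVec I p i) (stdVec I p j)

/-- The gradient of `u`: the vector field with `g(grad u, ·) = du`. -/
def grad (g : ∀ p : N, TangentSpace I p →L[ℝ] TangentSpace I p →L[ℝ] ℝ) (u : N → ℝ)
    (p : N) : TangentSpace I p :=
  ∑ i, ∑ j, ((gram I g p)⁻¹ i j * mvfderiv I u p (stdVec I p j)) • stdVec I p i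

/-- The Lie derivative of `g` along `V`, evaluated on two vector fields:
`(L_V g)(A, B) = V(g(A, B)) - g([V, A], B) - g(A, [V, B])`. -/
def lieDerivMetric (g : ∀ p : N, TangentSpace I p →L[ℝ] TangentSpace I p →L[ℝ] ℝ)
    (V A B : ∀ p : N, TangentSpace I p) (p : N) : ℝ :=
  mvfderiv I (fun q => g q (A q) (B q)) p (V p)
    - g p (VectorField.mlieBracket I V A p) (B p) - g p (A p) (VectorField.mlieBracket I V B p)

/-- The Riemannian divergence `div V = (1/2) tr_g (L_V g)`. As `L_V g` is a tensor, the trace at `p`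
is computed with local smooth extensions of a basis of `T_p N`. -/
def divergence (g : ∀ p : N, TangentSpace I p →L[ℝ] TangentSpace I p →L[ℝ] ℝ)
    (V : ∀ p : N, TangentSpace I p) (p : N) : ℝ :=
  (1 / 2) * ∑ i, ∑ j, (gram I g p)⁻¹ i j *
    lieDerivMetric I g V
      (FiberBundle.extend (EuclideanSpace ℝ (Fin d)) (stdVec I p i))
      (FiberBundle.extend (EuclideanSpace ℝ (Fin d)) (stdVec I p j)) p

/-- The non-negative Laplacian `Δ u = - div (grad u)` of the metric `g`. -/
def laplacian (g : ∀ p : N, TangentSpace I p →L[ℝ] TangentSpace I p →L[ℝ] ℝ) (u : N → ℝ)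
    (p : N) : ℝ :=
  - divergence I g (grad I g u) p

end General

/-! ### Complexification -/

section Complexification

variable {V : Type*} [AddCommGroup V] [Module ℝ V]

/-- The element `a + i b` of the complexification `ℂ ⊗ V`. -/
def toC (a b : V) : ℂ ⊗[ℝ] V := (1 : ℂ) ⊗ₜ[ℝ] a + Complex.I ⊗ₜ[ℝ] b

/-- Complex conjugation on the complexification `ℂ ⊗ V`. -/
def conjC : ℂ ⊗[ℝ] V →ₗ[ℝ] ℂ ⊗[ℝ] V := LinearMap.rTensor V Complex.conjAe.toLinearMap

/-- The value on `a + i b` and `a' + i b'` of the complex bilinear extension of a real bilinear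
`β`. -/
def bilC {W : Type*} (β : W → W → ℝ) (a b a' b' : W) : ℂ :=
  ⟨β a a' - β b b', β a b' + β b a'⟩

end Complexification

/-! ### Partially integrable CR structures and contact forms

`M` has dimension `2n+1`; a complex vector field `Z = A + iB` on `M` is given by the pair of real
vector fields `A`, `B`. -/

section CR

variable {n : ℕ} {M : Type*} [TopologicalSpace M]
  [ChartedSpace (EuclideanSpace ℝ (Fin (2 * n + 1))) M]
  [IsManifold (𝓡 (2 * n + 1)) ∞ M]

/-- `A + iB` is a smooth section over `O` of the family `T10` of complex tangent subspaces. -/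
structure IsSection (T10 : ∀ q : M, Submodule ℂ (ℂ ⊗[ℝ] TangentSpace (𝓡 (2 * n + 1)) q))
    (O : Set M) (A B : ∀ q : M, TangentSpace (𝓡 (2 * n + 1)) q) : Prop where
  smooth_re : SmoothVF (𝓡 (2 * n + 1)) O A
  smooth_im : SmoothVF (𝓡 (2 * n + 1)) O B
  mem : ∀ q ∈ O, toC (A q) (B q) ∈ T10 q

/-- `T10` is a partially integrable almost CR structure: a smooth complex subbundle of rank `n` of
the complexified tangent bundle with `T^{1,0} ∩ T^{0,1} = 0` and
`[Γ(T^{1,0}), Γ(T^{1,0})] ⊆ Γ(T^{1,0} ⊕ T^{0,1})`, where `T^{0,1}` is the conjugate of `T^{1,0}`. -/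
structure IsPartiallyIntegrableCR
    (T10 : ∀ q : M, Submodule ℂ (ℂ ⊗[ℝ] TangentSpace (𝓡 (2 * n + 1)) q)) : Prop where
  local_frame : ∀ q₀ : M, ∃ O : Set M, IsOpen O ∧ q₀ ∈ O ∧
    ∃ A B : Fin n → ∀ q : M, TangentSpace (𝓡 (2 * n + 1)) q,
      (∀ α, IsSection T10 O (A α) (B α)) ∧
      ∀ q ∈ O, LinearIndependent ℂ (fun α => toC (A α q) (B α q)) ∧
        Submodule.span ℂ (Set.range fun α => toC (A α q) (B α q)) = T10 q
  inter_conj : ∀ q : M, ∀ z ∈ T10 q, conjC z ∈ T10 q → z = 0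
  bracket : ∀ O : Set M, IsOpen O → ∀ A B A' B' : ∀ q : M, TangentSpace (𝓡 (2 * n + 1)) q,
    IsSection T10 O A B → IsSection T10 O A' B' → ∀ q ∈ O, ∃ z ∈ T10 q, ∃ w ∈ T10 q,
      toC
        (VectorField.mlieBracket (𝓡 (2 * n + 1)) A A' q
          - VectorField.mlieBracket (𝓡 (2 * n + 1)) B B' q)
        (VectorField.mlieBracket (𝓡 (2 * n + 1)) A B' q
          + VectorField.mlieBracket (𝓡 (2 * n + 1)) B A' q) = z + conjC w

/-- The Levi form `L_θ(Z, W̄) = -i dθ(Z, W̄)` for `Z = A + iB` and `W = A' + iB'`. -/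
def levi (θ : ∀ q : M, TangentSpace (𝓡 (2 * n + 1)) q →L[ℝ] ℝ)
    (A B A' B' : ∀ q : M, TangentSpace (𝓡 (2 * n + 1)) q) (q : M) : ℂ :=
  -Complex.I * bilC (fun V W => dOne (𝓡 (2 * n + 1)) θ V W q) A B A' (-B')

/-- `θ` is a contact form (pseudo-Hermitian structure) for `T10`: a nowhere vanishing real one-form
that annihilates `Re T^{1,0}` and whose Levi form is positive definite. (The numbers `L_θ(Z, Z̄)`
are automatically real.) -/
structure IsContactForm (T10 : ∀ q : M, Submodule ℂ (ℂ ⊗[ℝ] TangentSpace (𝓡 (2 * n + 1)) q))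
    (θ : ∀ q : M, TangentSpace (𝓡 (2 * n + 1)) q →L[ℝ] ℝ) : Prop where
  smooth : SmoothOneForm (𝓡 (2 * n + 1)) θ
  ne_zero : ∀ q, θ q ≠ 0
  annihilates : ∀ q, ∀ a b : TangentSpace (𝓡 (2 * n + 1)) q, toC a b ∈ T10 q → θ q a = 0
  levi_pos : ∀ O : Set M, IsOpen O → ∀ A B : ∀ q : M, TangentSpace (𝓡 (2 * n + 1)) q,
    IsSection T10 O A B → ∀ q ∈ O, toC (A q) (B q) ≠ 0 → 0 < (levi θ A B A B q).re

/-- `T` is the Reeb vector field of `θ`: `θ(T) = 1` and `dθ(T, ·) = 0`. -/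
structure IsReeb (θ : ∀ q : M, TangentSpace (𝓡 (2 * n + 1)) q →L[ℝ] ℝ)
    (T : ∀ q : M, TangentSpace (𝓡 (2 * n + 1)) q) : Prop where
  smooth : SmoothVF (𝓡 (2 * n + 1)) Set.univ T
  apply_self : ∀ q, θ q (T q) = 1
  contract : ∀ O : Set M, IsOpen O → ∀ V : ∀ q : M, TangentSpace (𝓡 (2 * n + 1)) q,
    SmoothVF (𝓡 (2 * n + 1)) O V → ∀ q ∈ O, dOne (𝓡 (2 * n + 1)) θ T V q = 0

end CR

/-! ### The collar `[0, ∞) × M` and ACH metrics near `{0} × M` -/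

section Collar

variable {n : ℕ} {M : Type*} [TopologicalSpace M]
  [ChartedSpace (EuclideanSpace ℝ (Fin (2 * n + 1))) M]
  [IsManifold (𝓡 (2 * n + 1)) ∞ M]

/-- The model with corners of `[0, ∞) × M`; the half-line is `EuclideanHalfSpace 1`. -/
abbrev collarModel (n : ℕ) := (𝓡∂ 1).prod (𝓡 (2 * n + 1))

/-- The coordinate `r` of `[0, ∞)`. -/
def rad (y : EuclideanHalfSpace 1 × M) : ℝ := y.1.1 0

/-- The vector field `r ∂/∂r` on `[0, ∞) × M`. -/
def Zinf (y : EuclideanHalfSpace 1 × M) : TangentSpace (collarModel n) y :=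
  ((rad y • EuclideanSpace.single 0 (1 : ℝ), 0) :
    EuclideanSpace ℝ (Fin 1) × EuclideanSpace ℝ (Fin (2 * n + 1)))

/-- The vector field `r ^ k V` on `[0, ∞) × M`, for a vector field `V` on `M`. -/
def radPow (k : ℕ) (V : ∀ q : M, TangentSpace (𝓡 (2 * n + 1)) q)
    (y : EuclideanHalfSpace 1 × M) : TangentSpace (collarModel n) y :=
  ((0, rad y ^ k • V y.2) : EuclideanSpace ℝ (Fin 1) × EuclideanSpace ℝ (Fin (2 * n + 1)))

/-- The ACH condition for a metric `h` defined near `{0} × M` in `[0, ∞) × M`, with the contact form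
`θ`. With `Z_∞ = r ∂_r`, `Z_0 = r² T`, `Z_α = r Z` and `Z_β = r W`, for the Reeb field `T` and local
sections `Z = A + iB` and `W = A' + iB'` of `T^{1,0}`, the boundary values, i.e. the limits from
`r > 0`, of the components of `h` are
`h_∞∞ = 4, h_∞0 = 0, h_∞α = 0, h_00 = 1, h_0α = 0, h_αβ̄ = L_θ(Z, W̄), h_αβ = 0`. -/
structure IsACHOnCollar
    (T10 : ∀ q : M, Submodule ℂ (ℂ ⊗[ℝ] TangentSpace (𝓡 (2 * n + 1)) q))
    (θ : ∀ q : M, TangentSpace (𝓡 (2 * n + 1)) q →L[ℝ] ℝ)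
    (T : ∀ q : M, TangentSpace (𝓡 (2 * n + 1)) q)
    (h : ∀ y : EuclideanHalfSpace 1 × M,
      TangentSpace (collarModel n) y → TangentSpace (collarModel n) y → ℝ) : Prop where
  inf_inf : ∀ q : M, Tendsto (fun y => h y (Zinf y) (Zinf y))
    (𝓝[{y | 0 < rad y}] (0, q)) (𝓝 4)
  inf_zero : ∀ q : M, Tendsto (fun y => h y (Zinf y) (radPow 2 T y))
    (𝓝[{y | 0 < rad y}] (0, q)) (𝓝 0)
  zero_zero : ∀ q : M, Tendsto (fun y => h y (radPow 2 T y) (radPow 2 T y))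
    (𝓝[{y | 0 < rad y}] (0, q)) (𝓝 1)
  inf_alpha : ∀ O : Set M, IsOpen O → ∀ A B : ∀ q : M, TangentSpace (𝓡 (2 * n + 1)) q,
    IsSection T10 O A B → ∀ q ∈ O,
    Tendsto (fun y => bilC (h y) (Zinf y) 0 (radPow 1 A y) (radPow 1 B y))
      (𝓝[{y | 0 < rad y}] (0, q)) (𝓝 0)
  zero_alpha : ∀ O : Set M, IsOpen O → ∀ A B : ∀ q : M, TangentSpace (𝓡 (2 * n + 1)) q,
    IsSection T10 O A B → ∀ q ∈ O,
    Tendsto (fun y => bilC (h y) (radPow 2 T y) 0 (radPow 1 A y) (radPow 1 B y))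
      (𝓝[{y | 0 < rad y}] (0, q)) (𝓝 0)
  alpha_betaBar : ∀ O : Set M, IsOpen O →
    ∀ A B A' B' : ∀ q : M, TangentSpace (𝓡 (2 * n + 1)) q,
    IsSection T10 O A B → IsSection T10 O A' B' → ∀ q ∈ O,
    Tendsto
      (fun y => bilC (h y) (radPow 1 A y) (radPow 1 B y) (radPow 1 A' y) (-radPow 1 B' y))
      (𝓝[{y | 0 < rad y}] (0, q)) (𝓝 (levi θ A B A' B' q))
  alpha_beta : ∀ O : Set M, IsOpen O →
    ∀ A B A' B' : ∀ q : M, TangentSpace (𝓡 (2 * n + 1)) q,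
    IsSection T10 O A B → IsSection T10 O A' B' → ∀ q ∈ O,
    Tendsto
      (fun y => bilC (h y) (radPow 1 A y) (radPow 1 B y) (radPow 1 A' y) (radPow 1 B' y))
      (𝓝[{y | 0 < rad y}] (0, q)) (𝓝 0)

end Collar

/-! ### Θ-manifolds, Θ-metrics, ACH metrics

`X` is a manifold with boundary of dimension `2n+2`, and `ι : M → X` is the inclusion of its
boundary. -/

section Theta

variable {n : ℕ} {X : Type*} [TopologicalSpace X]
  [ChartedSpace (EuclideanHalfSpace (2 * n + 2)) X] [IsManifold (𝓡∂ (2 * n + 2)) ∞ X]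
  {M : Type*} [TopologicalSpace M]
  [ChartedSpace (EuclideanSpace ℝ (Fin (2 * n + 1))) M] [IsManifold (𝓡 (2 * n + 1)) ∞ M]

/-- `ι` identifies `M`, as a smooth manifold, with the boundary of `X`. -/
structure IsBoundaryInclusion (ι : M → X) : Prop where
  embedding : Manifold.IsSmoothEmbedding (𝓡 (2 * n + 1)) (𝓡∂ (2 * n + 2)) ∞ ι
  range_eq : Set.range ι = (𝓡∂ (2 * n + 2)).boundary X

/-- The differential of `ι` at `q`. -/
def dι (ι : M → X) (q : M) :
    TangentSpace (𝓡 (2 * n + 1)) q →L[ℝ] TangentSpace (𝓡∂ (2 * n + 2)) (ι q) :=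
  mfderiv (𝓡 (2 * n + 1)) (𝓡∂ (2 * n + 2)) ι q

/-- `Θ` represents a Θ-structure on `X`: a smooth section of `T*X` along the boundary whose
pullback to the boundary vanishes nowhere. The Θ-structure itself is the class of `Θ` modulo
multiplication by positive functions, and the notions below depend on this class only. -/
structure IsThetaStructure (ι : M → X)
    (Θ : ∀ q : M, TangentSpace (𝓡∂ (2 * n + 2)) (ι q) →L[ℝ] ℝ) : Prop where
  smooth : ContMDiff (𝓡 (2 * n + 1))
    ((𝓡∂ (2 * n + 2)).prod 𝓘(ℝ, EuclideanSpace ℝ (Fin (2 * n + 2)) →L[ℝ] ℝ)) ∞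
    (fun q : M => TotalSpace.mk' (EuclideanSpace ℝ (Fin (2 * n + 2)) →L[ℝ] ℝ)
      (E := fun p : X => TangentSpace (𝓡∂ (2 * n + 2)) p →L[ℝ] ℝ) (ι q) (Θ q))
  pullback_ne_zero : ∀ q, (Θ q).comp (dι ι q) ≠ 0

/-- `ρ` is a defining function of `X`. -/
structure IsDefiningFunction (ρ : X → ℝ) : Prop where
  smooth : ContMDiff (𝓡∂ (2 * n + 2)) 𝓘(ℝ, ℝ) ∞ ρ
  pos_iff : ∀ p, 0 < ρ p ↔ (𝓡∂ (2 * n + 2)).IsInteriorPoint p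
  deriv_ne_zero : ∀ p ∈ (𝓡∂ (2 * n + 2)).boundary X, mvfderiv (𝓡∂ (2 * n + 2)) ρ p ≠ 0

/-- Indices of a frame `(N, T, Y_1, …, Y_{2n})` of `TX`. -/
abbrev FrameIndex (n : ℕ) := Unit ⊕ Unit ⊕ Fin (2 * n)

/-- The vectors `(a N, b T, c Y_1, …, c Y_{2n})` at `p`. -/
def scaledFrame (a b c : ℝ) (N T : ∀ p : X, TangentSpace (𝓡∂ (2 * n + 2)) p)
    (Y : Fin (2 * n) → ∀ p : X, TangentSpace (𝓡∂ (2 * n + 2)) p) (p : X) :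
    FrameIndex n → TangentSpace (𝓡∂ (2 * n + 2)) p :=
  Sum.elim (fun _ => a • N p) (Sum.elim (fun _ => b • T p) (fun i => c • Y i p))

/-- `(N, T, Y_1, …, Y_{2n})` is a local frame of `TX` over `U` adapted to the Θ-structure: at the
boundary, `N` is annihilated by `Θ`, the fields `T, Y_1, …, Y_{2n}` are tangent to the boundary, and
`Y_1, …, Y_{2n}` span the kernel of the pullback of `Θ`. (The last condition amounts to `Θ(Y_i) = 0`
since the `2n` fields `Y_i` are linearly independent.) -/
structure IsAdaptedFrame (ι : M → X)
    (Θ : ∀ q : M, TangentSpace (𝓡∂ (2 * n + 2)) (ι q) →L[ℝ] ℝ) (U : Set X)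
    (N T : ∀ p : X, TangentSpace (𝓡∂ (2 * n + 2)) p)
    (Y : Fin (2 * n) → ∀ p : X, TangentSpace (𝓡∂ (2 * n + 2)) p) : Prop where
  smooth_N : SmoothVF (𝓡∂ (2 * n + 2)) U N
  smooth_T : SmoothVF (𝓡∂ (2 * n + 2)) U T
  smooth_Y : ∀ i, SmoothVF (𝓡∂ (2 * n + 2)) U (Y i)
  linearIndependent : ∀ p ∈ U, LinearIndependent ℝ (scaledFrame 1 1 1 N T Y p)
  N_theta : ∀ q, ι q ∈ U → Θ q (N (ι q)) = 0
  T_tangent : ∀ q, ι q ∈ U → T (ι q) ∈ Set.range (dι ι q)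
  Y_tangent : ∀ q, ι q ∈ U → ∀ i, Y i (ι q) ∈ Set.range (dι ι q)
  Y_theta : ∀ q, ι q ∈ U → ∀ i, Θ q (Y i (ι q)) = 0

/-- `g` is a Θ-metric on `X`, i.e. a smooth bundle metric of the Θ-tangent bundle, which is the
bundle over `X` with the local frames `(ρ N, ρ² T, ρ Y_1, …, ρ Y_{2n})`, for `(N, T, Y_i)` an
adapted frame and `ρ` a defining function. It is given as a Riemannian metric on the interior of `X`
whose matrix in each of these frames extends, smoothly and positive definite, to the boundary.
(The values of `g` at boundary points, as a form on `TX`, play no role.) -/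
structure IsThetaMetric (ι : M → X)
    (Θ : ∀ q : M, TangentSpace (𝓡∂ (2 * n + 2)) (ι q) →L[ℝ] ℝ)
    (g : ∀ p : X, TangentSpace (𝓡∂ (2 * n + 2)) p →L[ℝ]
      TangentSpace (𝓡∂ (2 * n + 2)) p →L[ℝ] ℝ) : Prop where
  interior : IsRiemannianMetricOn (𝓡∂ (2 * n + 2)) ((𝓡∂ (2 * n + 2)).interior X) g
  extends_to_boundary : ∀ ρ : X → ℝ, IsDefiningFunction (n := n) ρ →
    ∀ U : Set X, IsOpen U → ∀ N T Y, IsAdaptedFrame ι Θ U N T Y →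
    ∃ G : X → Matrix (FrameIndex n) (FrameIndex n) ℝ,
      (∀ i j, ContMDiffOn (𝓡∂ (2 * n + 2)) 𝓘(ℝ, ℝ) ∞ (fun p => G p i j) U) ∧
      (∀ p ∈ U, (G p).PosDef) ∧
      ∀ p ∈ U, (𝓡∂ (2 * n + 2)).IsInteriorPoint p → ∀ i j,
        G p i j = g p (scaledFrame (ρ p) (ρ p ^ 2) (ρ p) N T Y p i)
          (scaledFrame (ρ p) (ρ p ^ 2) (ρ p) N T Y p j)

/-- `g` is an ACH metric on the Θ-manifold `(X, [Θ])`, with CR structure at infinity `T10`. -/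
structure IsACHMetric (ι : M → X)
    (Θ : ∀ q : M, TangentSpace (𝓡∂ (2 * n + 2)) (ι q) →L[ℝ] ℝ)
    (g : ∀ p : X, TangentSpace (𝓡∂ (2 * n + 2)) p →L[ℝ]
      TangentSpace (𝓡∂ (2 * n + 2)) p →L[ℝ] ℝ)
    (T10 : ∀ q : M, Submodule ℂ (ℂ ⊗[ℝ] TangentSpace (𝓡 (2 * n + 1)) q)) : Prop where
  thetaMetric : IsThetaMetric ι Θ g
  /-- `T10` is a partially integrable CR structure on the boundary ... -/
  cr : IsPartiallyIntegrableCR T10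
  /-- ... compatible with the Θ-structure. -/
  compatible : IsContactForm T10 (fun q => (Θ q).comp (dι ι q))
  /-- There are a contact form `θ` with Reeb field `T` and a diffeomorphism `Ψ` from an open
  neighborhood of `{0} × M` in `[0, ∞) × M` to an open subset of `X`, with `Ψ(0, q) = ι q`, which
  preserves the Θ-structures (the one of `[0, ∞) × M` being the class of the pullback of `θ`), such
  that `Ψ^* g` satisfies the ACH condition on the collar. -/
  collar : ∃ (θ : ∀ q : M, TangentSpace (𝓡 (2 * n + 1)) q →L[ℝ] ℝ)
    (T : ∀ q : M, TangentSpace (𝓡 (2 * n + 1)) q)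
    (Ψ : PartialDiffeomorph (collarModel n) (𝓡∂ (2 * n + 2)) (EuclideanHalfSpace 1 × M) X ∞),
    IsContactForm T10 θ ∧ IsReeb θ T ∧
    (∀ q : M, ((0 : EuclideanHalfSpace 1), q) ∈ Ψ.source ∧ Ψ (0, q) = ι q) ∧
    (∀ q : M, ∃ c : ℝ, 0 < c ∧ ∀ (a : EuclideanSpace ℝ (Fin 1))
      (v : EuclideanSpace ℝ (Fin (2 * n + 1))),
      Θ q (mfderiv (collarModel n) (𝓡∂ (2 * n + 2)) Ψ (0, q) (a, v)) = c * θ q v) ∧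
    IsACHOnCollar T10 θ T (fun y v w =>
      g (Ψ y) (mfderiv (collarModel n) (𝓡∂ (2 * n + 2)) Ψ y v)
        (mfderiv (collarModel n) (𝓡∂ (2 * n + 2)) Ψ y w))

/-- The function `ρ` is normalized by `θ`: the continuous extension to the boundary of the tensor
`ρ⁴ g` pulls back to `θ ⊗ θ` on the boundary. -/
def IsNormalizedBy (ι : M → X)
    (g : ∀ p : X, TangentSpace (𝓡∂ (2 * n + 2)) p →L[ℝ]
      TangentSpace (𝓡∂ (2 * n + 2)) p →L[ℝ] ℝ)
    (ρ : X → ℝ) (θ : ∀ q : M, TangentSpace (𝓡 (2 * n + 1)) q →L[ℝ] ℝ) : Prop :=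
  ∀ (q : M) (v w : TangentSpace (𝓡 (2 * n + 1)) q),
    ∀ U : Set X, IsOpen U → ι q ∈ U → ∀ V W : ∀ p : X, TangentSpace (𝓡∂ (2 * n + 2)) p,
      SmoothVF (𝓡∂ (2 * n + 2)) U V → SmoothVF (𝓡∂ (2 * n + 2)) U W →
      V (ι q) = dι ι q v → W (ι q) = dι ι q w →
      Tendsto (fun p => ρ p ^ 4 * g p (V p) (W p))
        (𝓝[(𝓡∂ (2 * n + 2)).interior X] (ι q)) (𝓝 (θ q v * θ q w))

/-- The function `u` on the interior of `X` is `O(x ^ a)`, where `x = 2 ρ²`: it is the product of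
`x ^ a` with a function that is smooth on `X` up to the boundary. -/
def IsOPow (n : ℕ) {X : Type*} [TopologicalSpace X]
    [ChartedSpace (EuclideanHalfSpace (2 * n + 2)) X] (ρ : X → ℝ) (a : ℝ) (u : X → ℝ) : Prop :=
  ∃ f : X → ℝ, ContMDiff (𝓡∂ (2 * n + 2)) 𝓘(ℝ, ℝ) ∞ f ∧
    ∀ p, (𝓡∂ (2 * n + 2)).IsInteriorPoint p → u p = (2 * ρ p ^ 2) ^ a * f p

end Theta

end

end ACH

/-! Let `σ` be a defining function equal to the collar coordinate `r` near `M`. Every other defining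
function is `σ e^u` with `u` smooth up to `M`, and `log (2 (σ e^u)²) = log 2 + 2 log σ + 2 u`. The
equation is therefore linear in `u`: `2 Δ u = m - 2 Δ log σ` modulo `σ^(2n+2)`, since `x^m` is
`σ^(2m)` up to a smooth positive factor. The normalization prescribes `u` on `M`.

Everything rests on the leading part of `Δ` at `M`. In the frame `(r ∂_r, r² T, r Y_i)` the Gram
matrix is smooth and positive definite up to `M`, and there its `r ∂_r` row is `(4, 0, …, 0)`.
Bracketing with `r ∂_r` multiplies the other fields by their weights `2, 1, …, 1`, so `div (r ∂_r) =
-(2n+2)` on `M`, while the divergences of the other fields vanish on `M`. Hence `Δ (σ^k u) = σ^k (-k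
(k - (2n+2)) / 4 · u + O(σ))` and `Δ log σ = (n+1)/2 + O(σ)`. The computation is
`IsWeightedFrame.exists_laplacian_eq`; its global forms are `IsACHCollar.exists_laplacian_pow_mul`
and `IsACHCollar.exists_laplacian_log`.

The indicial roots are thus `0` and `2n+2`. The root `0` leaves `u` free on `M`, which is where the
normalization enters: it says `e^(4u) = θ(T)²` for the Reeb field `T` of the collar's contact form.
For `0 < k < 2n+2` the indicial factor is nonzero. So an error of order `k` is removed by adding
some `σ^k b` to `u` (`IsACHCollar.exists_approximate_solution`). Conversely, a function vanishing on
`M` whose Laplacian is `O(σ^(2n+2))` is itself `O(σ^(2n+2))`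
(`IsACHCollar.exists_eq_pow_mul_of_laplacian`). Applied to `u₁ - u₂`, this gives uniqueness, and the
prefactor `σ` accounts for the extra order in `ρ₁ - ρ₂`.

Each induction step divides by `σ` a smooth function that vanishes on `M`. The quotient is smooth up
to the boundary by Hadamard's lemma on half-balls, glued over the collar
(`IsCollarFunction.exists_eq_mul`). -/

namespace ACH

noncomputable section

/-! ### Smoothness of derivatives, brackets and frame coefficients -/

section FrameLaplacian

variable {d : ℕ} {H : Type*} [TopologicalSpace H]
  {I : ModelWithCorners ℝ (EuclideanSpace ℝ (Fin d)) H}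
  {N : Type*} [TopologicalSpace N] [ChartedSpace H N]

variable {κ : Type*} [Fintype κ] [DecidableEq κ]

theorem contMDiffOn_matrix_inv {U : Set N} {G : N → Matrix κ κ ℝ}
    (hG : ∀ i j, ContMDiffOn I 𝓘(ℝ, ℝ) ∞ (fun p => G p i j) U)
    (hdet : ∀ p ∈ U, (G p).det ≠ 0) (i j : κ) :
    ContMDiffOn I 𝓘(ℝ, ℝ) ∞ (fun p => (G p)⁻¹ i j) U := by
  have hd : ContMDiffOn I 𝓘(ℝ, ℝ) ∞ (fun p => (G p).det) U := by
    simp only [Matrix.det_apply]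
    refine contMDiffOn_finsetSum fun σ _ => ?_
    simp only [Units.smul_def, zsmul_eq_mul]
    exact contMDiffOn_const.mul (contMDiffOn_finsetProd fun i _ => hG _ _)
  have ha : ContMDiffOn I 𝓘(ℝ, ℝ) ∞ (fun p => (G p).adjugate i j) U := by
    simp only [Matrix.adjugate_apply, Matrix.det_apply]
    refine contMDiffOn_finsetSum fun σ _ => ?_
    simp only [Units.smul_def, zsmul_eq_mul]
    refine contMDiffOn_const.mul (contMDiffOn_finsetProd fun k _ => ?_)
    by_cases h : σ k = j
    · simp only [Matrix.updateRow_apply, h, if_true]; exact contMDiffOn_const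
    · simp only [Matrix.updateRow_apply, h, if_false]; exact hG _ _
  refine ((hd.inv₀ hdet).mul ha).congr fun p hp => ?_
  simp [Matrix.inv_def]

variable [IsManifold I ∞ N]

/-- The function `df(V)` is the fibre component of the tangent map of `f` composed with the section
`V`. -/
theorem SmoothVF.contMDiffOn_mvfderiv {U : Set N} (hU : IsOpen U)
    {V : ∀ p : N, TangentSpace I p} (hV : SmoothVF I U V) {f : N → ℝ}
    (hf : ContMDiffOn I 𝓘(ℝ, ℝ) ∞ f U) :
    ContMDiffOn I 𝓘(ℝ, ℝ) ∞ (fun p => mvfderiv I f p (V p)) U := by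
  have h1 := hf.contMDiffOn_tangentMapWithin (m := ∞) (by simp) hU.uniqueMDiffOn
  have h2 := h1.comp hV (fun p hp => hp)
  have h3 := (contMDiff_snd_tangentBundle_modelSpace ℝ 𝓘(ℝ, ℝ) (n := ∞)).comp_contMDiffOn h2
  refine h3.congr fun p hp => ?_
  simp only [Function.comp, tangentMapWithin, mvfderiv]
  rw [mfderivWithin_of_isOpen hU hp]
  rfl

theorem SmoothVF.mono {U U' : Set N} {V : ∀ p : N, TangentSpace I p} (hV : SmoothVF I U V)
    (h : U' ⊆ U) : SmoothVF I U' V := ContMDiffOn.mono hV h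

theorem SmoothVF.smul {U : Set N} {V : ∀ p : N, TangentSpace I p} (hV : SmoothVF I U V)
    {f : N → ℝ} (hf : ContMDiffOn I 𝓘(ℝ, ℝ) ∞ f U) : SmoothVF I U (f • V) :=
  ContMDiffOn.smul_section hf hV

theorem SmoothVF.mlieBracket {U : Set N} (hU : IsOpen U) {V W : ∀ p : N, TangentSpace I p}
    (hV : SmoothVF I U V) (hW : SmoothVF I U W) :
    SmoothVF I U (VectorField.mlieBracket I V W) := by
  intro p hp
  have : IsManifold I ((⊤ : ℕ∞) + 1) N := by
    convert! (inferInstance : IsManifold I ∞ N)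
  have : IsManifold I (minSmoothness ℝ 2) N := by
    rw [minSmoothness_of_isRCLikeNormedField]
    exact IsManifold.of_le (n := ∞) (WithTop.coe_le_coe.2 le_top)
  exact (ContMDiffAt.mlieBracket_vectorField (m := ⊤) (n := ⊤)
    (hV.contMDiffAt (hU.mem_nhds hp)) (hW.contMDiffAt (hU.mem_nhds hp))
      (by simp)).contMDiffWithinAt

/-- The matrix `P` passing from `F` to a trivialization frame is smooth and invertible. The
coefficients in `F` are `P⁻¹` applied to the coefficients in the trivialization, which are known to
be smooth. -/
theorem _root_.IsLocalFrameOn.contMDiffOn_coeff {F : κ → ∀ p : N, TangentSpace I p} {U : Set N}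
    (hF : IsLocalFrameOn I (EuclideanSpace ℝ (Fin d)) ∞ F U) (hU : IsOpen U)
    {V : ∀ p : N, TangentSpace I p} (hV : SmoothVF I U V) (k : κ) :
    ContMDiffOn I 𝓘(ℝ, ℝ) ∞ (fun p => hF.coeff k p (V p)) U := by
  intro p₀ hp₀
  let e := trivializationAt (EuclideanSpace ℝ (Fin d)) (TangentSpace I : N → Type _) p₀
  let b₀ := hF.toBasisAt hp₀
  -- The tangent space at `p₀` is the model space, so the frame at `p₀` supplies a basis indexed by
  -- `κ` and the change of frame becomes a square matrix.
  have b : Module.Basis κ ℝ (EuclideanSpace ℝ (Fin d)) := b₀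
  let U' := U ∩ e.baseSet
  have hU' : IsOpen U' := hU.inter e.open_baseSet
  have hp' : p₀ ∈ U' := ⟨hp₀, FiberBundle.mem_baseSet_trivializationAt' p₀⟩
  let c : (∀ p : N, TangentSpace I p) → κ → N → ℝ := fun W i p => e.localFrameCoeff I b i p (W p)
  have hc : ∀ W, SmoothVF I U W → ∀ i, ContMDiffOn I 𝓘(ℝ, ℝ) ∞ (c W i) U' := fun W hW i =>
    contMDiffOn_localFrameCoeff b hU' Set.inter_subset_right (ContMDiffOn.mono hW Set.inter_subset_left) i
  let P : N → Matrix κ κ ℝ := fun p => Matrix.of fun i j => c (F j) i p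
  have hP : ∀ p ∈ U', ∀ W : ∀ p : N, TangentSpace I p,
      (fun i => c W i p) = (P p).mulVec (fun j => hF.coeff j p (W p)) := by
    intro p hp W
    ext i
    have h := hF.coeff_sum_eq W hp.1
    simp only [c, P, Matrix.mulVec, dotProduct, Matrix.of_apply]
    conv_lhs => rw [h]
    simp [map_sum, mul_comm]
  have hdet : ∀ p ∈ U', (P p).det ≠ 0 := by
    intro p hp hdet
    obtain ⟨v, hv, hv0⟩ := Matrix.exists_mulVec_eq_zero_iff.2 hdet
    apply hv
    have h1 := hP p hp (fun q => ∑ j, v j • F j q)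
    have h2 : (fun j => hF.coeff j p (∑ j, v j • F j p)) = v := by
      ext j
      simp only [map_sum, map_smul]
      have : ∀ i, hF.coeff j p (F i p) = if i = j then 1 else 0 := by
        intro i
        rw [hF.coeff_apply_of_mem hp.1 (F i), ← hF.toBasisAt_coe hp.1 i, Module.Basis.repr_self]
        simp [Finsupp.single_apply]
      simp [this]
    rw [h2, hv0] at h1
    have h3 : (∑ j, v j • F j p) = 0 := by
      have := e.eq_sum_localFrameCoeff_smul (I := I) (b := b) (s := fun q => ∑ j, v j • F j q) hp.2
      refine this.trans ?_
      refine Finset.sum_eq_zero fun i _ => ?_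
      have h4 := congrFun h1 i
      simp only [c, Pi.zero_apply] at h4
      rw [h4, zero_smul]
    rw [← h2, h3]; ext j; simp
  have hco : ∀ p ∈ U', hF.coeff k p (V p) = ∑ i, (P p)⁻¹ k i * c V i p := by
    intro p hp
    have h1 := hP p hp V
    have h2 : (P p)⁻¹.mulVec (fun i => c V i p) = fun j => hF.coeff j p (V p) := by
      rw [h1, Matrix.mulVec_mulVec, Matrix.nonsing_inv_mul _ (hdet p hp).isUnit, Matrix.one_mulVec]
    rw [← congrFun h2 k]; rfl
  have hs : ContMDiffOn I 𝓘(ℝ, ℝ) ∞ (fun p => ∑ i, (P p)⁻¹ k i * c V i p) U' :=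
    contMDiffOn_finsetSum fun i _ =>
      (contMDiffOn_matrix_inv (fun i j => hc _ (hF.contMDiffOn j) i) hdet k i).mul (hc V hV i)
  exact ((hs.congr hco).contMDiffAt (hU'.mem_nhds hp')).contMDiffWithinAt

end FrameLaplacian

/-! ### Gradients and metric traces do not depend on the basis -/

section LinearAlgebra

variable {V : Type*} [AddCommGroup V] [Module ℝ V] [TopologicalSpace V]
  {κ : Type*} [Fintype κ] {κ' : Type*} [Fintype κ']

/-- `g` is an inner product. -/
structure IsInner (g : V →L[ℝ] V →L[ℝ] ℝ) : Prop where
  symm : ∀ v w, g v w = g w v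
  pos : ∀ v, v ≠ 0 → 0 < g v v

/-- The Gram matrix of a bilinear form with respect to a family of vectors. -/
def gramMatrix (g : V →L[ℝ] V →L[ℝ] ℝ) (b : κ → V) : Matrix κ κ ℝ :=
  Matrix.of fun i j => g (b i) (b j)

theorem IsInner.posDef_gramMatrix {g : V →L[ℝ] V →L[ℝ] ℝ} (hg : IsInner g) {b : κ → V}
    (hb : LinearIndependent ℝ b) : (gramMatrix g b).PosDef := by
  refine Matrix.PosDef.of_dotProduct_mulVec_pos ?_ ?_
  · ext i j
    simp [gramMatrix, Matrix.conjTranspose_apply, hg.symm]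
  · intro x hx
    have h : star x ⬝ᵥ (gramMatrix g b).mulVec x = g (∑ i, x i • b i) (∑ i, x i • b i) := by
      simp [gramMatrix, dotProduct, Matrix.mulVec, map_sum, Finset.mul_sum, mul_comm]
      rw [Finset.sum_comm]
      refine Finset.sum_congr rfl fun i _ => Finset.sum_congr rfl fun j _ => by rw [hg.symm]; ring
    rw [h]
    apply hg.pos
    intro h0
    exact hx (funext (Fintype.linearIndependent_iff.1 hb x h0))

theorem IsInner.eq_of_forall_apply_eq {g : V →L[ℝ] V →L[ℝ] ℝ} (hg : IsInner g) {v w : V}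
    (h : ∀ u, g v u = g w u) : v = w := by
  by_contra hne
  have h1 := hg.pos (v - w) (sub_ne_zero.2 hne)
  have h2 := h (v - w)
  have h3 : g (v - w) (v - w) = g v (v - w) - g w (v - w) := by simp
  rw [h3, h2, sub_self] at h1
  exact lt_irrefl _ h1

variable [DecidableEq κ] [DecidableEq κ']

/-- The vector dual to the linear form `α` with respect to `g`, computed in the family `b`. -/
def sharp (g : V →L[ℝ] V →L[ℝ] ℝ) (b : κ → V) (α : V →L[ℝ] ℝ) : V :=
  ∑ i, ∑ j, ((gramMatrix g b)⁻¹ i j * α (b j)) • b i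

theorem IsInner.sharp_apply {g : V →L[ℝ] V →L[ℝ] ℝ} (hg : IsInner g) (b : Module.Basis κ ℝ V)
    (α : V →L[ℝ] ℝ) (w : V) : g (sharp g b α) w = α w := by
  have hdet := (hg.posDef_gramMatrix b.linearIndependent).det_pos.ne'
  have hl : (g (sharp g b α) : V →ₗ[ℝ] ℝ) = (α : V →ₗ[ℝ] ℝ) := by
    refine b.ext fun k => ?_
    have hmul := Matrix.mul_nonsing_inv _ hdet.isUnit
    have : ∀ j, ∑ i, gramMatrix g b k i * (gramMatrix g b)⁻¹ i j = if k = j then 1 else 0 := by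
      intro j
      have := congrFun (congrFun hmul k) j
      rwa [Matrix.mul_apply, Matrix.one_apply] at this
    have h2 : ∀ i, g (b i) (b k) = gramMatrix g b k i := fun i => by simp [gramMatrix, hg.symm]
    simp only [sharp, map_sum, map_smul, ContinuousLinearMap.coe_coe, FunLike.coe_sum,
      Finset.sum_apply, FunLike.coe_smul, Pi.smul_apply, smul_eq_mul, h2]
    rw [Finset.sum_comm]
    calc _ = ∑ j, (∑ i, gramMatrix g b k i * (gramMatrix g b)⁻¹ i j) * α (b j) := by
          refine Finset.sum_congr rfl fun j _ => ?_
          rw [Finset.sum_mul]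
          exact Finset.sum_congr rfl fun i _ => by ring
      _ = _ := by simp [this]
  exact LinearMap.congr_fun hl w

theorem IsInner.sharp_eq_sharp {g : V →L[ℝ] V →L[ℝ] ℝ} (hg : IsInner g) (b : Module.Basis κ ℝ V)
    (b' : Module.Basis κ' ℝ V) (α : V →L[ℝ] ℝ) : sharp g b α = sharp g b' α :=
  hg.eq_of_forall_apply_eq fun u => by rw [hg.sharp_apply, hg.sharp_apply]

/-- The endomorphism representing the bilinear form `β` with respect to `g`. -/
def sharpMap (g β : V →L[ℝ] V →L[ℝ] ℝ) (b : κ → V) : V →ₗ[ℝ] V where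
  toFun v := sharp g b (β v)
  map_add' v w := by simp [sharp, mul_add, add_smul, Finset.sum_add_distrib]
  map_smul' c v := by
    simp only [sharp, map_smul, FunLike.coe_smul, Pi.smul_apply, smul_eq_mul, RingHom.id_apply,
      Finset.smul_sum, smul_smul]
    exact Finset.sum_congr rfl fun i _ => Finset.sum_congr rfl fun j _ => by ring_nf

theorem trace_sharpMap (g β : V →L[ℝ] V →L[ℝ] ℝ) (b : Module.Basis κ ℝ V) :
    LinearMap.trace ℝ V (sharpMap g β b) =
      ∑ i, ∑ j, (gramMatrix g b)⁻¹ i j * β (b i) (b j) := by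
  rw [LinearMap.trace_eq_matrix_trace ℝ b, Matrix.trace]
  refine Finset.sum_congr rfl fun i _ => ?_
  simp [LinearMap.toMatrix_apply, sharpMap, sharp, Finsupp.single_apply]

/-- Both sums are the trace of one endomorphism, the one that represents `β` with respect to `g`. -/
theorem IsInner.sum_inv_gramMatrix_mul_eq {g : V →L[ℝ] V →L[ℝ] ℝ} (hg : IsInner g)
    (b : Module.Basis κ ℝ V) (b' : Module.Basis κ' ℝ V) (β : V →L[ℝ] V →L[ℝ] ℝ) :
    ∑ i, ∑ j, (gramMatrix g b)⁻¹ i j * β (b i) (b j) =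
      ∑ i, ∑ j, (gramMatrix g b')⁻¹ i j * β (b' i) (b' j) := by
  rw [← trace_sharpMap, ← trace_sharpMap]
  congr 1
  ext v
  exact hg.sharp_eq_sharp b b' (β v)

end LinearAlgebra

/-! ### Tensoriality of the Lie derivative of a metric, and the divergence in any basis -/

section FrameLaplacian

variable {d : ℕ} {H : Type*} [TopologicalSpace H]
  {I : ModelWithCorners ℝ (EuclideanSpace ℝ (Fin d)) H}
  {N : Type*} [TopologicalSpace N] [ChartedSpace H N] [IsManifold I ∞ N]
  {g : ∀ p : N, TangentSpace I p →L[ℝ] TangentSpace I p →L[ℝ] ℝ}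

theorem IsRiemannianMetricOn.isInner {U : Set N} (hg : IsRiemannianMetricOn I U g) {p : N}
    (hp : p ∈ U) : IsInner (g p) := ⟨hg.symm p hp, hg.pos p hp⟩

theorem IsRiemannianMetricOn.mdifferentiableAt {U : Set N} (hg : IsRiemannianMetricOn I U g)
    (hU : IsOpen U) {p : N} (hp : p ∈ U) {A B : ∀ p : N, TangentSpace I p}
    (hA : MDifferentiableAt I I.tangent (fun p => (⟨p, A p⟩ : TangentBundle I N)) p)
    (hB : MDifferentiableAt I I.tangent (fun p => (⟨p, B p⟩ : TangentBundle I N)) p) :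
    MDifferentiableAt I 𝓘(ℝ, ℝ) (fun q => g q (A q) (B q)) p := by
  have : MDifferentiableAt I (I.prod 𝓘(ℝ))
      (fun m ↦ TotalSpace.mk' ℝ (E := Bundle.Trivial N ℝ) m (g m (A m) (B m))) p := by
    apply MDifferentiableAt.clm_bundle_apply₂ (F₁ := EuclideanSpace ℝ (Fin d))
      (F₂ := EuclideanSpace ℝ (Fin d))
    · exact (hg.smooth.contMDiffAt (hU.mem_nhds hp)).mdifferentiableAt (by simp)
    · exact hA
    · exact hB
  simp only [mdifferentiableAt_totalSpace] at this
  exact this.2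

theorem IsRiemannianMetricOn.contMDiffOn {U : Set N} (hg : IsRiemannianMetricOn I U g)
    {A B : ∀ p : N, TangentSpace I p} (hA : SmoothVF I U A) (hB : SmoothVF I U B) :
    ContMDiffOn I 𝓘(ℝ, ℝ) ∞ (fun q => g q (A q) (B q)) U := by
  intro p hp
  have : ContMDiffWithinAt I (I.prod 𝓘(ℝ)) ∞
      (fun m ↦ TotalSpace.mk' ℝ (E := Bundle.Trivial N ℝ) m (g m (A m) (B m))) U p := by
    apply ContMDiffWithinAt.clm_bundle_apply₂ (F₁ := EuclideanSpace ℝ (Fin d))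
      (F₂ := EuclideanSpace ℝ (Fin d))
    · exact hg.smooth p hp
    · exact hA p hp
    · exact hB p hp
  simp only [contMDiffWithinAt_totalSpace] at this
  exact this.2

/-- When `A` is replaced by `f A`, the term `V(f) g(A, B)` from the derivative cancels the one from
`[V, f A]`. -/
theorem tensorialAt_lieDerivMetric_left {U : Set N} (hg : IsRiemannianMetricOn I U g)
    (hU : IsOpen U) {p : N} (hp : p ∈ U) {V B : ∀ p : N, TangentSpace I p}
    (hB : MDifferentiableAt I I.tangent (fun p => (⟨p, B p⟩ : TangentBundle I N)) p) :
    TensorialAt I (EuclideanSpace ℝ (Fin d)) (fun A => lieDerivMetric I g V A B p) p := by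
  have : IsManifold I 2 N := IsManifold.of_le (n := ∞) (WithTop.coe_le_coe.2 le_top)
  constructor
  · intro f A hf hA
    simp only [lieDerivMetric]
    rw [VectorField.mlieBracket_smul_right hf hA]
    have h : (fun q => g q ((f • A) q) (B q)) = fun q => f q * g q (A q) (B q) := by
      ext q; simp
    rw [h, mvfderiv_fun_mul hf (hg.mdifferentiableAt hU hp hA hB)]
    simp
    ring
  · intro A A' hA hA'
    simp only [lieDerivMetric]
    rw [VectorField.mlieBracket_add_right hA hA']
    have h : (fun q => g q ((A + A') q) (B q)) = fun q => g q (A q) (B q) + g q (A' q) (B q) := by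
      ext q; simp
    rw [h, mvfderiv_fun_add (hg.mdifferentiableAt hU hp hA hB) (hg.mdifferentiableAt hU hp hA' hB)]
    simp
    ring

theorem tensorialAt_lieDerivMetric_right {U : Set N} (hg : IsRiemannianMetricOn I U g)
    (hU : IsOpen U) {p : N} (hp : p ∈ U) {V A : ∀ p : N, TangentSpace I p}
    (hA : MDifferentiableAt I I.tangent (fun p => (⟨p, A p⟩ : TangentBundle I N)) p) :
    TensorialAt I (EuclideanSpace ℝ (Fin d)) (fun B => lieDerivMetric I g V A B p) p := by
  have : IsManifold I 2 N := IsManifold.of_le (n := ∞) (WithTop.coe_le_coe.2 le_top)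
  constructor
  · intro f B hf hB
    simp only [lieDerivMetric]
    rw [VectorField.mlieBracket_smul_right hf hB]
    have h : (fun q => g q (A q) ((f • B) q)) = fun q => f q * g q (A q) (B q) := by
      ext q; simp
    rw [h, mvfderiv_fun_mul hf (hg.mdifferentiableAt hU hp hA hB)]
    simp
    ring
  · intro B B' hB hB'
    simp only [lieDerivMetric]
    rw [VectorField.mlieBracket_add_right hB hB']
    have h : (fun q => g q (A q) ((B + B') q)) = fun q => g q (A q) (B q) + g q (A q) (B' q) := by
      ext q; simp
    rw [h, mvfderiv_fun_add (hg.mdifferentiableAt hU hp hA hB) (hg.mdifferentiableAt hU hp hA hB')]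
    simp
    ring

/-- The basis of `T_p N` given by the standard basis of the model vector space. -/
def stdBasis (I : ModelWithCorners ℝ (EuclideanSpace ℝ (Fin d)) H) (p : N) :
    Module.Basis (Fin d) ℝ (TangentSpace I p) :=
  (EuclideanSpace.basisFun (Fin d) ℝ).toBasis

omit [IsManifold I ∞ N] in
theorem coe_stdBasis (p : N) : ⇑(stdBasis I p) = stdVec I p := by
  funext i
  change (EuclideanSpace.basisFun (Fin d) ℝ).toBasis i = EuclideanSpace.single i (1 : ℝ)
  simp

omit [IsManifold I ∞ N] in
theorem gram_eq_gramMatrix (p : N) : gram I g p = gramMatrix (g p) (stdBasis I p) := by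
  rw [coe_stdBasis]; rfl

omit [IsManifold I ∞ N] in
theorem grad_eq_sharp (u : N → ℝ) (p : N) :
    grad I g u p = sharp (g p) (stdBasis I p) (mvfderiv I u p) := by
  rw [grad, sharp, gram_eq_gramMatrix, coe_stdBasis]

/-- By tensoriality the Lie derivative of `g` is a bilinear form on `T_p N`, so its metric trace can
be taken in `Z` instead of the standard basis. This frees the divergence from the coordinate
definition. -/
theorem divergence_eq_of_basis {κ : Type*} [Fintype κ] [DecidableEq κ] {U : Set N}
    (hg : IsRiemannianMetricOn I U g) (hU : IsOpen U) {p : N} (hp : p ∈ U)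
    (V : ∀ p : N, TangentSpace I p) (Z : κ → ∀ p : N, TangentSpace I p)
    (hZ : ∀ i, MDifferentiableAt I I.tangent (fun p => (⟨p, Z i p⟩ : TangentBundle I N)) p)
    (b : Module.Basis κ ℝ (TangentSpace I p)) (hb : ∀ i, b i = Z i p) :
    divergence I g V p = (1 / 2) * ∑ i, ∑ j, (gramMatrix (g p) (fun i => Z i p))⁻¹ i j *
      lieDerivMetric I g V (Z i) (Z j) p := by
  have : IsManifold I 1 N := IsManifold.of_le (n := ∞) (WithTop.coe_le_coe.2 le_top)
  let β := TensorialAt.mkHom₂ (fun A B => lieDerivMetric I g V A B p) p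
    (fun B hB => tensorialAt_lieDerivMetric_left hg hU hp hB)
    (fun A hA => tensorialAt_lieDerivMetric_right hg hU hp hA)
  have h1 := (hg.isInner hp).sum_inv_gramMatrix_mul_eq (stdBasis I p) b β
  rw [divergence, gram_eq_gramMatrix]
  have h2 : (b : κ → TangentSpace I p) = fun i => Z i p := funext hb
  rw [h2] at h1
  have h3 : ∀ i j, β (Z i p) (Z j p) = lieDerivMetric I g V (Z i) (Z j) p := fun i j =>
    TensorialAt.mkHom₂_apply _ _ (hZ i) (hZ j)
  simp only [h3] at h1
  rw [← h1, coe_stdBasis]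
  rfl

end FrameLaplacian

/-! ### The Laplacian in a local frame -/

section FrameLaplacian

variable {d : ℕ} {H : Type*} [TopologicalSpace H]
  {I : ModelWithCorners ℝ (EuclideanSpace ℝ (Fin d)) H}
  {N : Type*} [TopologicalSpace N] [ChartedSpace H N]
  {g : ∀ p : N, TangentSpace I p →L[ℝ] TangentSpace I p →L[ℝ] ℝ}
  {κ : Type*} [Fintype κ] [DecidableEq κ]
  {Z : κ → ∀ p : N, TangentSpace I p} {U : Set N}

/-- The Gram matrix of `g` in the frame `Z`. -/
def frameGram (g : ∀ p : N, TangentSpace I p →L[ℝ] TangentSpace I p →L[ℝ] ℝ)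
    (Z : κ → ∀ p : N, TangentSpace I p) (p : N) : Matrix κ κ ℝ :=
  gramMatrix (g p) (fun i => Z i p)

/-- The components of the gradient of `u` in the frame `Z`. -/
def frameGrad (g : ∀ p : N, TangentSpace I p →L[ℝ] TangentSpace I p →L[ℝ] ℝ)
    (Z : κ → ∀ p : N, TangentSpace I p) (u : N → ℝ) (k : κ) (p : N) : ℝ :=
  ∑ l, (frameGram g Z p)⁻¹ k l * mvfderiv I u p (Z l p)

/-- The divergence of the field `Z k` of the frame `Z`. -/
def frameDiv (g : ∀ p : N, TangentSpace I p →L[ℝ] TangentSpace I p →L[ℝ] ℝ)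
    [IsManifold I 1 N] (hZ : IsLocalFrameOn I (EuclideanSpace ℝ (Fin d)) ∞ Z U)
    (k : κ) (p : N) : ℝ :=
  (1 / 2) * ∑ i, ∑ j, (frameGram g Z p)⁻¹ i j * mvfderiv I (fun q => frameGram g Z q i j) p (Z k p)
    - ∑ i, hZ.coeff i p (VectorField.mlieBracket I (Z k) (Z i) p)

variable [IsManifold I ∞ N]

omit [DecidableEq κ] in
theorem mlieBracket_sum_smul {p : N} {f : κ → N → ℝ} {W : ∀ p : N, TangentSpace I p}
    (hf : ∀ k, MDifferentiableAt I 𝓘(ℝ, ℝ) (f k) p)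
    (hZ : ∀ i, MDifferentiableAt I I.tangent (fun p => (⟨p, Z i p⟩ : TangentBundle I N)) p) :
    VectorField.mlieBracket I (fun q => ∑ k, f k q • Z k q) W p =
      ∑ k, (-(mvfderiv I (f k) p (W p)) • Z k p + f k p • VectorField.mlieBracket I (Z k) W p) := by
  classical
  have : IsManifold I 2 N := IsManifold.of_le (n := ∞) (WithTop.coe_le_coe.2 le_top)
  have : IsManifold I 1 N := IsManifold.of_le (n := ∞) (WithTop.coe_le_coe.2 le_top)
  -- Differentiability of the partial sums is carried along the induction because additivity of the
  -- bracket requires it.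
  suffices h : ∀ s : Finset κ,
      MDifferentiableAt I I.tangent
        (fun q => (⟨q, (∑ k ∈ s, f k • Z k) q⟩ : TangentBundle I N)) p ∧
      VectorField.mlieBracket I (∑ k ∈ s, f k • Z k) W p =
      ∑ k ∈ s, (-(mvfderiv I (f k) p (W p)) • Z k p +
        f k p • VectorField.mlieBracket I (Z k) W p) by
    have h1 := (h Finset.univ).2
    have h2 : (∑ k, f k • Z k) = fun q => ∑ k, f k q • Z k q := by
      ext q; simp [Finset.sum_apply]
    rw [← h1, h2]
  intro s
  induction s using Finset.induction_on with
  | empty =>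
    refine ⟨?_, by simp⟩
    simp only [Finset.sum_empty]
    exact (contMDiff_zeroSection ℝ (TangentSpace I : N → Type _) (n := 1)).contMDiffAt.mdifferentiableAt one_ne_zero
  | insert k s hk ih =>
    have h1 : MDifferentiableAt I I.tangent
        (fun q => (⟨q, (f k • Z k) q⟩ : TangentBundle I N)) p := (hf k).smul_section (hZ k)
    rw [Finset.sum_insert hk, Finset.sum_insert hk]
    refine ⟨mdifferentiableAt_add_section h1 ih.1, ?_⟩
    rw [VectorField.mlieBracket_add_left h1 ih.1, ih.2,
      VectorField.mlieBracket_smul_left (hf k) (hZ k)]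

theorem IsRiemannianMetricOn.grad_eq_sum (hg : IsRiemannianMetricOn I U g)
    (hZ : IsLocalFrameOn I (EuclideanSpace ℝ (Fin d)) ∞ Z U) (u : N → ℝ) {p : N} (hp : p ∈ U) :
    grad I g u p = ∑ k, frameGrad g Z u k p • Z k p := by
  rw [grad_eq_sharp, (hg.isInner hp).sharp_eq_sharp (stdBasis I p) (hZ.toBasisAt hp)]
  have h2 : (hZ.toBasisAt hp : κ → TangentSpace I p) = fun i => Z i p :=
    funext fun i => hZ.toBasisAt_coe hp i
  simp only [sharp, frameGrad, frameGram, h2, Finset.sum_smul]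

omit [DecidableEq κ] in
theorem IsRiemannianMetricOn.posDef_frameGram (hg : IsRiemannianMetricOn I U g)
    (hZ : IsLocalFrameOn I (EuclideanSpace ℝ (Fin d)) ∞ Z U) {p : N} (hp : p ∈ U) :
    (frameGram g Z p).PosDef := (hg.isInner hp).posDef_gramMatrix (hZ.linearIndependent hp)

omit [Fintype κ] [DecidableEq κ] in
theorem IsRiemannianMetricOn.contMDiffOn_frameGram (hg : IsRiemannianMetricOn I U g)
    (hZ : IsLocalFrameOn I (EuclideanSpace ℝ (Fin d)) ∞ Z U) (i j : κ) :
    ContMDiffOn I 𝓘(ℝ, ℝ) ∞ (fun q => frameGram g Z q i j) U :=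
  hg.contMDiffOn (hZ.contMDiffOn i) (hZ.contMDiffOn j)

theorem IsRiemannianMetricOn.contMDiffOn_frameGrad (hg : IsRiemannianMetricOn I U g)
    (hU : IsOpen U) (hZ : IsLocalFrameOn I (EuclideanSpace ℝ (Fin d)) ∞ Z U) {u : N → ℝ}
    (hu : ContMDiffOn I 𝓘(ℝ, ℝ) ∞ u U) (k : κ) :
    ContMDiffOn I 𝓘(ℝ, ℝ) ∞ (frameGrad g Z u k) U :=
  contMDiffOn_finsetSum fun l _ =>
    (contMDiffOn_matrix_inv (hg.contMDiffOn_frameGram hZ)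
      (fun _ hp => (hg.posDef_frameGram hZ hp).det_pos.ne') k l).mul
      (SmoothVF.contMDiffOn_mvfderiv hU (hZ.contMDiffOn l) hu)

theorem IsRiemannianMetricOn.sum_inv_frameGram_mul (hg : IsRiemannianMetricOn I U g)
    (hZ : IsLocalFrameOn I (EuclideanSpace ℝ (Fin d)) ∞ Z U) {p : N} (hp : p ∈ U)
    (X : TangentSpace I p) (i : κ) :
    ∑ j, (frameGram g Z p)⁻¹ i j * g p X (Z j p) = hZ.coeff i p X := by
  have hmul := Matrix.nonsing_inv_mul _ (hg.posDef_frameGram hZ hp).det_pos.ne'.isUnit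
  have h1 : ∀ k, ∑ j, (frameGram g Z p)⁻¹ i j * g p (Z k p) (Z j p) = if i = k then 1 else 0 := by
    intro k
    have := congrFun (congrFun hmul i) k
    rw [Matrix.mul_apply, Matrix.one_apply] at this
    rw [← this]
    refine Finset.sum_congr rfl fun j _ => ?_
    rw [hg.symm p hp]; rfl
  have h2 : X = ∑ k, hZ.coeff k p X • Z k p := by
    have := hZ.coeff_sum_eq (FiberBundle.extend (EuclideanSpace ℝ (Fin d)) X) hp
    rwa [FiberBundle.extend_apply_self] at this
  conv_lhs => rw [h2]
  simp only [map_sum, map_smul, FunLike.coe_sum, Finset.sum_apply, FunLike.coe_smul,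
    Pi.smul_apply, smul_eq_mul, Finset.mul_sum]
  rw [Finset.sum_comm]
  calc _ = ∑ k, hZ.coeff k p X * ∑ j, (frameGram g Z p)⁻¹ i j * g p (Z k p) (Z j p) := by
        refine Finset.sum_congr rfl fun k _ => ?_
        rw [Finset.mul_sum]
        exact Finset.sum_congr rfl fun j _ => by ring
    _ = _ := by simp [h1]

/-- With `V = grad u = ∑ v^k Z_k`, the trace of `L_V g` consists of the derivative of the Gram
matrix along `V` and two bracket terms. The bracket terms agree by symmetry, and expanding `[V,
Z_i]` produces the derivatives `-Z_i(v^i)`. What multiplies `v^k` in the remainder is `frameDiv`. -/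
theorem IsRiemannianMetricOn.laplacian_eq (hg : IsRiemannianMetricOn I U g) (hU : IsOpen U)
    (hZ : IsLocalFrameOn I (EuclideanSpace ℝ (Fin d)) ∞ Z U) {u : N → ℝ}
    (hu : ContMDiffOn I 𝓘(ℝ, ℝ) ∞ u U) {p : N} (hp : p ∈ U) :
    laplacian I g u p = -∑ k, (mvfderiv I (frameGrad g Z u k) p (Z k p) +
      frameGrad g Z u k p * frameDiv g hZ k p) := by
  have hZp : ∀ i, MDifferentiableAt I I.tangent (fun p => (⟨p, Z i p⟩ : TangentBundle I N)) p :=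
    fun i => ((hZ.contMDiffOn i).contMDiffAt (hU.mem_nhds hp)).mdifferentiableAt (by simp)
  have hv : ∀ k, MDifferentiableAt I 𝓘(ℝ, ℝ) (frameGrad g Z u k) p := fun k =>
    ((hg.contMDiffOn_frameGrad hU hZ hu k).contMDiffAt (hU.mem_nhds hp)).mdifferentiableAt (by simp)
  have hgrad : grad I g u =ᶠ[𝓝 p] fun q => ∑ k, frameGrad g Z u k q • Z k q := by
    filter_upwards [hU.mem_nhds hp] with q hq using hg.grad_eq_sum hZ u hq
  have hbr : ∀ i, VectorField.mlieBracket I (grad I g u) (Z i) p =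
      ∑ k, (-(mvfderiv I (frameGrad g Z u k) p (Z i p)) • Z k p +
        frameGrad g Z u k p • VectorField.mlieBracket I (Z k) (Z i) p) := fun i => by
    exact (hgrad.mlieBracket_vectorField_eq (EventuallyEq.refl (𝓝 p) (Z i))).trans
      (mlieBracket_sum_smul hv hZp)
  have hcoeff : ∀ i j, hZ.coeff i p (Z j p) = if j = i then 1 else 0 := by
    intro i j
    rw [hZ.coeff_apply_of_mem hp (Z j), ← hZ.toBasisAt_coe hp j, Module.Basis.repr_self,
      Finsupp.single_apply]
  have hcb : ∀ i, hZ.coeff i p (VectorField.mlieBracket I (grad I g u) (Z i) p) =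
      -mvfderiv I (frameGrad g Z u i) p (Z i p) + ∑ k, frameGrad g Z u k p *
        hZ.coeff i p (VectorField.mlieBracket I (Z k) (Z i) p) := by
    intro i
    rw [hbr, map_sum]
    simp only [map_add, map_smul, hcoeff, smul_eq_mul, Finset.sum_add_distrib]
    simp
  have hsymm : ∀ i j, (frameGram g Z p)⁻¹ i j = (frameGram g Z p)⁻¹ j i := by
    intro i j
    have := (hg.posDef_frameGram hZ hp).1.inv
    exact (by simpa using (this.apply i j).symm)
  have hL : ∀ i j, lieDerivMetric I g (grad I g u) (Z i) (Z j) p =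
      (∑ k, frameGrad g Z u k p * mvfderiv I (fun q => frameGram g Z q i j) p (Z k p))
      - g p (VectorField.mlieBracket I (grad I g u) (Z i) p) (Z j p)
      - g p (VectorField.mlieBracket I (grad I g u) (Z j) p) (Z i p) := by
    intro i j
    rw [lieDerivMetric, hg.grad_eq_sum hZ u hp, map_sum, hg.symm p hp (Z i p)]
    simp only [map_smul, smul_eq_mul]
    rfl
  rw [laplacian, divergence_eq_of_basis hg hU hp _ Z hZp (hZ.toBasisAt hp) (hZ.toBasisAt_coe hp)]
  change -((1 / 2) * ∑ i, ∑ j, (frameGram g Z p)⁻¹ i j * _) = _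
  congr 1
  have h1 : ∑ i, ∑ j, (frameGram g Z p)⁻¹ i j *
      g p (VectorField.mlieBracket I (grad I g u) (Z i) p) (Z j p) =
      ∑ i, hZ.coeff i p (VectorField.mlieBracket I (grad I g u) (Z i) p) :=
    Finset.sum_congr rfl fun i _ => hg.sum_inv_frameGram_mul hZ hp _ i
  have h2 : ∑ i, ∑ j, (frameGram g Z p)⁻¹ i j *
      g p (VectorField.mlieBracket I (grad I g u) (Z j) p) (Z i p) =
      ∑ i, hZ.coeff i p (VectorField.mlieBracket I (grad I g u) (Z i) p) := by
    rw [← h1, Finset.sum_comm]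
    exact Finset.sum_congr rfl fun i _ => Finset.sum_congr rfl fun j _ => by rw [hsymm]
  simp only [hL, mul_sub, Finset.sum_sub_distrib, h1, h2]
  simp only [hcb, Finset.sum_add_distrib, frameDiv, mul_sub, Finset.sum_neg_distrib,
    Finset.sum_sub_distrib]
  have h3 : ∑ i, ∑ j, (frameGram g Z p)⁻¹ i j * ∑ k, frameGrad g Z u k p *
      mvfderiv I (fun q => frameGram g Z q i j) p (Z k p) = ∑ k, frameGrad g Z u k p *
      ∑ i, ∑ j, (frameGram g Z p)⁻¹ i j * mvfderiv I (fun q => frameGram g Z q i j) p (Z k p) := by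
    simp only [Finset.mul_sum]
    symm
    refine Finset.sum_comm.trans (Finset.sum_congr rfl fun i _ => Finset.sum_comm.trans ?_)
    exact Finset.sum_congr rfl fun j _ => Finset.sum_congr rfl fun k _ => by ring
  have h4 : ∑ i, ∑ k, frameGrad g Z u k p *
      hZ.coeff i p (VectorField.mlieBracket I (Z k) (Z i) p) = ∑ k, frameGrad g Z u k p *
      ∑ i, hZ.coeff i p (VectorField.mlieBracket I (Z k) (Z i) p) := by
    rw [Finset.sum_comm]
    simp only [Finset.mul_sum]
  have h5 : ∑ k, frameGrad g Z u k p * ((1 / 2) * ∑ i, ∑ j, (frameGram g Z p)⁻¹ i j *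
      mvfderiv I (fun q => frameGram g Z q i j) p (Z k p)) = (1 / 2) * ∑ k, frameGrad g Z u k p *
      ∑ i, ∑ j, (frameGram g Z p)⁻¹ i j * mvfderiv I (fun q => frameGram g Z q i j) p (Z k p) := by
    rw [Finset.mul_sum]
    exact Finset.sum_congr rfl fun k _ => by ring
  rw [h3, h4, h5]
  ring

end FrameLaplacian

/-! ### Locality, smoothness and linearity of the Laplacian -/

section MvfderivCongr

variable {E : Type*} [NormedAddCommGroup E] [NormedSpace ℝ E] {H : Type*} [TopologicalSpace H]
  {I : ModelWithCorners ℝ E H} {M : Type*} [TopologicalSpace M] [ChartedSpace H M]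

theorem mvfderiv_congr {f f' : M → ℝ} {p : M} (h : f =ᶠ[𝓝 p] f') :
    mvfderiv I f p = mvfderiv I f' p := by
  ext v
  rw [mvfderiv, mvfderiv, h.mfderiv_eq]
  rfl

end MvfderivCongr

section FrameLaplacian

variable {d : ℕ} {H : Type*} [TopologicalSpace H]
  {I : ModelWithCorners ℝ (EuclideanSpace ℝ (Fin d)) H}
  {N : Type*} [TopologicalSpace N] [ChartedSpace H N]

theorem mvfderiv_congr_of_eqOn {U : Set N} (hU : IsOpen U) {f f' : N → ℝ} (h : Set.EqOn f f' U)
    {p : N} (hp : p ∈ U) : mvfderiv I f p = mvfderiv I f' p :=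
  mvfderiv_congr (h.eventuallyEq_of_mem (hU.mem_nhds hp))

variable
  {g : ∀ p : N, TangentSpace I p →L[ℝ] TangentSpace I p →L[ℝ] ℝ}
  {κ : Type*} [Fintype κ] [DecidableEq κ]
  {Z : κ → ∀ p : N, TangentSpace I p} {U : Set N}
variable [IsManifold I ∞ N]

theorem IsRiemannianMetricOn.contMDiffOn_frameDiv (hg : IsRiemannianMetricOn I U g) (hU : IsOpen U)
    (hZ : IsLocalFrameOn I (EuclideanSpace ℝ (Fin d)) ∞ Z U) (k : κ) :
    ContMDiffOn I 𝓘(ℝ, ℝ) ∞ (frameDiv g hZ k) U := by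
  refine ContMDiffOn.sub (contMDiffOn_const.mul (contMDiffOn_finsetSum fun i _ =>
    contMDiffOn_finsetSum fun j _ => ?_)) (contMDiffOn_finsetSum fun i _ => ?_)
  · exact (contMDiffOn_matrix_inv (hg.contMDiffOn_frameGram hZ)
      (fun _ hp => (hg.posDef_frameGram hZ hp).det_pos.ne') i j).mul
      (SmoothVF.contMDiffOn_mvfderiv hU (hZ.contMDiffOn k) (hg.contMDiffOn_frameGram hZ i j))
  · exact hZ.contMDiffOn_coeff hU (SmoothVF.mlieBracket hU (hZ.contMDiffOn k) (hZ.contMDiffOn i)) i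

theorem IsRiemannianMetricOn.mono {U' : Set N} (hg : IsRiemannianMetricOn I U g) (h : U' ⊆ U) :
    IsRiemannianMetricOn I U' g :=
  ⟨hg.smooth.mono h, fun p hp => hg.symm p (h hp), fun p hp => hg.pos p (h hp)⟩

theorem exists_isLocalFrameOn (I : ModelWithCorners ℝ (EuclideanSpace ℝ (Fin d)) H)
    [IsManifold I ∞ N] {U : Set N} (hU : IsOpen U) {p : N} (hp : p ∈ U) :
    ∃ U' ⊆ U, IsOpen U' ∧ p ∈ U' ∧ ∃ Z : Fin d → ∀ p : N, TangentSpace I p,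
      IsLocalFrameOn I (EuclideanSpace ℝ (Fin d)) ∞ Z U' := by
  let e := trivializationAt (EuclideanSpace ℝ (Fin d)) (TangentSpace I : N → Type _) p
  refine ⟨U ∩ e.baseSet, Set.inter_subset_left, hU.inter e.open_baseSet,
    ⟨hp, FiberBundle.mem_baseSet_trivializationAt' p⟩,
    e.localFrame (EuclideanSpace.basisFun (Fin d) ℝ).toBasis, ?_⟩
  exact (e.isLocalFrameOn_localFrame_baseSet I ∞ _).mono Set.inter_subset_right

theorem IsRiemannianMetricOn.contMDiffOn_laplacian (hg : IsRiemannianMetricOn I U g)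
    (hU : IsOpen U) {u : N → ℝ} (hu : ContMDiffOn I 𝓘(ℝ, ℝ) ∞ u U) :
    ContMDiffOn I 𝓘(ℝ, ℝ) ∞ (laplacian I g u) U := by
  intro p hp
  obtain ⟨U', hU'U, hU', hp', Z, hZ⟩ := exists_isLocalFrameOn I hU hp
  have hg' := hg.mono hU'U
  have h : ContMDiffOn I 𝓘(ℝ, ℝ) ∞ (laplacian I g u) U' := by
    refine ContMDiffOn.congr ?_ fun q hq => hg'.laplacian_eq hU' hZ (hu.mono hU'U) hq
    refine ContMDiffOn.neg (contMDiffOn_finsetSum fun k _ => ContMDiffOn.add ?_ ?_)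
    · exact SmoothVF.contMDiffOn_mvfderiv hU' (hZ.contMDiffOn k)
        (hg'.contMDiffOn_frameGrad hU' hZ (hu.mono hU'U) k)
    · exact (hg'.contMDiffOn_frameGrad hU' hZ (hu.mono hU'U) k).mul
        (hg'.contMDiffOn_frameDiv hU' hZ k)
  exact (h.contMDiffAt (hU'.mem_nhds hp')).contMDiffWithinAt

/-- Linearity is stated for a `w` that agrees with the combination on `U` only, because the
logarithm identities it serves hold only in the interior. The constant `c` absorbs `log 2`. -/
theorem IsRiemannianMetricOn.laplacian_eq_of_eqOn (hg : IsRiemannianMetricOn I U g)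
    (hU : IsOpen U) {w u v : N → ℝ} (hu : ContMDiffOn I 𝓘(ℝ, ℝ) ∞ u U)
    (hv : ContMDiffOn I 𝓘(ℝ, ℝ) ∞ v U) {c a b : ℝ}
    (hw : Set.EqOn w (fun q => c + a * u q + b * v q) U) {p : N} (hp : p ∈ U) :
    laplacian I g w p = a * laplacian I g u p + b * laplacian I g v p := by
  obtain ⟨U', hU'U, hU', hp', Z, hZ⟩ := exists_isLocalFrameOn I hU hp
  have hg' := hg.mono hU'U
  have hu' := hu.mono hU'U
  have hv' := hv.mono hU'U
  have hw' : ContMDiffOn I 𝓘(ℝ, ℝ) ∞ w U' :=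
    ((contMDiffOn_const.add (contMDiffOn_const.mul hu')).add (contMDiffOn_const.mul hv')).congr
      (hw.mono hU'U)
  have key : ∀ u v w : N → ℝ, ContMDiffOn I 𝓘(ℝ, ℝ) ∞ u U' → ContMDiffOn I 𝓘(ℝ, ℝ) ∞ v U' →
      ∀ c, Set.EqOn w (fun q => c + a * u q + b * v q) U' → ∀ q ∈ U', ∀ x,
      mvfderiv I w q x = a * mvfderiv I u q x + b * mvfderiv I v q x := by
    intro u v w hu hv c hw q hq x
    have hud := (hu.contMDiffAt (hU'.mem_nhds hq)).mdifferentiableAt (n := ∞) (by simp)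
    have hvd := (hv.contMDiffAt (hU'.mem_nhds hq)).mdifferentiableAt (n := ∞) (by simp)
    have hc : ∀ c : ℝ, MDifferentiableAt I 𝓘(ℝ, ℝ) (fun _ : N => c) q := fun c =>
      mdifferentiableAt_const
    rw [mvfderiv_congr_of_eqOn hU' hw hq]
    change mvfderiv I ((fun _ => c) + (fun _ => a) * u + (fun _ => b) * v) q x = _
    rw [mvfderiv_add ((hc c).add ((hc a).mul hud)) ((hc b).mul hvd),
      mvfderiv_add (hc c) ((hc a).mul hud), mvfderiv_mul (hc a) hud, mvfderiv_mul (hc b) hvd]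
    simp [mvfderiv_const]
  have hgr : ∀ k, Set.EqOn (frameGrad g Z w k)
      (fun q => 0 + a * frameGrad g Z u k q + b * frameGrad g Z v k q) U' := by
    intro k q hq
    simp only [frameGrad, key u v w hu' hv' c (hw.mono hU'U) q hq, mul_add, Finset.sum_add_distrib,
      Finset.mul_sum, zero_add]
    congr 1 <;> exact Finset.sum_congr rfl fun i _ => by ring
  rw [hg'.laplacian_eq hU' hZ hw' hp', hg'.laplacian_eq hU' hZ hu' hp',
    hg'.laplacian_eq hU' hZ hv' hp']
  simp only [fun k => key _ _ _ (hg'.contMDiffOn_frameGrad hU' hZ hu' k)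
    (hg'.contMDiffOn_frameGrad hU' hZ hv' k) 0 (hgr k) p hp', fun k => hgr k hp', mul_neg,
    Finset.mul_sum, ← Finset.sum_neg_distrib, ← Finset.sum_add_distrib]
  exact Finset.sum_congr rfl fun i _ => by ring

end FrameLaplacian

/-! ### Frames degenerating at the boundary and the leading coefficient of the Laplacian -/

section WeightedFrame

variable {d : ℕ} {H : Type*} [TopologicalSpace H]
  {I : ModelWithCorners ℝ (EuclideanSpace ℝ (Fin d)) H}
  {N : Type*} [TopologicalSpace N] [ChartedSpace H N] [IsManifold I ∞ N]
  {κ : Type*} [Fintype κ] [DecidableEq κ]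

omit [IsManifold I ∞ N] in
theorem mvfderiv_comp_real {f : N → ℝ} {p : N} (hf : MDifferentiableAt I 𝓘(ℝ, ℝ) f p)
    {φ : ℝ → ℝ} {c : ℝ} (hφ : HasDerivAt φ c (f p)) (v : TangentSpace I p) :
    mvfderiv I (fun q => φ (f q)) p v = c * mvfderiv I f p v := by
  have h := (hφ.hasFDerivAt.hasMFDerivAt.comp p hf.hasMFDerivAt).mfderiv
  change (mfderiv I 𝓘(ℝ, ℝ) (φ ∘ f) p v : ℝ) = _
  rw [h]
  exact mul_comm (mvfderiv I f p v) c

omit [IsManifold I ∞ N] in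
theorem mvfderiv_pow_apply {f : N → ℝ} {p : N} (hf : MDifferentiableAt I 𝓘(ℝ, ℝ) f p) (k : ℕ)
    (v : TangentSpace I p) :
    mvfderiv I (fun q => f q ^ k) p v = k * f p ^ (k - 1) * mvfderiv I f p v :=
  mvfderiv_comp_real hf (hasDerivAt_pow k (f p)) v

/-- `F` is a frame over the open set `U` which becomes, over the open subset `U'`, a frame with
Gram matrix `G` smooth and positive definite on `U` after multiplication by the powers `ρ ^ w k`,
where the function `ρ`, positive on `U'`, is a coordinate dual to `F k₀`. -/
structure IsWeightedFrame (g : ∀ p : N, TangentSpace I p →L[ℝ] TangentSpace I p →L[ℝ] ℝ)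
    (U U' : Set N) (F : κ → ∀ p : N, TangentSpace I p) (ρ : N → ℝ) (w : κ → ℕ) (k₀ : κ)
    (G : N → Matrix κ κ ℝ) : Prop where
  isOpen : IsOpen U
  isOpen' : IsOpen U'
  subset : U' ⊆ U
  metric : IsRiemannianMetricOn I U' g
  frame : IsLocalFrameOn I (EuclideanSpace ℝ (Fin d)) ∞ F U
  smooth : ContMDiffOn I 𝓘(ℝ, ℝ) ∞ ρ U
  pos : ∀ q ∈ U', 0 < ρ q
  dual : ∀ q ∈ U, ∀ k, mvfderiv I ρ q (F k q) = if k = k₀ then 1 else 0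
  weight_self : w k₀ = 1
  weight_pos : ∀ k, 1 ≤ w k
  smooth_gram : ∀ i j, ContMDiffOn I 𝓘(ℝ, ℝ) ∞ (fun q => G q i j) U
  posDef : ∀ q ∈ U, (G q).PosDef
  gram_eq : ∀ q ∈ U', ∀ i j, G q i j = g q (ρ q ^ w i • F i q) (ρ q ^ w j • F j q)

namespace IsWeightedFrame

variable {g : ∀ p : N, TangentSpace I p →L[ℝ] TangentSpace I p →L[ℝ] ℝ}
    {U U' : Set N} {F : κ → ∀ p : N, TangentSpace I p} {ρ : N → ℝ} {w : κ → ℕ} {k₀ : κ}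
    {G : N → Matrix κ κ ℝ}

/-- The weighted frame. -/
def scaled (F : κ → ∀ p : N, TangentSpace I p) (ρ : N → ℝ) (w : κ → ℕ) (k : κ) (q : N) :
    TangentSpace I q := ρ q ^ w k • F k q

/-- The smooth extension of the divergence of the weighted frame. -/
def divExt (h : IsWeightedFrame g U U' F ρ w k₀ G) (k : κ) (q : N) : ℝ :=
  (1 / 2) * ∑ i, ∑ j, (G q)⁻¹ i j *
      (ρ q ^ w k * mvfderiv I (fun q => G q i j) q (F k q))
    - (ρ q ^ w k * ∑ i, h.frame.coeff i q (VectorField.mlieBracket I (F k) (F i) q)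
      + if k = k₀ then ((∑ i, w i : ℕ) - 1 : ℝ) else 0)

omit [Fintype κ] in
theorem isLocalFrameOn_scaled (h : IsWeightedFrame g U U' F ρ w k₀ G) :
    IsLocalFrameOn I (EuclideanSpace ℝ (Fin d)) ∞ (scaled F ρ w) U' where
  linearIndependent {q} hq := by
    have h1 := h.frame.linearIndependent (h.subset hq)
    exact h1.units_smul fun i => Units.mk0 (ρ q ^ w i) (pow_pos (h.pos q hq) _).ne'
  generating {q} hq := by
    have h1 := h.frame.generating (h.subset hq)
    refine h1.trans (Submodule.span_le.2 ?_)
    rintro _ ⟨i, rfl⟩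
    have h2 : F i q = (ρ q ^ w i)⁻¹ • scaled F ρ w i q := by
      rw [scaled, smul_smul, inv_mul_cancel₀ (pow_pos (h.pos q hq) _).ne', one_smul]
    change F i q ∈ _
    rw [h2]
    exact Submodule.smul_mem _ _ (Submodule.subset_span ⟨i, rfl⟩)
  contMDiffOn i := SmoothVF.smul (SmoothVF.mono (h.frame.contMDiffOn i) h.subset)
    ((h.smooth.mono h.subset).pow (w i))

omit [Fintype κ] in
theorem frameGram_scaled (h : IsWeightedFrame g U U' F ρ w k₀ G) {q : N} (hq : q ∈ U') :
    frameGram g (scaled F ρ w) q = G q := by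
  ext i j
  exact (h.gram_eq q hq i j).symm

theorem coeff_scaled (h : IsWeightedFrame g U U' F ρ w k₀ G) {q : N} (hq : q ∈ U') (i : κ)
    (X : TangentSpace I q) :
    ρ q ^ w i * h.isLocalFrameOn_scaled.coeff i q X = h.frame.coeff i q X := by
  have h1 := h.isLocalFrameOn_scaled.coeff_sum_eq
    (FiberBundle.extend (EuclideanSpace ℝ (Fin d)) X) hq
  rw [FiberBundle.extend_apply_self] at h1
  have hcoeff : ∀ i j, h.frame.coeff i q (F j q) = if j = i then 1 else 0 := by
    intro i j
    rw [h.frame.coeff_apply_of_mem (h.subset hq) (F j),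
      ← h.frame.toBasisAt_coe (h.subset hq) j, Module.Basis.repr_self, Finsupp.single_apply]
  conv_rhs => rw [h1]
  simp [scaled, hcoeff, mul_comm]

/-- Differentiating `ρ ^ w i` along `ρ F k₀` reproduces it with the factor `w i`, so brackets with
the field `k₀` contribute the sum of the weights. The field's bracket with itself is zero, which
accounts for the `-1`. All remaining bracket terms carry a factor `ρ ^ w k`. -/
theorem frameDiv_scaled (h : IsWeightedFrame g U U' F ρ w k₀ G) (k : κ) {q : N} (hq : q ∈ U') :
    frameDiv g h.isLocalFrameOn_scaled k q = h.divExt k q := by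
  have : IsManifold I 2 N := IsManifold.of_le (n := ∞) (WithTop.coe_le_coe.2 le_top)
  have hρ := h.pos q hq
  have hqU := h.subset hq
  have hdρ : MDifferentiableAt I 𝓘(ℝ, ℝ) ρ q :=
    (h.smooth.contMDiffAt (h.isOpen.mem_nhds hqU)).mdifferentiableAt (by simp)
  have hdpow : ∀ m : ℕ, MDifferentiableAt I 𝓘(ℝ, ℝ) (fun q => ρ q ^ m) q := fun m =>
    ((h.smooth.pow m).contMDiffAt (h.isOpen.mem_nhds hqU)).mdifferentiableAt (by simp)
  have hdF : ∀ i, MDifferentiableAt I I.tangent (fun p => (⟨p, F i p⟩ : TangentBundle I N)) q :=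
    fun i => ((h.frame.contMDiffOn i).contMDiffAt
      (h.isOpen.mem_nhds hqU)).mdifferentiableAt (by simp)
  have hcoeff : ∀ i j, h.frame.coeff i q (F j q) = if j = i then 1 else 0 := by
    intro i j
    rw [h.frame.coeff_apply_of_mem hqU (F j), ← h.frame.toBasisAt_coe hqU j,
      Module.Basis.repr_self, Finsupp.single_apply]
  have hbr : ∀ i, h.isLocalFrameOn_scaled.coeff i q
      (VectorField.mlieBracket I (scaled F ρ w k) (scaled F ρ w i) q) =
      (if k = k₀ then (w i : ℝ) else 0) - (if k = i then (if k = k₀ then 1 else 0) else 0) +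
        ρ q ^ w k * h.frame.coeff i q (VectorField.mlieBracket I (F k) (F i) q) := by
    intro i
    have h1 : VectorField.mlieBracket I (scaled F ρ w k) (scaled F ρ w i) q =
        (ρ q ^ w k * (w i * ρ q ^ (w i - 1) * if k = k₀ then 1 else 0)) • F i q +
        ρ q ^ w i • (-(w k * ρ q ^ (w k - 1) * if i = k₀ then 1 else 0) • F k q +
          ρ q ^ w k • VectorField.mlieBracket I (F k) (F i) q) := by
      change VectorField.mlieBracket I ((fun q => ρ q ^ w k) • F k)
        ((fun q => ρ q ^ w i) • F i) q = _
      rw [VectorField.mlieBracket_smul_right (hdpow _) (hdF i),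
        VectorField.mlieBracket_smul_left (hdpow _) (hdF k)]
      simp only [Pi.smul_apply', map_smul, mvfderiv_pow_apply hdρ, h.dual q hqU, smul_eq_mul]
      rw [mul_left_comm (ρ q ^ w k)]
    have h2 := h.coeff_scaled hq i
      (VectorField.mlieBracket I (scaled F ρ w k) (scaled F ρ w i) q)
    have hwi : ρ q ^ w i = ρ q ^ (w i - 1) * ρ q := by
      rw [← pow_succ, Nat.sub_add_cancel (h.weight_pos i)]
    refine mul_left_cancel₀ (pow_pos hρ (w i)).ne' ?_
    rw [h2, h1]
    simp only [map_add, map_smul, hcoeff, smul_eq_mul]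
    by_cases hk : k = k₀
    · subst hk
      by_cases hi : k = i
      · subst hi
        simp [h.weight_self]
      · have hi' : ¬ i = k := fun h => hi h.symm
        simp only [if_true, hi, hi', if_false, h.weight_self, hwi]
        simp
        ring
    · simp only [hk, if_false]
      by_cases hi : k = i
      · subst hi
        simp [hk]
      · simp [hi]
  rw [frameDiv, divExt]
  simp only [hbr, h.frameGram_scaled hq]
  congr 1
  · congr 1
    refine Finset.sum_congr rfl fun i _ => Finset.sum_congr rfl fun j _ => ?_
    have h3 : Set.EqOn (fun q => frameGram g (scaled F ρ w) q i j) (fun q => G q i j) U' :=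
      fun q hq => by simp only [h.frameGram_scaled hq]
    rw [mvfderiv_congr_of_eqOn h.isOpen' h3 hq, scaled, map_smul, smul_eq_mul]
  · rw [Finset.sum_add_distrib, Finset.sum_sub_distrib, ← Finset.mul_sum, add_comm]
    congr 1
    by_cases hk : k = k₀ <;> simp [hk]

theorem contMDiffOn_divExt (h : IsWeightedFrame g U U' F ρ w k₀ G) (k : κ) :
    ContMDiffOn I 𝓘(ℝ, ℝ) ∞ (h.divExt k) U := by
  refine ContMDiffOn.sub (contMDiffOn_const.mul (contMDiffOn_finsetSum fun i _ =>
    contMDiffOn_finsetSum fun j _ => ?_)) (ContMDiffOn.add (ContMDiffOn.mul (h.smooth.pow _)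
      (contMDiffOn_finsetSum fun i _ => ?_)) contMDiffOn_const)
  · exact (contMDiffOn_matrix_inv h.smooth_gram
      (fun _ hp => (h.posDef _ hp).det_pos.ne') i j).mul
      ((h.smooth.pow _).mul
        (SmoothVF.contMDiffOn_mvfderiv h.isOpen (h.frame.contMDiffOn k) (h.smooth_gram i j)))
  · exact h.frame.contMDiffOn_coeff h.isOpen
      (SmoothVF.mlieBracket h.isOpen (h.frame.contMDiffOn k) (h.frame.contMDiffOn i)) i

/-- The number `1 - ∑ w i` is the source of the nonzero indicial root: with weights `1, 2, 1, …, 1`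
it equals `-(2n+2)`. -/
theorem divExt_of_eq_zero (h : IsWeightedFrame g U U' F ρ w k₀ G) (k : κ) {q : N}
    (hq : ρ q = 0) : h.divExt k q = if k = k₀ then 1 - ((∑ i, w i : ℕ) : ℝ) else 0 := by
  have : ρ q ^ w k = 0 := by rw [hq, zero_pow (Nat.one_le_iff_ne_zero.1 (h.weight_pos k))]
  rw [divExt, this]
  by_cases hk : k = k₀ <;> simp [hk]

/-- The Laplacian in a weighted frame of a function whose derivatives along the weighted frame are
`ρ ^ m` times functions that are smooth on `U`. -/
theorem exists_laplacian_eq (h : IsWeightedFrame g U U' F ρ w k₀ G) {u : N → ℝ}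
    (hu : ContMDiffOn I 𝓘(ℝ, ℝ) ∞ u U') (m : ℕ) {ψ : κ → N → ℝ}
    (hψ : ∀ k, ContMDiffOn I 𝓘(ℝ, ℝ) ∞ (ψ k) U)
    (hd : ∀ q ∈ U', ∀ k, ρ q ^ w k * mvfderiv I u q (F k q) = ρ q ^ m * ψ k q) :
    ∃ f : N → ℝ, ContMDiffOn I 𝓘(ℝ, ℝ) ∞ f U ∧
      (∀ q ∈ U', laplacian I g u q = ρ q ^ m * f q) ∧
      ∀ q ∈ U, ρ q = 0 → (∀ j, G q k₀ j = if k₀ = j then 4 else 0) →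
        f q = -(m - ((∑ i, w i : ℕ) - 1 : ℝ)) / 4 * ψ k₀ q := by
  -- The gradient has components `ρ ^ m * v k` in the weighted frame. Differentiating `ρ ^ m` along
  -- the field `k₀` yields the term with `m` in the witness below.
  let v : κ → N → ℝ := fun k q => ∑ l, (G q)⁻¹ k l * ψ l q
  have hv : ∀ k, ContMDiffOn I 𝓘(ℝ, ℝ) ∞ (v k) U := fun k => contMDiffOn_finsetSum fun l _ =>
    (contMDiffOn_matrix_inv h.smooth_gram (fun _ hp => (h.posDef _ hp).det_pos.ne') k l).mul (hψ l)
  refine ⟨fun q => -∑ k, (ρ q ^ w k * mvfderiv I (v k) q (F k q) +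
    (if k = k₀ then (m : ℝ) else 0) * v k q + v k q * h.divExt k q), ?_, ?_, ?_⟩
  · refine ContMDiffOn.neg (contMDiffOn_finsetSum fun k _ => ContMDiffOn.add (ContMDiffOn.add ?_ ?_)
      ((hv k).mul (h.contMDiffOn_divExt k)))
    · exact (h.smooth.pow _).mul
        (SmoothVF.contMDiffOn_mvfderiv h.isOpen (h.frame.contMDiffOn k) (hv k))
    · exact contMDiffOn_const.mul (hv k)
  · intro q hq
    have hqU := h.subset hq
    have hdρ : MDifferentiableAt I 𝓘(ℝ, ℝ) ρ q :=
      (h.smooth.contMDiffAt (h.isOpen.mem_nhds hqU)).mdifferentiableAt (by simp)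
    have hdpow : ∀ m : ℕ, MDifferentiableAt I 𝓘(ℝ, ℝ) (fun q => ρ q ^ m) q := fun m =>
      ((h.smooth.pow m).contMDiffAt (h.isOpen.mem_nhds hqU)).mdifferentiableAt (by simp)
    have hdv : ∀ k, MDifferentiableAt I 𝓘(ℝ, ℝ) (v k) q := fun k =>
      ((hv k).contMDiffAt (h.isOpen.mem_nhds hqU)).mdifferentiableAt (by simp)
    have hgrad : ∀ k, Set.EqOn (frameGrad g (scaled F ρ w) u k)
        ((fun q => ρ q ^ m) * v k) U' := by
      intro k q hq
      simp only [frameGrad, h.frameGram_scaled hq, Pi.mul_apply, v, Finset.mul_sum]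
      refine Finset.sum_congr rfl fun l _ => ?_
      rw [scaled, map_smul, smul_eq_mul, hd q hq l]
      ring
    rw [h.metric.laplacian_eq h.isOpen' h.isLocalFrameOn_scaled hu hq, mul_neg, Finset.mul_sum]
    congr 1
    refine Finset.sum_congr rfl fun k _ => ?_
    rw [mvfderiv_congr_of_eqOn h.isOpen' (hgrad k) hq, hgrad k hq, h.frameDiv_scaled k hq,
      mvfderiv_mul (hdpow m) (hdv k)]
    simp only [scaled, map_smul, FunLike.coe_add, Pi.add_apply, FunLike.coe_smul, Pi.smul_apply,
      smul_eq_mul, mvfderiv_pow_apply hdρ, h.dual q hqU, Pi.mul_apply]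
    by_cases hk : k = k₀
    · subst hk
      rw [h.weight_self]
      -- The exponent `m - 1` is a truncated subtraction, so `m = 0` is treated apart.
      rcases Nat.eq_zero_or_pos m with rfl | hm
      · simp
      · have : ρ q ^ m = ρ q ^ (m - 1) * ρ q := by rw [← pow_succ, Nat.sub_add_cancel hm]
        simp only [if_true, this]
        ring
    · simp only [hk, if_false]
      ring
  · intro q hq h0 hG
    have hw : ∀ k, ρ q ^ w k = 0 := fun k => by
      rw [h0, zero_pow (Nat.one_le_iff_ne_zero.1 (h.weight_pos k))]
    have hmul := Matrix.mul_nonsing_inv _ (h.posDef q hq).det_pos.ne'.isUnit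
    -- Row `k₀` of `G G⁻¹ = 1` reads `4 G⁻¹ k₀ l = δ`, so no other entry of `G` is needed.
    have hinv : ∀ l, (G q)⁻¹ k₀ l = if k₀ = l then 1 / 4 else 0 := by
      intro l
      have h1 := congrFun (congrFun hmul k₀) l
      rw [Matrix.mul_apply, Matrix.one_apply] at h1
      simp only [hG] at h1
      by_cases hl : k₀ = l
      · simp [hl] at h1 ⊢
        linarith
      · simpa [hl] using h1
    have hv0 : v k₀ q = 1 / 4 * ψ k₀ q := by simp [v, hinv]
    simp only [hw, h.divExt_of_eq_zero _ h0]
    simp only [zero_mul, zero_add, ite_mul, mul_ite, mul_zero, Finset.sum_add_distrib,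
      Finset.sum_ite_eq', Finset.mem_univ, if_true, hv0]
    ring

end IsWeightedFrame

end WeightedFrame

/-! ### Parametric integrals and Hadamard's lemma on sets with boundary -/

section Hadamard

theorem continuousOn_integral_of_continuousOn {E G : Type*} [TopologicalSpace E]
    [FirstCountableTopology E] [NormedAddCommGroup G]
    [NormedSpace ℝ G] {s : Set E} {g : ℝ × E → G}
    (hg : ContinuousOn g (Set.Icc (0 : ℝ) 1 ×ˢ s)) :
    ContinuousOn (fun x => ∫ t in (0 : ℝ)..1, g (t, x)) s := by
  rw [continuousOn_iff_continuous_domRestrict]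
  have h : Continuous (Function.uncurry fun (x : s) (t : ℝ) =>
      -- Clamping `t` to `[0, 1]` makes the integrand continuous for all real `t` without changing
      -- the integral.
      g (Set.projIcc (0 : ℝ) 1 zero_le_one t, (x : E))) := by
    refine hg.comp_continuous (by fun_prop) ?_
    rintro ⟨x, t⟩
    exact ⟨(Set.projIcc (0 : ℝ) 1 zero_le_one t).2, x.2⟩
  refine (intervalIntegral.continuous_parametric_intervalIntegral_of_continuous'
    (μ := MeasureTheory.volume) h 0 1).congr ?_
  intro x
  refine intervalIntegral.integral_congr fun t ht => ?_
  rw [Set.uIcc_of_le zero_le_one] at ht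
  simp [Set.projIcc_of_mem _ ht]

theorem intervalIntegrable_of_continuousOn_prod {E G : Type*} [TopologicalSpace E]
    [NormedAddCommGroup G] {s : Set E} {g : ℝ × E → G}
    (hg : ContinuousOn g (Set.Icc (0 : ℝ) 1 ×ˢ s)) {y : E} (hy : y ∈ s) :
    IntervalIntegrable (fun t => g (t, y)) MeasureTheory.volume 0 1 := by
  refine ContinuousOn.intervalIntegrable ?_
  rw [Set.uIcc_of_le zero_le_one]
  exact hg.comp (by fun_prop) fun t ht => ⟨ht, hy⟩

/-- Compactness of `[0, 1]` makes the continuity of `g'` at `x` uniform in `t`. The mean value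
inequality on the convex set then bounds the remainder uniformly in `t`, and the bound survives
integration. -/
theorem hasFDerivWithinAt_integral {E G : Type*} [NormedAddCommGroup E] [NormedSpace ℝ E]
    [NormedAddCommGroup G] [NormedSpace ℝ G] [CompleteSpace G] {s : Set E} (hs : Convex ℝ s)
    {g : ℝ × E → G} {g' : ℝ × E → E →L[ℝ] G} (hg : ContinuousOn g (Set.Icc (0 : ℝ) 1 ×ˢ s))
    (hg' : ContinuousOn g' (Set.Icc (0 : ℝ) 1 ×ˢ s))
    (hd : ∀ t ∈ Set.Icc (0 : ℝ) 1, ∀ x ∈ s, HasFDerivWithinAt (fun y => g (t, y)) (g' (t, x)) s x)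
    {x : E} (hx : x ∈ s) :
    HasFDerivWithinAt (fun x => ∫ t in (0 : ℝ)..1, g (t, x)) (∫ t in (0 : ℝ)..1, g' (t, x)) s x := by
  rw [hasFDerivWithinAt_iff_isLittleO, Asymptotics.isLittleO_iff]
  intro ε hε
  have hswap : ContinuousOn (Function.uncurry fun (y : E) (t : ℝ) => g' (t, y))
      (s ×ˢ Set.Icc (0 : ℝ) 1) :=
    hg'.comp (by fun_prop) fun y hy => ⟨hy.2, hy.1⟩
  obtain ⟨v, hv, hvb⟩ := isCompact_Icc.mem_uniformity_of_prod hswap hx (Metric.dist_mem_uniformity hε)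
  obtain ⟨δ, hδ, hball⟩ := Metric.mem_nhdsWithin_iff.1 hv
  filter_upwards [inter_mem_nhdsWithin s (Metric.ball_mem_nhds x hδ)] with y hy
  have hys : y ∈ s := hy.1
  have hconv : Convex ℝ (Metric.ball x δ ∩ s) := (convex_ball x δ).inter hs
  have hb : ∀ t ∈ Set.uIoc (0 : ℝ) 1, ‖g (t, y) - g (t, x) - g' (t, x) (y - x)‖ ≤ ε * ‖y - x‖ := by
    intro t ht
    rw [Set.uIoc_of_le zero_le_one] at ht
    have ht' : t ∈ Set.Icc (0 : ℝ) 1 := ⟨ht.1.le, ht.2⟩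
    refine hconv.norm_image_sub_le_of_norm_hasFDerivWithin_le' (f := fun y => g (t, y))
      (f' := fun z => g' (t, z)) (fun z hz => (hd t ht' z hz.2).mono Set.inter_subset_right)
      (fun z hz => ?_) ⟨Metric.mem_ball_self hδ, hx⟩ ⟨hy.2, hys⟩
    rw [← dist_eq_norm]
    exact (hvb z (hball hz) t ht').le
  have h1 : (∫ t in (0 : ℝ)..1, g (t, y)) - (∫ t in (0 : ℝ)..1, g (t, x)) -
      (∫ t in (0 : ℝ)..1, g' (t, x)) (y - x) =
      ∫ t in (0 : ℝ)..1, (g (t, y) - g (t, x) - g' (t, x) (y - x)) := by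
    have h2 : IntervalIntegrable (fun t => g' (t, x) (y - x)) MeasureTheory.volume 0 1 :=
      intervalIntegrable_of_continuousOn_prod (g := fun q => g' q (y - x))
        (hg'.clm_apply continuousOn_const) hx
    rw [intervalIntegral.integral_sub ((intervalIntegrable_of_continuousOn_prod hg hys).sub (intervalIntegrable_of_continuousOn_prod hg hx)) h2,
      intervalIntegral.integral_sub (intervalIntegrable_of_continuousOn_prod hg hys) (intervalIntegrable_of_continuousOn_prod hg hx),
      ContinuousLinearMap.intervalIntegral_apply (intervalIntegrable_of_continuousOn_prod hg' hx)]
  rw [h1]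
  simpa using intervalIntegral.norm_integral_le_of_norm_le_const hb

/-- The derivative of the integral is the integral of the partial derivative, an integral of the
same type with values in `E →L[ℝ] G`. The induction on the order therefore generalizes over the
target space. -/
theorem contDiffOn_integral {E : Type} [NormedAddCommGroup E] [NormedSpace ℝ E]
    {s : Set E} (hs : Convex ℝ s) (hu : UniqueDiffOn ℝ s) {G : Type} [NormedAddCommGroup G]
    [NormedSpace ℝ G] [CompleteSpace G]
    {g : ℝ × E → G} (hg : ContDiffOn ℝ ∞ g (Set.Icc (0 : ℝ) 1 ×ˢ s)) :
    ContDiffOn ℝ ∞ (fun x => ∫ t in (0 : ℝ)..1, g (t, x)) s := by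
  suffices h : ∀ n : ℕ, ∀ {G : Type} [NormedAddCommGroup G] [NormedSpace ℝ G] [CompleteSpace G]
      {g : ℝ × E → G}, ContDiffOn ℝ ∞ g (Set.Icc (0 : ℝ) 1 ×ˢ s) →
      ContDiffOn ℝ n (fun x => ∫ t in (0 : ℝ)..1, g (t, x)) s from
    contDiffOn_infty.2 fun n => h n hg
  have huS : UniqueDiffOn ℝ (Set.Icc (0 : ℝ) 1 ×ˢ s) := (uniqueDiffOn_Icc zero_lt_one).prod hu
  intro n
  induction n with
  | zero =>
    intro G _ _ _ g hg
    exact contDiffOn_zero.2 (continuousOn_integral_of_continuousOn hg.continuousOn)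
  | succ n ih =>
    intro G _ _ _ g hg
    let g' : ℝ × E → E →L[ℝ] G := fun q =>
      (fderivWithin ℝ g (Set.Icc (0 : ℝ) 1 ×ˢ s) q).comp (ContinuousLinearMap.inr ℝ ℝ E)
    have hg' : ContDiffOn ℝ ∞ g' (Set.Icc (0 : ℝ) 1 ×ˢ s) :=
      (hg.fderivWithin huS (by simp)).clm_comp contDiffOn_const
    have hd : ∀ t ∈ Set.Icc (0 : ℝ) 1, ∀ x ∈ s,
        HasFDerivWithinAt (fun y => g (t, y)) (g' (t, x)) s x := by
      intro t ht x hx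
      have h1 := (hg.differentiableOn (by simp) (t, x) ⟨ht, hx⟩).hasFDerivWithinAt
      exact h1.comp x (hasFDerivAt_prodMk_right t x).hasFDerivWithinAt fun y hy => ⟨ht, hy⟩
    have hJ : ∀ x ∈ s, HasFDerivWithinAt (fun x => ∫ t in (0 : ℝ)..1, g (t, x))
        (∫ t in (0 : ℝ)..1, g' (t, x)) s x := fun x hx =>
      hasFDerivWithinAt_integral hs hg.continuousOn hg'.continuousOn hd hx
    push_cast
    rw [contDiffOn_succ_iff_fderivWithin hu]
    refine ⟨fun x hx => (hJ x hx).differentiableWithinAt, by simp, ?_⟩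
    exact (ih hg').congr fun x hx => (hJ x hx).fderivWithin (hu x hx)

/-- Hadamard's lemma on a convex set with unique differentials, such as a half-ball. -/
theorem exists_contDiffOn_eq_apply {E₁ E₂ : Type} [NormedAddCommGroup E₁] [NormedSpace ℝ E₁]
    [NormedAddCommGroup E₂] [NormedSpace ℝ E₂] {s : Set (E₁ × E₂)} (hs : Convex ℝ s)
    (hu : UniqueDiffOn ℝ s) (hstar : ∀ y ∈ s, ∀ t ∈ Set.Icc (0 : ℝ) 1, (t • y.1, y.2) ∈ s)
    {f : E₁ × E₂ → ℝ} (hf : ContDiffOn ℝ ∞ f s) (h0 : ∀ y ∈ s, f (0, y.2) = 0) (e : E₁) :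
    ∃ h : E₁ × E₂ → ℝ, ContDiffOn ℝ ∞ h s ∧ ∀ y ∈ s, ∀ c : ℝ, y.1 = c • e → f y = c * h y := by
  let γ : ℝ × (E₁ × E₂) → E₁ × E₂ := fun q => (q.1 • q.2.1, q.2.2)
  have hγ : ContDiff ℝ ∞ γ := by fun_prop
  -- Along the segment from `(0, y.2)` to `y` the derivative of `f` is `c` times this, since `y.1 =
  -- c • e`. Its integral over `[0, 1]` is the quotient.
  let g : ℝ × (E₁ × E₂) → ℝ := fun q => fderivWithin ℝ f s (γ q) (e, 0)
  have hg : ContDiffOn ℝ ∞ g (Set.Icc (0 : ℝ) 1 ×ˢ s) :=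
    ((hf.fderivWithin hu (by simp)).comp hγ.contDiffOn
      (fun q hq => hstar q.2 hq.2 q.1 hq.1)).clm_apply contDiffOn_const
  refine ⟨fun y => ∫ t in (0 : ℝ)..1, g (t, y), contDiffOn_integral hs hu hg, fun y hy c hc => ?_⟩
  have hd : ∀ t ∈ Set.Icc (0 : ℝ) 1,
      HasDerivWithinAt (fun t : ℝ => f (t • y.1, y.2)) (c * g (t, y)) (Set.Icc 0 1) t := by
    intro t ht
    have h1 := (hf.differentiableOn (by simp) (t • y.1, y.2) (hstar y hy t ht)).hasFDerivWithinAt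
    have h2 : HasDerivWithinAt (fun t : ℝ => (t • y.1, y.2)) (y.1, 0) (Set.Icc 0 1) t := by
      have := ((hasDerivAt_id t).smul_const y.1).prodMk (hasDerivAt_const t y.2)
      simpa using this.hasDerivWithinAt
    have h3 := h1.comp_hasDerivWithinAt t h2 fun t ht => hstar y hy t ht
    refine h3.congr_deriv ?_
    have h4 : ((y.1, 0) : E₁ × E₂) = c • (e, (0 : E₂)) := by rw [hc]; simp
    rw [h4, map_smul, smul_eq_mul]
  have h1 : ContinuousOn (fun t : ℝ => f (t • y.1, y.2)) (Set.Icc 0 1) :=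
    fun t ht => (hd t ht).continuousWithinAt
  have h2 : IntervalIntegrable (fun t => c * g (t, y)) MeasureTheory.volume 0 1 := by
    refine ContinuousOn.intervalIntegrable ?_
    rw [Set.uIcc_of_le zero_le_one]
    exact continuousOn_const.mul (hg.continuousOn.comp (by fun_prop) fun t ht => ⟨ht, hy⟩)
  have h3 := intervalIntegral.integral_eq_sub_of_hasDeriv_right_of_le zero_le_one h1
    (fun t ht => (((hd t ⟨ht.1.le, ht.2.le⟩).hasDerivAt
      (Icc_mem_nhds ht.1 ht.2)).hasDerivWithinAt)) h2
  rw [intervalIntegral.integral_const_mul] at h3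
  rw [h3]
  have h4 : f ((0 : ℝ) • y.1, y.2) = 0 := by rw [zero_smul]; exact h0 y hy
  simp only [h4, one_smul, sub_zero]

end Hadamard

/-! ### The collar, density of the interior, and extension to the boundary -/

section Rad

variable {M : Type*}

theorem rad_nonneg (y : EuclideanHalfSpace 1 × M) : 0 ≤ rad y := y.1.2

theorem eq_zero_of_rad_eq_zero {y : EuclideanHalfSpace 1 × M} (h : rad y = 0) :
    y = ((0 : EuclideanHalfSpace 1), y.2) := by
  refine Prod.ext (Subtype.ext (PiLp.ext fun i => ?_)) rfl
  rw [Subsingleton.elim i 0]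
  exact h

@[simp] theorem rad_zero (q : M) : rad ((0 : EuclideanHalfSpace 1), q) = 0 := rfl

end Rad

section Collar

variable {n : ℕ} {M : Type*} [TopologicalSpace M]
  [ChartedSpace (EuclideanSpace ℝ (Fin (2 * n + 1))) M]

theorem hasMFDerivAt_rad (y : EuclideanHalfSpace 1 × M) :
    HasMFDerivAt (collarModel n) 𝓘(ℝ, ℝ) rad y
      (((EuclideanSpace.proj (0 : Fin 1) : EuclideanSpace ℝ (Fin 1) →L[ℝ] ℝ).comp
        (ContinuousLinearMap.id ℝ (EuclideanSpace ℝ (Fin 1)))).comp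
        (ContinuousLinearMap.fst ℝ (EuclideanSpace ℝ (Fin 1))
          (EuclideanSpace ℝ (Fin (2 * n + 1))))) := by
  have h1 : HasMFDerivAt (𝓡∂ 1) 𝓘(ℝ, EuclideanSpace ℝ (Fin 1)) (𝓡∂ 1) y.1
    (ContinuousLinearMap.id _ _) := ModelWithCorners.hasMFDerivAt (𝓡∂ 1)
  have h2 := (EuclideanSpace.proj (0 : Fin 1) :
    EuclideanSpace ℝ (Fin 1) →L[ℝ] ℝ).hasMFDerivAt (x := (𝓡∂ 1) y.1)
  exact (h2.comp y.1 h1).comp y (hasMFDerivAt_fst (I := 𝓡∂ 1) (I' := 𝓡 (2 * n + 1)) (x := y))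

theorem mvfderiv_rad_apply (y : EuclideanHalfSpace 1 × M) (v : TangentSpace (collarModel n) y) :
    mvfderiv (collarModel n) rad y v =
      (show EuclideanSpace ℝ (Fin 1) × EuclideanSpace ℝ (Fin (2 * n + 1)) from v).1 0 := by
  rw [mvfderiv, (hasMFDerivAt_rad y).mfderiv]
  rfl

theorem contMDiff_rad : ContMDiff (collarModel n) 𝓘(ℝ, ℝ) ∞
    (rad : EuclideanHalfSpace 1 × M → ℝ) := by
  have h1 : ContMDiff (𝓡∂ 1) 𝓘(ℝ, EuclideanSpace ℝ (Fin 1)) ∞ (𝓡∂ 1) :=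
    ModelWithCorners.contMDiff (𝓡∂ 1)
  have h2 := (EuclideanSpace.proj (0 : Fin 1) : EuclideanSpace ℝ (Fin 1) →L[ℝ] ℝ).contMDiff (n := ∞)
  exact (h2.comp h1).comp contMDiff_fst

/-- The boundary of the collar is adherent to its interior. -/
theorem neBot_nhdsWithin_rad (q : M) :
    (𝓝[{y | 0 < rad y}] ((0 : EuclideanHalfSpace 1), q)).NeBot := by
  -- The inward curve `t ↦ (t, q)`, truncated at `0` so as to stay in the half-line for every real
  -- `t`.
  let c : ℝ → EuclideanHalfSpace 1 × M := fun t =>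
    (⟨EuclideanSpace.single 0 (max t 0), by simp⟩, q)
  have hc : Continuous c := by
    refine Continuous.prodMk (Continuous.subtype_mk ?_ _) continuous_const
    have h1 : (fun t : ℝ => EuclideanSpace.single (0 : Fin 1) (max t 0)) =
        fun t => max t 0 • EuclideanSpace.single (0 : Fin 1) (1 : ℝ) := by
      funext t
      refine PiLp.ext fun i => ?_
      rw [Subsingleton.elim i 0]
      simp
    rw [h1]
    fun_prop
  have hc0 : c 0 = ((0 : EuclideanHalfSpace 1), q) := by
    refine Prod.ext (Subtype.ext ?_) rfl
    refine PiLp.ext fun i => ?_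
    rw [Subsingleton.elim i 0]
    simp [c]
    rfl
  have h : Tendsto c (𝓝[>] 0) (𝓝[{y | 0 < rad y}] ((0 : EuclideanHalfSpace 1), q)) := by
    refine tendsto_nhdsWithin_iff.2 ⟨?_, ?_⟩
    · rw [← hc0]
      exact hc.continuousAt.tendsto.mono_left nhdsWithin_le_nhds
    · filter_upwards [self_mem_nhdsWithin] with t ht
      have ht' : (0 : ℝ) < t := ht
      simp [c, rad, ht']
  exact h.neBot

theorem isOpen_interior (n : ℕ) (X : Type*) [TopologicalSpace X]
    [ChartedSpace (EuclideanHalfSpace (2 * n + 2)) X] [IsManifold (𝓡∂ (2 * n + 2)) ∞ X] :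
    IsOpen ((𝓡∂ (2 * n + 2)).interior X) :=
  (𝓡∂ (2 * n + 2)).isOpen_interior (n := ∞) (by simp)

variable {X : Type*} [TopologicalSpace X]
  [ChartedSpace (EuclideanHalfSpace (2 * n + 2)) X]

/-- `Ψ` is a collar of the boundary `ι` of `X`. -/
structure IsCollar (ι : M → X)
    (Ψ : PartialDiffeomorph (collarModel n) (𝓡∂ (2 * n + 2)) (EuclideanHalfSpace 1 × M) X ∞) :
    Prop where
  range_eq : Set.range ι = (𝓡∂ (2 * n + 2)).boundary X
  mem_source : ∀ q, ((0 : EuclideanHalfSpace 1), q) ∈ Ψ.source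
  apply_zero : ∀ q, Ψ (0, q) = ι q

namespace IsCollar

variable {ι : M → X}
  {Ψ : PartialDiffeomorph (collarModel n) (𝓡∂ (2 * n + 2)) (EuclideanHalfSpace 1 × M) X ∞}
  (hΨ : IsCollar ι Ψ)
include hΨ

theorem isBoundaryPoint (q : M) : (𝓡∂ (2 * n + 2)).IsBoundaryPoint (ι q) := by
  have : ι q ∈ (𝓡∂ (2 * n + 2)).boundary X := hΨ.range_eq ▸ ⟨q, rfl⟩
  exact this

theorem mem_target (q : M) : ι q ∈ Ψ.target := hΨ.apply_zero q ▸ Ψ.map_source (hΨ.mem_source q)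

theorem symm_apply (q : M) : Ψ.symm (ι q) = (0, q) := by
  rw [← hΨ.apply_zero q]
  exact Ψ.left_inv (hΨ.mem_source q)

theorem isInteriorPoint_iff {p : X} (hp : p ∈ Ψ.target) :
    (𝓡∂ (2 * n + 2)).IsInteriorPoint p ↔ 0 < rad (Ψ.symm p) := by
  rw [(𝓡∂ (2 * n + 2)).isInteriorPoint_iff_not_isBoundaryPoint]
  constructor
  · intro h
    refine lt_of_le_of_ne (rad_nonneg _) fun h0 => h ?_
    have h1 := eq_zero_of_rad_eq_zero h0.symm
    have h2 : Ψ (Ψ.symm p) = p := Ψ.right_inv hp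
    rw [← h2, h1, hΨ.apply_zero]
    exact hΨ.isBoundaryPoint _
  · intro h hb
    have : p ∈ Set.range ι := hΨ.range_eq ▸ hb
    obtain ⟨q, rfl⟩ := this
    rw [hΨ.symm_apply, rad_zero] at h
    exact lt_irrefl _ h

theorem isInteriorPoint_apply_iff {y : EuclideanHalfSpace 1 × M} (hy : y ∈ Ψ.source) :
    (𝓡∂ (2 * n + 2)).IsInteriorPoint (Ψ y) ↔ 0 < rad y := by
  rw [hΨ.isInteriorPoint_iff (Ψ.map_source hy)]
  have : Ψ.symm (Ψ y) = y := Ψ.left_inv hy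
  rw [this]

theorem continuousAt (q : M) : ContinuousAt Ψ ((0 : EuclideanHalfSpace 1), q) :=
  Ψ.contMDiffOn.continuousOn.continuousAt (Ψ.open_source.mem_nhds (hΨ.mem_source q))

theorem tendsto_nhdsWithin (q : M) :
    Tendsto Ψ (𝓝[{y | 0 < rad y}] ((0 : EuclideanHalfSpace 1), q))
      (𝓝[(𝓡∂ (2 * n + 2)).interior X] (ι q)) := by
  refine tendsto_nhdsWithin_iff.2 ⟨?_, ?_⟩
  · rw [← hΨ.apply_zero q]
    exact (hΨ.continuousAt q).tendsto.mono_left nhdsWithin_le_nhds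
  · filter_upwards [self_mem_nhdsWithin,
      mem_nhdsWithin_of_mem_nhds (Ψ.open_source.mem_nhds (hΨ.mem_source q))] with y hy hys
    exact (hΨ.isInteriorPoint_apply_iff hys).2 hy

theorem neBot_nhdsWithin (q : M) : (𝓝[(𝓡∂ (2 * n + 2)).interior X] (ι q)).NeBot :=
  have := neBot_nhdsWithin_rad q
  (hΨ.tendsto_nhdsWithin q).neBot

/-- Boundary points are limits of interior points, and limits are unique. This transfers every
identity proved in the interior, where `Δ` is defined, to `M`. -/
theorem eqOn_of_eqOn_interior {U : Set X} (hU : IsOpen U) {f f' : X → ℝ} (hf : ContinuousOn f U)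
    (hf' : ContinuousOn f' U) (h : Set.EqOn f f' (U ∩ (𝓡∂ (2 * n + 2)).interior X)) :
    Set.EqOn f f' U := by
  intro p hp
  rcases (𝓡∂ (2 * n + 2)).isInteriorPoint_or_isBoundaryPoint p with hi | hb
  · exact h ⟨hp, hi⟩
  · have : p ∈ Set.range ι := hΨ.range_eq ▸ hb
    obtain ⟨q, rfl⟩ := this
    have := hΨ.neBot_nhdsWithin q
    have h1 := ((hf.continuousAt (hU.mem_nhds hp)).tendsto).mono_left
      (nhdsWithin_le_nhds (s := (𝓡∂ (2 * n + 2)).interior X))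
    have h2 := ((hf'.continuousAt (hU.mem_nhds hp)).tendsto).mono_left
      (nhdsWithin_le_nhds (s := (𝓡∂ (2 * n + 2)).interior X))
    refine tendsto_nhds_unique (h1.congr' ?_) h2
    filter_upwards [self_mem_nhdsWithin, mem_nhdsWithin_of_mem_nhds (hU.mem_nhds hp)] with x hx hxU
    exact h ⟨hxU, hx⟩

/-- A function on the interior which has smooth extensions near all boundary points has a smooth
extension. -/
theorem exists_extension [IsManifold (𝓡∂ (2 * n + 2)) ∞ X] {f : X → ℝ}
    (hf : ContMDiffOn (𝓡∂ (2 * n + 2)) 𝓘(ℝ, ℝ) ∞ f ((𝓡∂ (2 * n + 2)).interior X))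
    (hloc : ∀ q : M, ∃ U : Set X, IsOpen U ∧ ι q ∈ U ∧ ∃ h : X → ℝ,
      ContMDiffOn (𝓡∂ (2 * n + 2)) 𝓘(ℝ, ℝ) ∞ h U ∧
      Set.EqOn f h (U ∩ (𝓡∂ (2 * n + 2)).interior X)) :
    ∃ h : X → ℝ, ContMDiff (𝓡∂ (2 * n + 2)) 𝓘(ℝ, ℝ) ∞ h ∧
      Set.EqOn f h ((𝓡∂ (2 * n + 2)).interior X) := by
  classical
  choose U hU hqU h hs heq using hloc
  have hex : ∀ p : X, ¬ (𝓡∂ (2 * n + 2)).IsInteriorPoint p → ∃ q, ι q = p := by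
    intro p hp
    have : p ∈ Set.range ι := hΨ.range_eq ▸
      ((𝓡∂ (2 * n + 2)).isBoundaryPoint_iff_not_isInteriorPoint p).2 hp
    exact this
  -- The local extension used at a boundary point is an arbitrary choice. `hFU` shows that the value
  -- does not depend on it, because two local extensions agree in the interior.
  let F : X → ℝ := fun p =>
    if hp : (𝓡∂ (2 * n + 2)).IsInteriorPoint p then f p else h (hex p hp).choose p
  have hFi : Set.EqOn F f ((𝓡∂ (2 * n + 2)).interior X) := fun p hp => dif_pos hp
  have hFU : ∀ q, Set.EqOn F (h q) (U q) := by
    intro q p hp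
    by_cases hi : (𝓡∂ (2 * n + 2)).IsInteriorPoint p
    · rw [hFi hi]; exact heq q ⟨hp, hi⟩
    · have hF : F p = h (hex p hi).choose p := dif_neg hi
      rw [hF]
      have hp' : p ∈ U (hex p hi).choose := by
        have := hqU (hex p hi).choose
        rwa [(hex p hi).choose_spec] at this
      generalize (hex p hi).choose = q' at hp'
      refine hΨ.eqOn_of_eqOn_interior ((hU q').inter (hU q))
        ((hs q').continuousOn.mono Set.inter_subset_left)
        ((hs q).continuousOn.mono Set.inter_subset_right) ?_ ⟨hp', hp⟩
      rintro x ⟨⟨hx, hx'⟩, hxi⟩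
      rw [← heq q' ⟨hx, hxi⟩, heq q ⟨hx', hxi⟩]
  refine ⟨F, fun p => ?_, hFi.symm⟩
  by_cases hi : (𝓡∂ (2 * n + 2)).IsInteriorPoint p
  · exact (hf.congr hFi).contMDiffAt ((isOpen_interior n X).mem_nhds hi)
  · obtain ⟨q, rfl⟩ := hex p hi
    exact ((hs q).congr (hFU q)).contMDiffAt ((hU q).mem_nhds (hqU q))

end IsCollar

end Collar

/-! ### Defining functions from the collar and division by them -/

section Collar

variable {n : ℕ} {M : Type*} [TopologicalSpace M]
  [ChartedSpace (EuclideanSpace ℝ (Fin (2 * n + 1))) M]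
  {X : Type*} [TopologicalSpace X] [ChartedSpace (EuclideanHalfSpace (2 * n + 2)) X]

namespace IsCollar

variable {ι : M → X}
  {Ψ : PartialDiffeomorph (collarModel n) (𝓡∂ (2 * n + 2)) (EuclideanHalfSpace 1 × M) X ∞}
  (hΨ : IsCollar ι Ψ)
include hΨ

/-- Smooth functions on the collar can be glued to the constant `c`. -/
theorem exists_glue [T2Space X] [SigmaCompactSpace X] [IsManifold (𝓡∂ (2 * n + 2)) ∞ X] :
    ∃ χ : X → ℝ, (∀ p, χ p ∈ Set.Icc 0 1) ∧ (∀ p ∉ Ψ.target, χ p = 0) ∧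
      (∃ V : Set X, IsOpen V ∧ (∀ q, ι q ∈ V) ∧ V ⊆ Ψ.target ∧ ∀ p ∈ V, χ p = 1) ∧
      ∀ (F : EuclideanHalfSpace 1 × M → ℝ) (c : ℝ), ContMDiff (collarModel n) 𝓘(ℝ, ℝ) ∞ F →
        ContMDiff (𝓡∂ (2 * n + 2)) 𝓘(ℝ, ℝ) ∞
          (fun p => χ p * F (Ψ.symm p) + (1 - χ p) * c) := by
  have : LocallyCompactSpace X := Manifold.locallyCompact_of_finiteDimensional (𝓡∂ (2 * n + 2))
  have hb : IsClosed ((𝓡∂ (2 * n + 2)).boundary X) :=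
    ModelWithCorners.isClosed_boundary (n := ∞) (by simp)
  have hbt : (𝓡∂ (2 * n + 2)).boundary X ⊆ Ψ.target := by
    rw [← hΨ.range_eq]
    rintro _ ⟨q, rfl⟩
    exact hΨ.mem_target q
  obtain ⟨χ, h0, h1, h01⟩ := exists_contMDiffMap_zero_one_nhds_of_isClosed (n := ⊤)
    (𝓡∂ (2 * n + 2)) Ψ.open_target.isClosed_compl hb
    (Set.disjoint_left.2 fun p hp hp' => hp (hbt hp'))
  have hχ : ContMDiff (𝓡∂ (2 * n + 2)) 𝓘(ℝ, ℝ) ∞ χ := χ.contMDiff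
  refine ⟨χ, h01, fun p hp => h0.self_of_nhdsSet p hp, ?_, fun F c hF => ?_⟩
  · obtain ⟨V, hV, hbV, hV1⟩ := mem_nhdsSet_iff_exists.1 h1
    refine ⟨V ∩ Ψ.target, hV.inter Ψ.open_target, fun q => ⟨hbV ?_, hΨ.mem_target q⟩,
      Set.inter_subset_right, fun p hp => hV1 hp.1⟩
    exact hΨ.isBoundaryPoint q
  · obtain ⟨W, hW, htW, hW0⟩ := mem_nhdsSet_iff_exists.1 h0
    intro p
    by_cases hp : p ∈ Ψ.target
    · have hFp : ContMDiffAt (𝓡∂ (2 * n + 2)) 𝓘(ℝ, ℝ) ∞ (fun p => F (Ψ.symm p)) p :=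
        hF.contMDiffAt.comp p (Ψ.contMDiffOn_invFun.contMDiffAt (Ψ.open_target.mem_nhds hp))
      exact (hχ.contMDiffAt.mul hFp).add ((contMDiffAt_const.sub hχ.contMDiffAt).mul contMDiffAt_const)
    · refine (contMDiffAt_const (c := c)).congr_of_eventuallyEq ?_
      filter_upwards [hW.mem_nhds (htW hp)] with x hx
      have : χ x = 0 := hW0 hx
      simp [this]

end IsCollar

/-- `ρ` is a defining function which is the coordinate `rad` of the collar `Ψ` in the neighborhood
`V` of the boundary. -/
structure IsCollarFunction (ι : M → X)
    (Ψ : PartialDiffeomorph (collarModel n) (𝓡∂ (2 * n + 2)) (EuclideanHalfSpace 1 × M) X ∞)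
    (V : Set X) (ρ : X → ℝ) : Prop extends IsCollar ι Ψ where
  isOpen : IsOpen V
  mem : ∀ q, ι q ∈ V
  subset_target : V ⊆ Ψ.target
  eq_rad : ∀ p ∈ V, ρ p = rad (Ψ.symm p)
  smooth : ContMDiff (𝓡∂ (2 * n + 2)) 𝓘(ℝ, ℝ) ∞ ρ
  pos : ∀ p, (𝓡∂ (2 * n + 2)).IsInteriorPoint p → 0 < ρ p

theorem IsCollar.exists_isCollarFunction [T2Space X] [SigmaCompactSpace X]
    [IsManifold (𝓡∂ (2 * n + 2)) ∞ X] {ι : M → X}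
    {Ψ : PartialDiffeomorph (collarModel n) (𝓡∂ (2 * n + 2)) (EuclideanHalfSpace 1 × M) X ∞}
    (hΨ : IsCollar ι Ψ) : ∃ V ρ, IsCollarFunction ι Ψ V ρ := by
  obtain ⟨χ, h01, h0, ⟨V, hV, hιV, hVt, hV1⟩, hs⟩ := hΨ.exists_glue
  -- Gluing to the constant `1` keeps the function positive in the interior away from the collar.
  refine ⟨V, fun p => χ p * rad (Ψ.symm p) + (1 - χ p) * 1, hΨ, hV, hιV, hVt, fun p hp => ?_,
    hs _ 1 contMDiff_rad, fun p hp => ?_⟩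
  · simp [hV1 p hp]
  · by_cases ht : p ∈ Ψ.target
    · have h1 := (hΨ.isInteriorPoint_iff ht).1 hp
      rcases (h01 p).1.eq_or_lt with h | h
      · simp [← h]
      · have := (h01 p).2
        nlinarith [mul_pos h h1]
    · simp [h0 p ht]

theorem IsCollar.exists_contMDiff_extension [T2Space X] [SigmaCompactSpace X]
    [IsManifold (𝓡∂ (2 * n + 2)) ∞ X] {ι : M → X}
    {Ψ : PartialDiffeomorph (collarModel n) (𝓡∂ (2 * n + 2)) (EuclideanHalfSpace 1 × M) X ∞}
    (hΨ : IsCollar ι Ψ) {c : M → ℝ} (hc : ContMDiff (𝓡 (2 * n + 1)) 𝓘(ℝ, ℝ) ∞ c) :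
    ∃ f : X → ℝ, ContMDiff (𝓡∂ (2 * n + 2)) 𝓘(ℝ, ℝ) ∞ f ∧ ∀ q, f (ι q) = c q := by
  obtain ⟨χ, h01, h0, ⟨V, hV, hιV, hVt, hV1⟩, hs⟩ := hΨ.exists_glue
  refine ⟨_, hs (fun y => c y.2) 0 (hc.comp contMDiff_snd), fun q => ?_⟩
  have h1 := hΨ.symm_apply q
  simp only [hV1 _ (hιV q), h1]
  ring

namespace IsCollarFunction

variable {ι : M → X}
  {Ψ : PartialDiffeomorph (collarModel n) (𝓡∂ (2 * n + 2)) (EuclideanHalfSpace 1 × M) X ∞}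
  {V : Set X} {ρ : X → ℝ} (h : IsCollarFunction ι Ψ V ρ)
include h

theorem apply_boundary (q : M) : ρ (ι q) = 0 := by
  rw [h.eq_rad _ (h.mem q), h.symm_apply, rad_zero]

/-- On `V` the composition `ρ ∘ Ψ` is `rad`. This is what makes `ρ` a coordinate dual to the pushed
forward `∂_r`. -/
theorem mvfderiv_apply {y : EuclideanHalfSpace 1 × M} (hy : y ∈ Ψ.source) (hyV : Ψ y ∈ V)
    (w : TangentSpace (collarModel n) y) :
    mvfderiv (𝓡∂ (2 * n + 2)) ρ (Ψ y) (mfderiv (collarModel n) (𝓡∂ (2 * n + 2)) Ψ y w) =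
      (show EuclideanSpace ℝ (Fin 1) × EuclideanSpace ℝ (Fin (2 * n + 1)) from w).1 0 := by
  have hΨ := (Ψ.contMDiffOn.contMDiffAt (Ψ.open_source.mem_nhds hy))
  rw [← mvfderiv_comp_apply y (h.smooth.mdifferentiableAt (by simp))
    (hΨ.mdifferentiableAt (by simp)), ← mvfderiv_rad_apply]
  refine DFunLike.congr_fun (mvfderiv_congr ?_) w
  filter_upwards [hΨ.continuousAt.preimage_mem_nhds (h.isOpen.mem_nhds hyV),
    Ψ.open_source.mem_nhds hy] with z hz hzs
  have h1 : Ψ.symm (Ψ z) = z := Ψ.left_inv hzs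
  rw [Function.comp_apply, h.eq_rad _ hz, h1]

theorem isDefiningFunction : IsDefiningFunction (n := n) ρ where
  smooth := h.smooth
  pos_iff p := by
    refine ⟨fun hp => ?_, h.pos p⟩
    by_contra hi
    have : p ∈ Set.range ι := h.range_eq ▸
      ((𝓡∂ (2 * n + 2)).isBoundaryPoint_iff_not_isInteriorPoint p).2 hi
    obtain ⟨q, rfl⟩ := this
    rw [h.apply_boundary] at hp
    exact lt_irrefl _ hp
  deriv_ne_zero p hp h0 := by
    rw [← h.range_eq] at hp
    obtain ⟨q, rfl⟩ := hp
    have h1 := h.mvfderiv_apply (h.mem_source q) (by rw [h.apply_zero]; exact h.mem q)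
      ((EuclideanSpace.single 0 1, 0) :
        EuclideanSpace ℝ (Fin 1) × EuclideanSpace ℝ (Fin (2 * n + 1)))
    rw [h.apply_zero, h0] at h1
    simp at h1

/-- A smooth function vanishing at the boundary is divisible by `ρ`. -/
theorem exists_eq_mul [IsManifold (𝓡∂ (2 * n + 2)) ∞ X] [IsManifold (𝓡 (2 * n + 1)) ∞ M] {f : X → ℝ}
    (hf : ContMDiff (𝓡∂ (2 * n + 2)) 𝓘(ℝ, ℝ) ∞ f) (hf0 : ∀ q, f (ι q) = 0) :
    ∃ k : X → ℝ, ContMDiff (𝓡∂ (2 * n + 2)) 𝓘(ℝ, ℝ) ∞ k ∧ ∀ p, f p = ρ p * k p := by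
  obtain ⟨k, hk, hfk⟩ := h.exists_extension (f := fun p => f p / ρ p)
    (fun p hp => ((hf p).div₀ (h.smooth p) (h.pos p hp).ne').contMDiffWithinAt) fun q => by
    set φ := extChartAt (𝓡 (2 * n + 1)) q
    let ψ : EuclideanSpace ℝ (Fin 1) × EuclideanSpace ℝ (Fin (2 * n + 1)) →
      EuclideanHalfSpace 1 × M := fun a => ((𝓡∂ 1).symm a.1, φ.symm a.2)
    let κ : EuclideanHalfSpace 1 × M →
      EuclideanSpace ℝ (Fin 1) × EuclideanSpace ℝ (Fin (2 * n + 1)) := fun y => ((𝓡∂ 1) y.1, φ y.2)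
    have hr : Set.range (𝓡∂ 1) = {y | 0 ≤ y 0} := range_euclideanHalfSpace 1
    have hφt : IsOpen φ.target := isOpen_extChartAt_target q
    have hψs : ContMDiffOn 𝓘(ℝ, EuclideanSpace ℝ (Fin 1) × EuclideanSpace ℝ (Fin (2 * n + 1)))
        (collarModel n) ∞ ψ (Set.range (𝓡∂ 1) ×ˢ φ.target) :=
      ((𝓡∂ 1).contMDiffOn_symm.comp contDiff_fst.contMDiff.contMDiffOn fun a ha => ha.1).prodMk
        ((contMDiffOn_extChartAt_symm q).comp contDiff_snd.contMDiff.contMDiffOn fun a ha => ha.2)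
    have hκs : ContMDiffOn (collarModel n)
        𝓘(ℝ, EuclideanSpace ℝ (Fin 1) × EuclideanSpace ℝ (Fin (2 * n + 1))) ∞ κ
        {y | y.2 ∈ φ.source} := by
      refine (((𝓡∂ 1).contMDiff.comp contMDiff_fst).contMDiffOn).prodMk_space ?_
      refine contMDiffOn_extChartAt.comp contMDiff_snd.contMDiffOn fun y hy => ?_
      rw [← extChartAt_source (𝓡 (2 * n + 1))]
      exact hy
    have hψκ : ∀ y, y.2 ∈ φ.source → ψ (κ y) = y := fun y hy =>
      Prod.ext ((𝓡∂ 1).left_inv y.1) (φ.left_inv hy)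
    have hqs : q ∈ φ.source := mem_extChartAt_source q
    have hκq : κ (0, q) = (0, φ q) := rfl
    have hψq : ψ (0, φ q) = (0, q) := by rw [← hκq, hψκ _ hqs]
    have hψc : ContinuousAt ψ (0, φ q) := by
      refine ((𝓡∂ 1).continuous_symm.continuousAt.comp continuousAt_fst).prodMk ?_
      exact (continuousAt_extChartAt_symm q).comp
        (f := Prod.snd) (x := ((0 : EuclideanSpace ℝ (Fin 1)), φ q)) continuousAt_snd
    have hmem : {a | a.2 ∈ φ.target ∧ ψ a ∈ Ψ.source} ∈
        𝓝 ((0 : EuclideanSpace ℝ (Fin 1)), φ q) := by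
      refine inter_mem (continuous_snd.continuousAt.preimage_mem_nhds
        (hφt.mem_nhds (φ.map_source hqs))) (hψc.preimage_mem_nhds ?_)
      rw [hψq]
      exact Ψ.open_source.mem_nhds (h.mem_source q)
    obtain ⟨ε, hε, hball⟩ := Metric.mem_nhds_iff.1 hmem
    rw [← ball_prod_same] at hball
    -- In a chart the collar is this half-ball times a ball. The set is convex, has unique
    -- differentials, and is stable under shrinking the first coordinate, as Hadamard's lemma
    -- requires.
    set s : Set (EuclideanSpace ℝ (Fin 1) × EuclideanSpace ℝ (Fin (2 * n + 1))) :=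
      (Set.range (𝓡∂ 1) ∩ Metric.ball 0 ε) ×ˢ Metric.ball (φ q) ε with hs
    have hs1 : ∀ a ∈ s, a.2 ∈ φ.target ∧ ψ a ∈ Ψ.source := fun a ha => hball ⟨ha.1.2, ha.2⟩
    have hFs : ContDiffOn ℝ ∞ (fun a => f (Ψ (ψ a))) s := by
      refine contMDiffOn_iff_contDiffOn.1 ?_
      exact hf.comp_contMDiffOn (Ψ.contMDiffOn.comp
        (hψs.mono fun a ha => ⟨ha.1.1, (hs1 a ha).1⟩) fun a ha => (hs1 a ha).2)
    obtain ⟨k₀, hk₀, hk₀F⟩ := exists_contDiffOn_eq_apply (s := s)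
      (((𝓡∂ 1).convex_range.inter (convex_ball _ _)).prod (convex_ball _ _))
      (((𝓡∂ 1).uniqueDiffOn.inter Metric.isOpen_ball).prod Metric.isOpen_ball.uniqueDiffOn)
      (fun a ha t ht => by
        refine ⟨⟨?_, ?_⟩, ha.2⟩
        · have := ha.1.1
          rw [hr] at this ⊢
          exact mul_nonneg ht.1 this
        · have h1 := ha.1.2
          rw [mem_ball_zero_iff] at h1 ⊢
          rw [norm_smul, Real.norm_of_nonneg ht.1]
          exact (mul_le_of_le_one_left (norm_nonneg _) ht.2).trans_lt h1)
      hFs (fun a ha => by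
        have h1 : ψ (0, a.2) = (0, φ.symm a.2) :=
          Prod.ext ((𝓡∂ 1).left_inv (0 : EuclideanHalfSpace 1)) rfl
        simp only [h1, h.apply_zero, hf0]) (EuclideanSpace.single 0 1)
    have hcont : ContinuousAt Ψ.symm (ι q) :=
      Ψ.contMDiffOn_invFun.continuousOn.continuousAt (Ψ.open_target.mem_nhds (h.mem_target q))
    have hsymm := h.symm_apply q
    have hsrc : {p | (Ψ.symm p).2 ∈ φ.source} ∈ 𝓝 (ι q) := by
      refine (continuous_snd.continuousAt.comp hcont).preimage_mem_nhds ?_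
      refine (isOpen_extChartAt_source q).mem_nhds ?_
      rw [Function.comp_apply, hsymm]
      exact hqs
    have hbl : {p | κ (Ψ.symm p) ∈ Metric.ball ((0 : EuclideanSpace ℝ (Fin 1)), φ q) ε} ∈
        𝓝 (ι q) := by
      have hκc : ContinuousAt κ (Ψ.symm (ι q)) := by
        rw [hsymm]
        refine (hκs.continuousOn.continuousAt ?_)
        exact continuous_snd.continuousAt.preimage_mem_nhds
          ((isOpen_extChartAt_source q).mem_nhds hqs)
      refine (hκc.comp hcont).preimage_mem_nhds ?_
      rw [Function.comp_apply, hsymm, hκq]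
      exact Metric.ball_mem_nhds _ hε
    obtain ⟨U, hU, hUo, hqU⟩ := mem_nhds_iff.1
      (inter_mem (inter_mem hsrc hbl) (h.isOpen.mem_nhds (h.mem q)))
    have hUs : ∀ p ∈ U, κ (Ψ.symm p) ∈ s := by
      intro p hp
      have h1 := (hU hp).1.2
      rw [Set.mem_ofPred_eq, ← ball_prod_same] at h1
      exact ⟨⟨⟨_, rfl⟩, h1.1⟩, h1.2⟩
    refine ⟨U, hUo, hqU, fun p => k₀ (κ (Ψ.symm p)), ?_, ?_⟩
    · refine hk₀.contMDiffOn.comp (hκs.comp (Ψ.contMDiffOn_invFun.mono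
        fun p hp => h.subset_target (hU hp).2) fun p hp => (hU hp).1.1) fun p hp => hUs p hp
    · rintro p ⟨hp, hpi⟩
      have h1 : Ψ (Ψ.symm p) = p := Ψ.right_inv (h.subset_target (hU hp).2)
      have h2 := hk₀F _ (hUs p hp) (ρ p) (by
        refine PiLp.ext fun i => ?_
        rw [Subsingleton.elim i 0, h.eq_rad p (hU hp).2]
        simp [κ, rad])
      rw [hψκ _ (hU hp).1.1, h1] at h2
      simp only [h2]
      field_simp [(h.pos p hpi).ne']
  refine ⟨k, hk, ?_⟩
  have h1 : Set.EqOn f (fun p => ρ p * k p) Set.univ := by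
    refine h.eqOn_of_eqOn_interior isOpen_univ hf.continuous.continuousOn
      (h.smooth.continuous.mul hk.continuous).continuousOn fun p hp => ?_
    have h2 := hfk hp.2
    have h3 := (h.pos p hp.2).ne'
    simp only at h2 ⊢
    rw [← h2]
    field_simp
  exact fun p => h1 (Set.mem_univ p)

end IsCollarFunction

end Collar

/-! ### Vector fields on the collar and their pushforwards -/

section Push

variable {n : ℕ} {M : Type*} [TopologicalSpace M]
  [ChartedSpace (EuclideanSpace ℝ (Fin (2 * n + 1))) M]

theorem contMDiff_const_halfSpace (a : EuclideanSpace ℝ (Fin 1)) :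
    ContMDiff (𝓡∂ 1) (𝓡∂ 1).tangent ∞
      (fun x : EuclideanHalfSpace 1 => (⟨x, a⟩ : TangentBundle (𝓡∂ 1) (EuclideanHalfSpace 1))) := by
  intro x₀
  refine (contMDiffAt_section (F := EuclideanSpace ℝ (Fin 1)) (E := TangentSpace (𝓡∂ 1))
    (s := fun _ : EuclideanHalfSpace 1 => a) x₀).2 ?_
  have : (fun x : EuclideanHalfSpace 1 => (trivializationAt (EuclideanSpace ℝ (Fin 1))
      (TangentSpace (𝓡∂ 1)) x₀ (⟨x, a⟩ : TangentBundle (𝓡∂ 1) (EuclideanHalfSpace 1))).2) =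
      fun _ => a := by
    funext x
    simp
  rw [this]
  exact contMDiffAt_const

/-- The vector field `a + W` on the collar, for a constant vector `a` in the direction of the
half-line and a vector field `W` on `M`. -/
def collarVF (a : EuclideanSpace ℝ (Fin 1)) (W : ∀ q : M, TangentSpace (𝓡 (2 * n + 1)) q)
    (y : EuclideanHalfSpace 1 × M) : TangentSpace (collarModel n) y :=
  ((a, W y.2) : EuclideanSpace ℝ (Fin 1) × EuclideanSpace ℝ (Fin (2 * n + 1)))

theorem contMDiffOn_collarVF [IsManifold (𝓡 (2 * n + 1)) ∞ M] (a : EuclideanSpace ℝ (Fin 1))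
    {W : ∀ q : M, TangentSpace (𝓡 (2 * n + 1)) q} {O : Set M} (hW : SmoothVF (𝓡 (2 * n + 1)) O W) :
    ContMDiffOn (collarModel n) (collarModel n).tangent ∞
      (fun y => (⟨y, collarVF a W y⟩ : TangentBundle (collarModel n) (EuclideanHalfSpace 1 × M)))
      {y | y.2 ∈ O} := by
  have h1 : ContMDiffOn (collarModel n) ((𝓡∂ 1).tangent.prod (𝓡 (2 * n + 1)).tangent) ∞
      (fun y : EuclideanHalfSpace 1 × M =>
        ((⟨y.1, a⟩ : TangentBundle (𝓡∂ 1) (EuclideanHalfSpace 1)),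
          (⟨y.2, W y.2⟩ : TangentBundle (𝓡 (2 * n + 1)) M))) {y | y.2 ∈ O} :=
    (((contMDiff_const_halfSpace a).comp contMDiff_fst).contMDiffOn).prodMk
      (hW.comp contMDiff_snd.contMDiffOn fun y hy => hy)
  exact (contMDiff_equivTangentBundleProd_symm (n := ∞)).comp_contMDiffOn h1

variable {X : Type*} [TopologicalSpace X] [ChartedSpace (EuclideanHalfSpace (2 * n + 2)) X]

/-- The pushforward of a vector field on the collar. -/
def push (Ψ : PartialDiffeomorph (collarModel n) (𝓡∂ (2 * n + 2)) (EuclideanHalfSpace 1 × M) X ∞)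
    (C : ∀ y : EuclideanHalfSpace 1 × M, TangentSpace (collarModel n) y) (p : X) :
    TangentSpace (𝓡∂ (2 * n + 2)) p :=
  (mfderiv (collarModel n) (𝓡∂ (2 * n + 2)) Ψ (Ψ.symm p) (C (Ψ.symm p)) :
    EuclideanSpace ℝ (Fin (2 * n + 2)))

variable {Ψ : PartialDiffeomorph (collarModel n) (𝓡∂ (2 * n + 2)) (EuclideanHalfSpace 1 × M) X ∞}

theorem push_apply (C : ∀ y : EuclideanHalfSpace 1 × M, TangentSpace (collarModel n) y)
    {y : EuclideanHalfSpace 1 × M} (hy : y ∈ Ψ.source) :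
    push Ψ C (Ψ y) = mfderiv (collarModel n) (𝓡∂ (2 * n + 2)) Ψ y (C y) := by
  have : Ψ.symm (Ψ y) = y := Ψ.left_inv hy
  rw [push, this]

theorem injective_mfderiv_collar {y : EuclideanHalfSpace 1 × M} (hy : y ∈ Ψ.source) :
    Function.Injective (mfderiv (collarModel n) (𝓡∂ (2 * n + 2)) Ψ y) :=
  ((PartialDiffeomorph.isLocalDiffeomorphAt _ _ _ Ψ hy).mfderivToContinuousLinearEquiv (by simp)).injective

/-- The pushforward is the tangent map of `Ψ` composed with the section `C` and with the inverse of
`Ψ`, all three smooth. -/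
theorem smoothVF_push [IsManifold (𝓡 (2 * n + 1)) ∞ M] [IsManifold (𝓡∂ (2 * n + 2)) ∞ X]
    {C : ∀ y : EuclideanHalfSpace 1 × M, TangentSpace (collarModel n) y}
    {A : Set (EuclideanHalfSpace 1 × M)}
    (hC : ContMDiffOn (collarModel n) (collarModel n).tangent ∞
      (fun y => (⟨y, C y⟩ : TangentBundle (collarModel n) (EuclideanHalfSpace 1 × M))) A) :
    SmoothVF (𝓡∂ (2 * n + 2)) (Ψ.target ∩ Ψ.symm ⁻¹' A) (push Ψ C) := by
  have h1 : ContMDiffOn (collarModel n).tangent (𝓡∂ (2 * n + 2)).tangent ∞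
      (tangentMap (collarModel n) (𝓡∂ (2 * n + 2)) Ψ)
      (TotalSpace.proj ⁻¹' Ψ.source) := by
    refine (Ψ.contMDiffOn.contMDiffOn_tangentMapWithin (m := ∞) (by simp)
      Ψ.open_source.uniqueMDiffOn).congr ?_
    rintro ⟨y, v⟩ hy
    refine (tangentMapWithin_eq_tangentMap (Ψ.open_source.uniqueMDiffOn _ hy) ?_).symm
    exact (Ψ.contMDiffOn.contMDiffAt (Ψ.open_source.mem_nhds hy)).mdifferentiableAt (by simp)
  have h0 : ContMDiffOn (𝓡∂ (2 * n + 2)) (collarModel n) ∞ Ψ.symm (Ψ.target ∩ Ψ.symm ⁻¹' A) :=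
    Ψ.contMDiffOn_invFun.mono Set.inter_subset_left
  have h2 := h1.comp (hC.comp h0 fun p hp => hp.2) fun p hp => Ψ.map_target hp.1
  refine ContMDiffOn.congr h2 fun p hp => ?_
  have h3 : Ψ (Ψ.symm p) = p := Ψ.right_inv hp.1
  change (⟨p, push Ψ C p⟩ : TangentBundle (𝓡∂ (2 * n + 2)) X) = ⟨Ψ (Ψ.symm p), push Ψ C p⟩
  exact TotalSpace.ext h3.symm HEq.rfl

end Push

/-! ### Linear algebra of a subspace of type `(1, 0)` -/

section CRAlgebra

variable {W : Type*} [AddCommGroup W] [Module ℝ W]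

theorem smul_toC (s t : ℝ) (a b : W) :
    (⟨s, t⟩ : ℂ) • toC a b = toC (s • a - t • b) (s • b + t • a) := by
  have h : (⟨s, t⟩ : ℂ) = s • (1 : ℂ) + t • Complex.I := by
    apply Complex.ext <;> simp
  simp only [toC, smul_add, TensorProduct.smul_tmul', smul_eq_mul, h, add_mul, smul_mul_assoc,
    one_mul, mul_one, Complex.I_mul_I, smul_neg, TensorProduct.neg_tmul, TensorProduct.add_tmul, TensorProduct.tmul_add, TensorProduct.tmul_sub,
    TensorProduct.smul_tmul]
  abel

theorem toC_sum {ι : Type*} (s : Finset ι) (a b : ι → W) :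
    ∑ i ∈ s, toC (a i) (b i) = toC (∑ i ∈ s, a i) (∑ i ∈ s, b i) := by
  simp only [toC, Finset.sum_add_distrib, TensorProduct.tmul_sum]

theorem conjC_toC (a b : W) : conjC (toC a b) = toC a (-b) := by
  simp [conjC, toC, TensorProduct.tmul_neg, TensorProduct.neg_tmul]

variable {S : Submodule ℂ (ℂ ⊗[ℝ] W)} {φ : W →ₗ[ℝ] ℝ}

theorem map_im_eq_zero (hφ : ∀ a b, toC a b ∈ S → φ a = 0) {a b : W} (h : toC a b ∈ S) :
    φ b = 0 := by
  have h1 := S.smul_mem (⟨0, -1⟩ : ℂ) h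
  rw [smul_toC] at h1
  simpa using hφ _ _ h1

/-- Real and imaginary parts of a basis of a space `S` of type `(1, 0)`, together with a vector
transverse to `Re S`, are linearly independent. -/
theorem linearIndependent_re_im {κ : Type*} [Fintype κ] (hS : ∀ z ∈ S, conjC z ∈ S → z = 0)
    (hφ : ∀ a b, toC a b ∈ S → φ a = 0) {A B : κ → W} (hAB : ∀ α, toC (A α) (B α) ∈ S)
    (hli : LinearIndependent ℂ fun α => toC (A α) (B α)) {T : W} (hT : φ T = 1) :
    LinearIndependent ℝ (Sum.elim (fun _ : Unit => T) (Sum.elim A B)) := by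
  rw [Fintype.linearIndependent_iff]
  intro c hc
  simp only [Fintype.sum_sum_type, Sum.elim_inl, Sum.elim_inr, Finset.univ_unique,
    Finset.sum_singleton] at hc
  have hA : ∀ α, φ (A α) = 0 := fun α => hφ _ _ (hAB α)
  have hB : ∀ α, φ (B α) = 0 := fun α => map_im_eq_zero hφ (hAB α)
  have hcT : c (Sum.inl ()) = 0 := by
    have := congrArg φ hc
    simpa [map_sum, hA, hB, hT] using this
  have hc' : ∑ α, c (Sum.inr (Sum.inl α)) • A α + ∑ α, c (Sum.inr (Sum.inr α)) • B α = 0 := by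
    simpa [hcT] using hc
  -- With these coefficients the real part of `∑ ζ α • toC (A α) (B α)` is the given real relation,
  -- hence zero. A purely imaginary element of `S` is minus its conjugate, so it lies in both `S`
  -- and its conjugate and vanishes.
  let ζ : κ → ℂ := fun α => ⟨c (Sum.inr (Sum.inl α)), -c (Sum.inr (Sum.inr α))⟩
  have hz : ∑ α, ζ α • toC (A α) (B α) = 0 := by
    have hmem : ∑ α, ζ α • toC (A α) (B α) ∈ S := S.sum_mem fun α _ => S.smul_mem _ (hAB α)
    refine hS _ hmem ?_
    have h1 : ∑ α, ζ α • toC (A α) (B α) = toC 0 (∑ α, (c (Sum.inr (Sum.inl α)) • B α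
        + (-c (Sum.inr (Sum.inr α))) • A α)) := by
      simp only [ζ, smul_toC, toC_sum]
      congr 1
      rw [← hc', ← Finset.sum_add_distrib]
      exact Finset.sum_congr rfl fun α _ => by rw [neg_smul, sub_neg_eq_add]
    rw [h1] at hmem ⊢
    rw [conjC_toC]
    have h2 := S.neg_mem hmem
    simpa [toC, TensorProduct.tmul_neg] using h2
  have hζ := Fintype.linearIndependent_iff.1 hli ζ hz
  rintro (⟨⟩ | α | α)
  · exact hcT
  · exact congrArg Complex.re (hζ α)
  · simpa [ζ] using congrArg Complex.im (hζ α)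

end CRAlgebra

/-! ### The adapted frame `(∂_r, T, Y)` on the collar -/

section Frame

variable {n : ℕ} {X : Type*} [TopologicalSpace X]
  [ChartedSpace (EuclideanHalfSpace (2 * n + 2)) X] [IsManifold (𝓡∂ (2 * n + 2)) ∞ X]
  {M : Type*} [TopologicalSpace M]
  [ChartedSpace (EuclideanSpace ℝ (Fin (2 * n + 1))) M] [IsManifold (𝓡 (2 * n + 1)) ∞ M]

/-- The data of a collar in which `g` satisfies the ACH condition, with a boundary defining function
that is the collar coordinate near the boundary. -/
structure IsACHCollar (ι : M → X)
    (Θ : ∀ q : M, TangentSpace (𝓡∂ (2 * n + 2)) (ι q) →L[ℝ] ℝ)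
    (g : ∀ p : X, TangentSpace (𝓡∂ (2 * n + 2)) p →L[ℝ]
      TangentSpace (𝓡∂ (2 * n + 2)) p →L[ℝ] ℝ)
    (T10 : ∀ q : M, Submodule ℂ (ℂ ⊗[ℝ] TangentSpace (𝓡 (2 * n + 1)) q))
    (θ : ∀ q : M, TangentSpace (𝓡 (2 * n + 1)) q →L[ℝ] ℝ)
    (T : ∀ q : M, TangentSpace (𝓡 (2 * n + 1)) q)
    (Ψ : PartialDiffeomorph (collarModel n) (𝓡∂ (2 * n + 2)) (EuclideanHalfSpace 1 × M) X ∞)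
    (V : Set X) (ρ : X → ℝ) : Prop extends IsCollarFunction ι Ψ V ρ where
  metric : IsThetaMetric ι Θ g
  cr : IsPartiallyIntegrableCR T10
  contact : IsContactForm T10 θ
  reeb : IsReeb θ T
  theta_eq : ∀ q : M, ∃ c : ℝ, 0 < c ∧ ∀ (a : EuclideanSpace ℝ (Fin 1))
    (v : EuclideanSpace ℝ (Fin (2 * n + 1))),
    Θ q (mfderiv (collarModel n) (𝓡∂ (2 * n + 2)) Ψ (0, q) (a, v)) = c * θ q v
  ach : IsACHOnCollar T10 θ T (fun y v w =>
    g (Ψ y) (mfderiv (collarModel n) (𝓡∂ (2 * n + 2)) Ψ y v)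
      (mfderiv (collarModel n) (𝓡∂ (2 * n + 2)) Ψ y w))

theorem IsACHMetric.exists_isACHCollar [T2Space X] [SigmaCompactSpace X] {ι : M → X}
    (hι : IsBoundaryInclusion (n := n) ι)
    {Θ : ∀ q : M, TangentSpace (𝓡∂ (2 * n + 2)) (ι q) →L[ℝ] ℝ}
    {g : ∀ p : X, TangentSpace (𝓡∂ (2 * n + 2)) p →L[ℝ]
      TangentSpace (𝓡∂ (2 * n + 2)) p →L[ℝ] ℝ}
    {T10 : ∀ q : M, Submodule ℂ (ℂ ⊗[ℝ] TangentSpace (𝓡 (2 * n + 1)) q)}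
    (hg : IsACHMetric ι Θ g T10) :
    ∃ θ T Ψ V ρ, IsACHCollar ι Θ g T10 θ T Ψ V ρ := by
  obtain ⟨θ, T, Ψ, hθ, hT, hΨ, hΘ, hach⟩ := hg.collar
  have hc : IsCollar ι Ψ := ⟨hι.range_eq, fun q => (hΨ q).1, fun q => (hΨ q).2⟩
  obtain ⟨V, ρ, h⟩ := hc.exists_isCollarFunction
  exact ⟨θ, T, Ψ, V, ρ, h, hg.thetaMetric, hg.cr, hθ, hT, hΘ, hach⟩

/-- The powers of the defining function in the weighted frame. -/
def weight : FrameIndex n → ℕ := Sum.elim (fun _ => 1) (Sum.elim (fun _ => 2) (fun _ => 1))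

theorem sum_weight : ∑ i, weight (n := n) i = 2 * n + 3 := by
  simp [weight, Fintype.sum_sum_type]
  ring

/-- The frame `(∂_r, T, Y)` on the collar. -/
def collarFrame (T : ∀ q : M, TangentSpace (𝓡 (2 * n + 1)) q)
    (Y : Fin (2 * n) → ∀ q : M, TangentSpace (𝓡 (2 * n + 1)) q) (k : FrameIndex n) :
    ∀ y : EuclideanHalfSpace 1 × M, TangentSpace (collarModel n) y :=
  Sum.elim (fun _ => collarVF (EuclideanSpace.single 0 1) 0)
    (Sum.elim (fun _ => collarVF 0 T) (fun i => collarVF 0 (Y i))) k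

omit [IsManifold (𝓡 (2 * n + 1)) ∞ M] in
theorem linearIndependent_collarFrame {T : ∀ q : M, TangentSpace (𝓡 (2 * n + 1)) q}
    {Y : Fin (2 * n) → ∀ q : M, TangentSpace (𝓡 (2 * n + 1)) q} {y : EuclideanHalfSpace 1 × M}
    (h : LinearIndependent ℝ (Sum.elim (fun _ : Unit => T y.2) fun i => Y i y.2)) :
    LinearIndependent ℝ fun k => collarFrame T Y k y := by
  rw [Fintype.linearIndependent_iff] at h ⊢
  intro c hc
  have hc' : (∑ k, c k • (show EuclideanSpace ℝ (Fin 1) × EuclideanSpace ℝ (Fin (2 * n + 1)) from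
    collarFrame T Y k y)) = 0 := hc
  have h1 := congrArg (fun v => v.1 0) hc'
  have h2 := congrArg Prod.snd hc'
  simp only [Fintype.sum_sum_type, Finset.univ_unique, Finset.sum_singleton, collarFrame,
    collarVF, Sum.elim_inl, Sum.elim_inr, Prod.fst_add, Prod.snd_add, Prod.fst_sum, Prod.snd_sum] at h1 h2
  have h3 : c (Sum.inl ()) = 0 := by simpa using h1
  have h4 := h (fun k => c (Sum.inr k)) (by
    simp only [Fintype.sum_sum_type, Finset.univ_unique, Finset.sum_singleton, Sum.elim_inl,
      Sum.elim_inr]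
    have h5 : c (Sum.inl ()) • (0 : TangentSpace (𝓡 (2 * n + 1)) y.2) +
        (c (Sum.inr (Sum.inl ())) • T y.2 + ∑ i, c (Sum.inr (Sum.inr i)) • Y i y.2) = 0 := h2
    rwa [smul_zero, zero_add] at h5)
  rintro (⟨⟩ | k)
  · exact h3
  · exact h4 k

/-- The CR structure has adapted local frames. -/
theorem IsPartiallyIntegrableCR.exists_real_frame
    {T10 : ∀ q : M, Submodule ℂ (ℂ ⊗[ℝ] TangentSpace (𝓡 (2 * n + 1)) q)}
    (hcr : IsPartiallyIntegrableCR T10) {θ : ∀ q : M, TangentSpace (𝓡 (2 * n + 1)) q →L[ℝ] ℝ}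
    (hθ : IsContactForm T10 θ) {T : ∀ q : M, TangentSpace (𝓡 (2 * n + 1)) q} (hT : IsReeb θ T)
    (q₀ : M) :
    ∃ O : Set M, IsOpen O ∧ q₀ ∈ O ∧ ∃ Y : Fin (2 * n) → ∀ q : M, TangentSpace (𝓡 (2 * n + 1)) q,
      (∀ i, SmoothVF (𝓡 (2 * n + 1)) O (Y i)) ∧ (∀ q ∈ O, ∀ i, θ q (Y i q) = 0) ∧
      (∀ q ∈ O, LinearIndependent ℝ (Sum.elim (fun _ : Unit => T q) fun i => Y i q)) ∧
      ∀ i, ∃ A B, IsSection T10 O A B ∧ (Y i = A ∨ Y i = B) := by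
  obtain ⟨O, hO, hq₀, A, B, hs, hli⟩ := hcr.local_frame q₀
  -- The `2n` real fields are the real and imaginary parts of a local frame of `T^{1,0}`.
  let e : Fin (2 * n) ≃ Fin n ⊕ Fin n := (finCongr (by omega)).trans finSumFinEquiv.symm
  refine ⟨O, hO, hq₀, fun i => Sum.elim A B (e i), fun i => ?_, fun q hq i => ?_, fun q hq => ?_,
    fun i => ?_⟩
  · show SmoothVF _ O (Sum.elim A B (e i))
    rcases e i with α | α
    · exact (hs α).smooth_re
    · exact (hs α).smooth_im
  · show θ q (Sum.elim A B (e i) q) = 0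
    rcases e i with α | α
    · exact hθ.annihilates q _ _ ((hs α).mem q hq)
    · exact map_im_eq_zero (φ := (θ q).toLinearMap) (hθ.annihilates q) ((hs α).mem q hq)
  · have h1 := linearIndependent_re_im (φ := (θ q).toLinearMap) (hcr.inter_conj q)
      (hθ.annihilates q) (fun α => (hs α).mem q hq) (hli q hq).1 (hT.apply_self q)
    have h2 := h1.comp (Sum.map id e) (Function.injective_id.sumMap e.injective)
    convert h2 using 1
    funext k
    rcases k with ⟨⟩ | k
    · rfl
    · simp only [Sum.elim_inr, Function.comp_apply, Sum.map_inr]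
      rcases e k with α | α <;> rfl
  · rcases h : e i with α | α
    · exact ⟨A α, B α, hs α, Or.inl (by simp [h])⟩
    · exact ⟨A α, B α, hs α, Or.inr (by simp [h])⟩

end Frame

/-! ### The adapted frame pushed forward to `X` -/

section Frame

variable {n : ℕ} {X : Type*} [TopologicalSpace X]
  [ChartedSpace (EuclideanHalfSpace (2 * n + 2)) X]
  {M : Type*} [TopologicalSpace M]
  [ChartedSpace (EuclideanSpace ℝ (Fin (2 * n + 1))) M]
  {ι : M → X}
  {Ψ : PartialDiffeomorph (collarModel n) (𝓡∂ (2 * n + 2)) (EuclideanHalfSpace 1 × M) X ∞}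

theorem IsCollar.push_boundary (h : IsCollar ι Ψ)
    (C : ∀ y : EuclideanHalfSpace 1 × M, TangentSpace (collarModel n) y) (q : M) :
    push Ψ C (ι q) = (mfderiv (collarModel n) (𝓡∂ (2 * n + 2)) Ψ (0, q) (C (0, q)) :
      EuclideanSpace ℝ (Fin (2 * n + 2))) := by
  have h1 := h.symm_apply q
  rw [push, h1]

/-- The chain rule for `ι = Ψ ∘ (0, ·)`. It identifies the pushforwards of `T` and `Y` at the
boundary as tangent vectors of `M`. -/
theorem IsCollar.dι_apply (h : IsCollar ι Ψ) (q : M) (v : TangentSpace (𝓡 (2 * n + 1)) q) :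
    dι ι q v = (mfderiv (collarModel n) (𝓡∂ (2 * n + 2)) Ψ (0, q)
      ((0, v) : EuclideanSpace ℝ (Fin 1) × EuclideanSpace ℝ (Fin (2 * n + 1))) :
      EuclideanSpace ℝ (Fin (2 * n + 2))) := by
  have h1 : ι = Ψ ∘ fun q => ((0 : EuclideanHalfSpace 1), q) := funext fun q => (h.apply_zero q).symm
  have h2 := (Ψ.contMDiffOn.contMDiffAt (Ψ.open_source.mem_nhds (h.mem_source q))).mdifferentiableAt
    (by simp)
  have h3 : MDifferentiableAt (𝓡 (2 * n + 1)) (collarModel n)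
      (fun q : M => ((0 : EuclideanHalfSpace 1), q)) q :=
    mdifferentiableAt_const.prodMk mdifferentiableAt_id
  have h4 : ∀ ι' : M → X, ι' = Ψ ∘ (fun q => ((0 : EuclideanHalfSpace 1), q)) →
      (mfderiv (𝓡 (2 * n + 1)) (𝓡∂ (2 * n + 2)) ι' q v : EuclideanSpace ℝ (Fin (2 * n + 2))) =
      mfderiv (collarModel n) (𝓡∂ (2 * n + 2)) Ψ (0, q)
      ((0, v) : EuclideanSpace ℝ (Fin 1) × EuclideanSpace ℝ (Fin (2 * n + 1))) := by
    rintro _ rfl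
    rw [mfderiv_comp q h2 h3, mfderiv_prod_right]
    rfl
  exact h4 ι h1

/-- The pushforward of the frame `(∂_r, T, Y)`. -/
def pushFrame (Ψ : PartialDiffeomorph (collarModel n) (𝓡∂ (2 * n + 2)) (EuclideanHalfSpace 1 × M) X ∞)
    (T : ∀ q : M, TangentSpace (𝓡 (2 * n + 1)) q)
    (Y : Fin (2 * n) → ∀ q : M, TangentSpace (𝓡 (2 * n + 1)) q) (k : FrameIndex n) :
    ∀ p : X, TangentSpace (𝓡∂ (2 * n + 2)) p :=
  push Ψ (collarFrame T Y k)

theorem scaledFrame_eq (r : ℝ) (T : ∀ q : M, TangentSpace (𝓡 (2 * n + 1)) q)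
    (Y : Fin (2 * n) → ∀ q : M, TangentSpace (𝓡 (2 * n + 1)) q) (p : X) (k : FrameIndex n) :
    scaledFrame r (r ^ 2) r (pushFrame Ψ T Y (Sum.inl ())) (pushFrame Ψ T Y (Sum.inr (Sum.inl ())))
      (fun i => pushFrame Ψ T Y (Sum.inr (Sum.inr i))) p k =
    r ^ weight k • pushFrame Ψ T Y k p := by
  rcases k with ⟨⟩ | ⟨⟩ | k <;> simp [scaledFrame, weight]

theorem scaledFrame_one (T : ∀ q : M, TangentSpace (𝓡 (2 * n + 1)) q)
    (Y : Fin (2 * n) → ∀ q : M, TangentSpace (𝓡 (2 * n + 1)) q) (p : X) :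
    scaledFrame 1 1 1 (pushFrame Ψ T Y (Sum.inl ())) (pushFrame Ψ T Y (Sum.inr (Sum.inl ())))
      (fun i => pushFrame Ψ T Y (Sum.inr (Sum.inr i))) p = fun k => pushFrame Ψ T Y k p := by
  funext k
  have := scaledFrame_eq (Ψ := Ψ) 1 T Y p k
  simpa using this

theorem linearIndependent_pushFrame {T : ∀ q : M, TangentSpace (𝓡 (2 * n + 1)) q}
    {Y : Fin (2 * n) → ∀ q : M, TangentSpace (𝓡 (2 * n + 1)) q} {p : X} (hp : p ∈ Ψ.target)
    (h : LinearIndependent ℝ (Sum.elim (fun _ : Unit => T (Ψ.symm p).2) fun i => Y i (Ψ.symm p).2)) :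
    LinearIndependent ℝ fun k => pushFrame Ψ T Y k p := by
  have h1 := linearIndependent_collarFrame h
  have h2 := h1.map' (mfderiv (collarModel n) (𝓡∂ (2 * n + 2)) Ψ (Ψ.symm p)).toLinearMap
    (LinearMap.ker_eq_bot.2 (injective_mfderiv_collar (Ψ.map_target hp)))
  exact h2

theorem contMDiffOn_collarFrame [IsManifold (𝓡 (2 * n + 1)) ∞ M]
    {T : ∀ q : M, TangentSpace (𝓡 (2 * n + 1)) q}
    {Y : Fin (2 * n) → ∀ q : M, TangentSpace (𝓡 (2 * n + 1)) q} {O : Set M}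
    (hT : SmoothVF (𝓡 (2 * n + 1)) O T) (hY : ∀ i, SmoothVF (𝓡 (2 * n + 1)) O (Y i))
    (k : FrameIndex n) :
    ContMDiffOn (collarModel n) (collarModel n).tangent ∞
      (fun y => (⟨y, collarFrame T Y k y⟩ :
        TangentBundle (collarModel n) (EuclideanHalfSpace 1 × M))) {y | y.2 ∈ O} := by
  rcases k with ⟨⟩ | ⟨⟩ | k
  · refine contMDiffOn_collarVF _ ?_
    exact (contMDiff_zeroSection ℝ (TangentSpace (𝓡 (2 * n + 1)))).contMDiffOn
  · exact contMDiffOn_collarVF _ hT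
  · exact contMDiffOn_collarVF _ (hY k)

theorem weight_smul_collarFrame (T : ∀ q : M, TangentSpace (𝓡 (2 * n + 1)) q)
    (Y : Fin (2 * n) → ∀ q : M, TangentSpace (𝓡 (2 * n + 1)) q) (k : FrameIndex n)
    (y : EuclideanHalfSpace 1 × M) :
    rad y ^ weight k • collarFrame T Y k y =
      Sum.elim (fun _ => Zinf y) (Sum.elim (fun _ => radPow 2 T y) (fun i => radPow 1 (Y i) y)) k := by
  rcases k with ⟨⟩ | ⟨⟩ | k
  · refine Prod.ext ?_ ?_
    · show rad y ^ 1 • EuclideanSpace.single (0 : Fin 1) (1 : ℝ) = rad y • EuclideanSpace.single 0 1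
      rw [pow_one]
    · show rad y ^ 1 • (0 : EuclideanSpace ℝ (Fin (2 * n + 1))) = 0
      rw [smul_zero]
  · refine Prod.ext ?_ ?_
    · show rad y ^ 2 • (0 : EuclideanSpace ℝ (Fin 1)) = 0
      simp
    · rfl
  · refine Prod.ext ?_ ?_
    · show rad y ^ 1 • (0 : EuclideanSpace ℝ (Fin 1)) = 0
      simp
    · rfl

end Frame

/-! ### Boundary values of the Gram matrix -/

section BoundaryFrame

variable {n : ℕ} {X : Type*} [TopologicalSpace X]
  [ChartedSpace (EuclideanHalfSpace (2 * n + 2)) X] [IsManifold (𝓡∂ (2 * n + 2)) ∞ X]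
  {M : Type*} [TopologicalSpace M]
  [ChartedSpace (EuclideanSpace ℝ (Fin (2 * n + 1))) M] [IsManifold (𝓡 (2 * n + 1)) ∞ M]
  {ι : M → X} {Θ : ∀ q : M, TangentSpace (𝓡∂ (2 * n + 2)) (ι q) →L[ℝ] ℝ}
  {g : ∀ p : X, TangentSpace (𝓡∂ (2 * n + 2)) p →L[ℝ] TangentSpace (𝓡∂ (2 * n + 2)) p →L[ℝ] ℝ}
  {T10 : ∀ q : M, Submodule ℂ (ℂ ⊗[ℝ] TangentSpace (𝓡 (2 * n + 1)) q)}
  {θ : ∀ q : M, TangentSpace (𝓡 (2 * n + 1)) q →L[ℝ] ℝ}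
  {T : ∀ q : M, TangentSpace (𝓡 (2 * n + 1)) q}
  {Ψ : PartialDiffeomorph (collarModel n) (𝓡∂ (2 * n + 2)) (EuclideanHalfSpace 1 × M) X ∞}
  {V : Set X} {ρ : X → ℝ}

-- Since `dΨ` is injective, the expansion already holds on the collar. Applying `θ` to its
-- `M`-component kills `∂_r` and the `Y i` and sends `T` to `1`.
omit [IsManifold (𝓡∂ (2 * n + 2)) ∞ X] [IsManifold (𝓡 (2 * n + 1)) ∞ M] in
theorem IsCollar.coeff_eq (h : IsCollar ι Ψ) {q : M}
    {Y : Fin (2 * n) → ∀ q : M, TangentSpace (𝓡 (2 * n + 1)) q} (hT : θ q (T q) = 1)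
    (hY : ∀ i, θ q (Y i q) = 0) {v : TangentSpace (𝓡 (2 * n + 1)) q} {c : FrameIndex n → ℝ}
    (hc : dι ι q v = ∑ k, c k • pushFrame Ψ T Y k (ι q)) : c (Sum.inr (Sum.inl ())) = θ q v := by
  have h1 : mfderiv (collarModel n) (𝓡∂ (2 * n + 2)) Ψ (0, q)
      ((0, v) : EuclideanSpace ℝ (Fin 1) × EuclideanSpace ℝ (Fin (2 * n + 1))) =
      mfderiv (collarModel n) (𝓡∂ (2 * n + 2)) Ψ (0, q)
        (∑ k, c k • collarFrame T Y k ((0 : EuclideanHalfSpace 1), q)) := by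
    rw [map_sum]
    simp only [map_smul]
    refine (h.dι_apply q v).symm.trans (hc.trans ?_)
    refine Finset.sum_congr rfl fun k _ => ?_
    exact congrArg (c k • ·) (h.push_boundary _ q)
  have h2 := injective_mfderiv_collar (h.mem_source q) h1
  let L : TangentSpace (collarModel n) ((0 : EuclideanHalfSpace 1), q) →ₗ[ℝ] ℝ :=
    (θ q).toLinearMap.comp (LinearMap.snd ℝ (EuclideanSpace ℝ (Fin 1))
      (EuclideanSpace ℝ (Fin (2 * n + 1))))
  have h3 := congrArg L h2
  rw [map_sum] at h3
  simp only [map_smul, Fintype.sum_sum_type, Finset.univ_unique, Finset.sum_singleton] at h3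
  have hLN : L (collarFrame T Y (Sum.inl ()) ((0 : EuclideanHalfSpace 1), q)) = 0 := map_zero (θ q)
  have hLT : L (collarFrame T Y (Sum.inr (Sum.inl ())) ((0 : EuclideanHalfSpace 1), q)) = 1 := hT
  have hLY : ∀ i, L (collarFrame T Y (Sum.inr (Sum.inr i)) ((0 : EuclideanHalfSpace 1), q)) = 0 := hY
  have hLv : L ((0, v) : EuclideanSpace ℝ (Fin 1) × EuclideanSpace ℝ (Fin (2 * n + 1))) = θ q v := rfl
  rw [← hLv, h3]
  simp [hLN, hLT, hLY]

namespace IsACHCollar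

variable (h : IsACHCollar ι Θ g T10 θ T Ψ V ρ)
include h

/-- The boundary values of the mixed components in the direction of `r ∂_r`. -/
theorem tendsto_inf_real {O : Set M} (hO : IsOpen O) {A B Y : ∀ q : M, TangentSpace (𝓡 (2 * n + 1)) q}
    (hs : IsSection T10 O A B) (hY : Y = A ∨ Y = B) {q : M} (hq : q ∈ O) :
    Tendsto (fun y => g (Ψ y) (mfderiv (collarModel n) (𝓡∂ (2 * n + 2)) Ψ y (Zinf y))
      (mfderiv (collarModel n) (𝓡∂ (2 * n + 2)) Ψ y (radPow 1 Y y)))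
      (𝓝[{y | 0 < rad y}] (0, q)) (𝓝 0) := by
  have h1 := h.ach.inf_alpha O hO A B hs q hq
  rcases hY with rfl | rfl
  · have h2 := (Complex.continuous_re.tendsto _).comp h1
    simpa [Function.comp_def, bilC] using h2
  · have h2 := (Complex.continuous_im.tendsto _).comp h1
    simpa [Function.comp_def, bilC] using h2

/-- This is where the ACH condition becomes usable data. The Laplacian needs the `r ∂_r` row of the
Gram matrix on `M`; the normalization needs the `T`-`T` entry and the `T`-coefficient of vectors
tangent to `M`. -/
theorem exists_isWeightedFrame (q₀ : M) :
    ∃ (U : Set X) (F : FrameIndex n → ∀ p : X, TangentSpace (𝓡∂ (2 * n + 2)) p)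
      (G : X → Matrix (FrameIndex n) (FrameIndex n) ℝ), ι q₀ ∈ U ∧
      IsWeightedFrame (I := 𝓡∂ (2 * n + 2)) g U (U ∩ (𝓡∂ (2 * n + 2)).interior X) F ρ weight
        (Sum.inl ()) G ∧
      ∀ q, ι q ∈ U →
        (∀ j, G (ι q) (Sum.inl ()) j = if Sum.inl () = j then 4 else 0) ∧
        G (ι q) (Sum.inr (Sum.inl ())) (Sum.inr (Sum.inl ())) = 1 ∧
        F (Sum.inr (Sum.inl ())) (ι q) = dι ι q (T q) ∧
        ∀ (v : TangentSpace (𝓡 (2 * n + 1)) q) (c : FrameIndex n → ℝ),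
          dι ι q v = ∑ k, c k • F k (ι q) → c (Sum.inr (Sum.inl ())) = θ q v := by
  obtain ⟨O, hO, hq₀, Y, hYs, hYθ, hli, hYs'⟩ := h.cr.exists_real_frame h.contact h.reeb q₀
  have hTO : SmoothVF (𝓡 (2 * n + 1)) O T := h.reeb.smooth.mono (Set.subset_univ _)
  set F := pushFrame Ψ T Y with hF
  set U : Set X := V ∩ {p | (Ψ.symm p).2 ∈ O} with hU
  have hUt : U ⊆ Ψ.target := fun p hp => h.subset_target hp.1
  have hUo : IsOpen U := by
    have h1 : IsOpen (Ψ.target ∩ Ψ.symm ⁻¹' {y | y.2 ∈ O}) :=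
      Ψ.contMDiffOn_invFun.continuousOn.isOpen_inter_preimage Ψ.open_target
        (hO.preimage continuous_snd)
    have h2 : U = V ∩ (Ψ.target ∩ Ψ.symm ⁻¹' {y | y.2 ∈ O}) :=
      Set.ext fun p => ⟨fun hp => ⟨hp.1, hUt hp, hp.2⟩, fun hp => ⟨hp.1, hp.2.2⟩⟩
    rw [h2]
    exact h.isOpen.inter h1
  have hιU : ∀ q, ι q ∈ U ↔ q ∈ O := by
    intro q
    have h1 := h.symm_apply q
    refine ⟨fun hq => ?_, fun hq => ⟨h.mem q, ?_⟩⟩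
    · have h2 := hq.2
      rwa [Set.mem_ofPred_eq, h1] at h2
    · rwa [Set.mem_ofPred_eq, h1]
  have hFs : ∀ k, SmoothVF (𝓡∂ (2 * n + 2)) U (F k) := fun k =>
    (smoothVF_push (contMDiffOn_collarFrame hTO hYs k)).mono fun p hp => ⟨hUt hp, hp.2⟩
  have hFli : ∀ p ∈ U, LinearIndependent ℝ fun k => F k p := fun p hp =>
    linearIndependent_pushFrame (hUt hp) (hli _ hp.2)
  have hFT : ∀ q, F (Sum.inr (Sum.inl ())) (ι q) = dι ι q (T q) := fun q =>
    (h.push_boundary _ q).trans (h.dι_apply q (T q)).symm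
  have hFY : ∀ q i, F (Sum.inr (Sum.inr i)) (ι q) = dι ι q (Y i q) := fun q i =>
    (h.push_boundary _ q).trans (h.dι_apply q (Y i q)).symm
  -- On `M` the form `Θ` is a positive multiple of `θ` of the `M`-component, so it kills `∂_r` as
  -- well as the `Y i`.
  have hFΘ : ∀ q (a : EuclideanSpace ℝ (Fin 1)) (v : TangentSpace (𝓡 (2 * n + 1)) q), θ q v = 0 →
      ∀ w : TangentSpace (𝓡∂ (2 * n + 2)) (ι q),
      w = (mfderiv (collarModel n) (𝓡∂ (2 * n + 2)) Ψ (0, q)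
      ((a, v) : EuclideanSpace ℝ (Fin 1) × EuclideanSpace ℝ (Fin (2 * n + 1))) :
      EuclideanSpace ℝ (Fin (2 * n + 2))) → Θ q w = 0 := by
    rintro q a v hv w rfl
    obtain ⟨c, -, hc⟩ := h.theta_eq q
    refine (hc a v).trans ?_
    rw [hv, mul_zero]
  have hadapted : IsAdaptedFrame ι Θ U (F (Sum.inl ())) (F (Sum.inr (Sum.inl ())))
      (fun i => F (Sum.inr (Sum.inr i))) :=
    { smooth_N := hFs _
      smooth_T := hFs _
      smooth_Y := fun i => hFs _
      linearIndependent := fun p hp => by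
        rw [scaledFrame_one]
        exact hFli p hp
      N_theta := fun q hq => hFΘ q _ 0 (map_zero _) _ (h.push_boundary _ q)
      T_tangent := fun q hq => ⟨T q, (hFT q).symm⟩
      Y_tangent := fun q hq i => ⟨Y i q, (hFY q i).symm⟩
      Y_theta := fun q hq i => hFΘ q _ (Y i q) (hYθ q ((hιU q).1 hq) i) _ (h.push_boundary _ q) }
  obtain ⟨G, hGs, hGpos, hGeq⟩ :=
    h.metric.extends_to_boundary ρ h.isDefiningFunction U hUo _ _ _ hadapted
  simp only [hF, scaledFrame_eq] at hGeq
  have hframe : IsLocalFrameOn (𝓡∂ (2 * n + 2)) (EuclideanSpace ℝ (Fin (2 * n + 2))) ∞ F U :=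
    { linearIndependent := fun hp => hFli _ hp
      generating := fun {p} hp => by
        have : FiniteDimensional ℝ (TangentSpace (𝓡∂ (2 * n + 2)) p) :=
          inferInstanceAs (FiniteDimensional ℝ (EuclideanSpace ℝ (Fin (2 * n + 2))))
        refine ((hFli p hp).span_eq_top_of_card_eq_finrank' ?_).ge
        have h1 : Module.finrank ℝ (TangentSpace (𝓡∂ (2 * n + 2)) p) = 2 * n + 2 :=
          finrank_euclideanSpace_fin
        rw [h1]
        simp only [FrameIndex, Fintype.card_sum, Fintype.card_unit, Fintype.card_fin]
        omega
      contMDiffOn := hFs }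
  have hw : IsWeightedFrame (I := 𝓡∂ (2 * n + 2)) g U (U ∩ (𝓡∂ (2 * n + 2)).interior X) F ρ weight
        (Sum.inl ()) G :=
    { isOpen := hUo
      isOpen' := hUo.inter (isOpen_interior n X)
      subset := Set.inter_subset_left
      metric := h.metric.interior.mono Set.inter_subset_right
      frame := hframe
      smooth := h.smooth.contMDiffOn
      pos := fun p hp => h.pos p hp.2
      dual := fun p hp k => by
        obtain ⟨y, hy, rfl⟩ : ∃ y ∈ Ψ.source, Ψ y = p :=
          ⟨Ψ.symm p, Ψ.map_target (hUt hp), Ψ.right_inv (hUt hp)⟩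
        have h1 := h.mvfderiv_apply hy hp.1 (collarFrame T Y k y)
        rw [hF, pushFrame, push_apply _ hy, h1]
        rcases k with ⟨⟩ | ⟨⟩ | k <;> simp [collarFrame, collarVF]
      weight_self := rfl
      weight_pos := by rintro (⟨⟩ | ⟨⟩ | k) <;> simp [weight]
      smooth_gram := hGs
      posDef := hGpos
      gram_eq := fun p hp i j => hGeq p hp.1 hp.2 i j }
  refine ⟨U, F, G, (hιU q₀).2 hq₀, hw, fun q hq => ?_⟩
  have := neBot_nhdsWithin_rad q
  -- For `r > 0` the smooth matrix entry is the metric component. Its value on `M` is therefore the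
  -- limit prescribed by the ACH condition.
  have hG : ∀ i j (a : ℝ), Tendsto (fun y => g (Ψ y)
      (mfderiv (collarModel n) (𝓡∂ (2 * n + 2)) Ψ y (rad y ^ weight i • collarFrame T Y i y))
      (mfderiv (collarModel n) (𝓡∂ (2 * n + 2)) Ψ y (rad y ^ weight j • collarFrame T Y j y)))
      (𝓝[{y | 0 < rad y}] (0, q)) (𝓝 a) → G (ι q) i j = a := by
    intro i j a ha
    have h1 : Tendsto (fun y => G (Ψ y) i j) (𝓝[{y | 0 < rad y}] ((0 : EuclideanHalfSpace 1), q))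
        (𝓝 (G (ι q) i j)) :=
      ((hGs i j).continuousOn.continuousAt (hUo.mem_nhds hq)).tendsto.comp
        ((h.tendsto_nhdsWithin q).mono_right nhdsWithin_le_nhds)
    refine tendsto_nhds_unique (h1.congr' ?_) ha
    have h2 : ∀ᶠ y in 𝓝[{y | 0 < rad y}] ((0 : EuclideanHalfSpace 1), q), Ψ y ∈ U :=
      ((h.tendsto_nhdsWithin q).mono_right nhdsWithin_le_nhds).eventually (hUo.mem_nhds hq)
    filter_upwards [self_mem_nhdsWithin, h2,
      mem_nhdsWithin_of_mem_nhds (Ψ.open_source.mem_nhds (h.mem_source q))] with y hy hyU hys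
    have h3 : Ψ.symm (Ψ y) = y := Ψ.left_inv hys
    rw [hGeq _ hyU ((h.isInteriorPoint_apply_iff hys).2 hy), h.eq_rad _ hyU.1, h3, pushFrame,
      pushFrame, push_apply _ hys, push_apply _ hys]
    simp only [map_smul, smul_apply]
  have hN : ∀ y, rad y ^ weight (n := n) (Sum.inl ()) • collarFrame T Y (Sum.inl ()) y = Zinf y :=
    weight_smul_collarFrame T Y (Sum.inl ())
  have hT : ∀ y, rad y ^ weight (n := n) (Sum.inr (Sum.inl ())) •
      collarFrame T Y (Sum.inr (Sum.inl ())) y = radPow 2 T y :=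
    weight_smul_collarFrame T Y (Sum.inr (Sum.inl ()))
  have hY : ∀ i y, rad y ^ weight (n := n) (Sum.inr (Sum.inr i)) •
      collarFrame T Y (Sum.inr (Sum.inr i)) y = radPow 1 (Y i) y := fun i =>
    weight_smul_collarFrame T Y (Sum.inr (Sum.inr i))
  refine ⟨fun j => ?_, ?_, hFT q, fun v c hc =>
    h.coeff_eq (h.reeb.apply_self q) (hYθ q ((hιU q).1 hq)) hc⟩
  · rcases j with ⟨⟩ | ⟨⟩ | j
    · rw [if_pos rfl]
      refine hG _ _ _ ?_
      simp only [hN]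
      exact h.ach.inf_inf q
    · rw [if_neg (by simp)]
      refine hG _ _ _ ?_
      simp only [hN, hT]
      exact h.ach.inf_zero q
    · obtain ⟨A, B, hs, hAB⟩ := hYs' j
      rw [if_neg (by simp)]
      refine hG _ _ _ ?_
      simp only [hN, hY]
      exact h.tendsto_inf_real hO hs hAB ((hιU q).1 hq)
  · refine hG _ _ _ ?_
    simp only [hT]
    exact h.ach.zero_zero q

end IsACHCollar

end BoundaryFrame

/-! ### The indicial behaviour of the Laplacian on `X` -/

section Global

variable {n : ℕ} {X : Type*} [TopologicalSpace X]
  [ChartedSpace (EuclideanHalfSpace (2 * n + 2)) X] [IsManifold (𝓡∂ (2 * n + 2)) ∞ X]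
  {M : Type*} [TopologicalSpace M]
  [ChartedSpace (EuclideanSpace ℝ (Fin (2 * n + 1))) M]
  {ι : M → X}
  {Ψ : PartialDiffeomorph (collarModel n) (𝓡∂ (2 * n + 2)) (EuclideanHalfSpace 1 × M) X ∞}
  {V : Set X} {ρ : X → ℝ}

/-- The quotient `φ / ρ ^ k` is determined in the interior, so the local factors agree with it there
and glue. Their boundary values pass to the global factor by density. -/
theorem IsCollarFunction.exists_eq_pow_mul (h : IsCollarFunction ι Ψ V ρ) (k : ℕ) {φ : X → ℝ}
    (hφ : ContMDiffOn (𝓡∂ (2 * n + 2)) 𝓘(ℝ, ℝ) ∞ φ ((𝓡∂ (2 * n + 2)).interior X)) {b : M → ℝ}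
    (hloc : ∀ q, ∃ U : Set X, IsOpen U ∧ ι q ∈ U ∧ ∃ f : X → ℝ,
      ContMDiffOn (𝓡∂ (2 * n + 2)) 𝓘(ℝ, ℝ) ∞ f U ∧
      (∀ p ∈ U ∩ (𝓡∂ (2 * n + 2)).interior X, φ p = ρ p ^ k * f p) ∧ f (ι q) = b q) :
    ∃ f : X → ℝ, ContMDiff (𝓡∂ (2 * n + 2)) 𝓘(ℝ, ℝ) ∞ f ∧
      (∀ p ∈ (𝓡∂ (2 * n + 2)).interior X, φ p = ρ p ^ k * f p) ∧ ∀ q, f (ι q) = b q := by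
  have hk : ∀ p ∈ (𝓡∂ (2 * n + 2)).interior X, ρ p ^ k ≠ 0 := fun p hp => (pow_pos (h.pos p hp) k).ne'
  have heq : ∀ U : Set X, ∀ f : X → ℝ,
      (∀ p ∈ U ∩ (𝓡∂ (2 * n + 2)).interior X, φ p = ρ p ^ k * f p) →
      Set.EqOn (fun p => φ p / ρ p ^ k) f (U ∩ (𝓡∂ (2 * n + 2)).interior X) := by
    intro U f hf p hp
    simp only [hf p hp]
    exact mul_div_cancel_left₀ _ (hk p hp.2)
  obtain ⟨F, hF, hFeq⟩ := h.exists_extension (f := fun p => φ p / ρ p ^ k)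
    (fun p hp => (hφ p hp).div₀ ((h.smooth p).pow k).contMDiffWithinAt (hk p hp)) fun q => by
      obtain ⟨U, hU, hq, f, hf, hfφ, -⟩ := hloc q
      exact ⟨U, hU, hq, f, hf, heq U f hfφ⟩
  refine ⟨F, hF, fun p hp => ?_, fun q => ?_⟩
  · rw [← hFeq hp]
    exact (mul_div_cancel₀ _ (hk p hp)).symm
  · obtain ⟨U, hU, hq, f, hf, hfφ, hb⟩ := hloc q
    rw [← hb]
    refine h.eqOn_of_eqOn_interior hU hF.continuous.continuousOn hf.continuousOn (fun p hp => ?_) hq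
    rw [← hFeq hp.2, heq U f hfφ hp]

variable [IsManifold (𝓡 (2 * n + 1)) ∞ M]
  {Θ : ∀ q : M, TangentSpace (𝓡∂ (2 * n + 2)) (ι q) →L[ℝ] ℝ}
  {g : ∀ p : X, TangentSpace (𝓡∂ (2 * n + 2)) p →L[ℝ] TangentSpace (𝓡∂ (2 * n + 2)) p →L[ℝ] ℝ}
  {T10 : ∀ q : M, Submodule ℂ (ℂ ⊗[ℝ] TangentSpace (𝓡 (2 * n + 1)) q)}
  {θ : ∀ q : M, TangentSpace (𝓡 (2 * n + 1)) q →L[ℝ] ℝ}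
  {T : ∀ q : M, TangentSpace (𝓡 (2 * n + 1)) q}

namespace IsACHCollar

variable (h : IsACHCollar ι Θ g T10 θ T Ψ V ρ)
include h

theorem contMDiffOn_log :
    ContMDiffOn (𝓡∂ (2 * n + 2)) 𝓘(ℝ, ℝ) ∞ (fun p => Real.log (ρ p))
      ((𝓡∂ (2 * n + 2)).interior X) := fun p hp =>
  ((Real.contDiffAt_log.2 (h.pos p hp).ne').contMDiffAt.comp p (h.smooth p)).contMDiffWithinAt

/-- The Laplacian of the logarithm of the defining function. -/
theorem exists_laplacian_log :
    ∃ f : X → ℝ, ContMDiff (𝓡∂ (2 * n + 2)) 𝓘(ℝ, ℝ) ∞ f ∧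
      (∀ p ∈ (𝓡∂ (2 * n + 2)).interior X,
        laplacian (𝓡∂ (2 * n + 2)) g (fun p => Real.log (ρ p)) p = f p) ∧
      ∀ q, f (ι q) = (n + 1) / 2 := by
  have hint := isOpen_interior n X
  obtain ⟨f, hf, hfeq, hfb⟩ := h.exists_eq_pow_mul 0
    (h.metric.interior.contMDiffOn_laplacian hint h.contMDiffOn_log)
    (b := fun _ => ((n : ℝ) + 1) / 2) fun q => by
      obtain ⟨U, F, G, hqU, hw, hb⟩ := h.exists_isWeightedFrame q
      obtain ⟨f, hf, hfeq, hfb⟩ := hw.exists_laplacian_eq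
        (h.contMDiffOn_log.mono Set.inter_subset_right) 0
        -- `log ρ` has derivative `1` along `ρ ∂_ρ` and `0` along the rest of the frame, so `m = 0`
        -- and the boundary value is `(2n+2)/4`.
        (ψ := fun k _ => if k = Sum.inl () then 1 else 0) (fun k => contMDiffOn_const)
        fun p hp k => by
          have hρ := h.pos p hp.2
          rw [mvfderiv_comp_real (h.smooth.mdifferentiableAt (by simp))
            (Real.hasDerivAt_log hρ.ne'), hw.dual p hp.1 k]
          split_ifs with hk
          · subst hk
            simp [weight, hρ.ne']
          · simp
      refine ⟨U, hw.isOpen, hqU, f, hf, hfeq, ?_⟩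
      rw [hfb _ hqU (h.apply_boundary q) (hb q hqU).1, sum_weight, if_pos rfl]
      push_cast
      ring
  exact ⟨f, hf, fun p hp => by rw [hfeq p hp, pow_zero, one_mul], hfb⟩

/-- The indicial behaviour of the Laplacian. -/
theorem exists_laplacian_pow_mul (k : ℕ) {u : X → ℝ}
    (hu : ContMDiff (𝓡∂ (2 * n + 2)) 𝓘(ℝ, ℝ) ∞ u) :
    ∃ f : X → ℝ, ContMDiff (𝓡∂ (2 * n + 2)) 𝓘(ℝ, ℝ) ∞ f ∧
      (∀ p ∈ (𝓡∂ (2 * n + 2)).interior X,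
        laplacian (𝓡∂ (2 * n + 2)) g (fun p => ρ p ^ k * u p) p = ρ p ^ k * f p) ∧
      ∀ q, f (ι q) = -(k * (k - (2 * n + 2))) / 4 * u (ι q) := by
  have hint := isOpen_interior n X
  have hs : ContMDiff (𝓡∂ (2 * n + 2)) 𝓘(ℝ, ℝ) ∞ (fun p => ρ p ^ k * u p) := (h.smooth.pow k).mul hu
  refine h.exists_eq_pow_mul k (h.metric.interior.contMDiffOn_laplacian hint hs.contMDiffOn)
    fun q => ?_
  obtain ⟨U, F, G, hqU, hw, hb⟩ := h.exists_isWeightedFrame q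
  obtain ⟨f, hf, hfeq, hfb⟩ := hw.exists_laplacian_eq hs.contMDiffOn k
    -- Differentiating `ρ ^ k` gives `k u` in the direction of `ρ ∂_ρ`, the only part of `ψ` that
    -- survives on `M`.
    (ψ := fun l p => (if l = Sum.inl () then (k : ℝ) else 0) * u p +
      ρ p ^ weight l * mvfderiv (𝓡∂ (2 * n + 2)) u p (F l p))
    (fun l => (contMDiffOn_const.mul hu.contMDiffOn).add ((h.smooth.pow _).contMDiffOn.mul
      (SmoothVF.contMDiffOn_mvfderiv hw.isOpen (hw.frame.contMDiffOn l) hu.contMDiffOn)))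
    fun p hp l => by
      have h1 : mvfderiv (𝓡∂ (2 * n + 2)) (fun p => ρ p ^ k * u p) p (F l p) =
          ρ p ^ k * mvfderiv (𝓡∂ (2 * n + 2)) u p (F l p) +
          (k * ρ p ^ (k - 1) * if l = Sum.inl () then 1 else 0) * u p := by
        have hρd := h.smooth.mdifferentiableAt (x := p) (by simp)
        rw [mvfderiv_fun_mul ((h.smooth.pow k).mdifferentiableAt (by simp))
          (hu.mdifferentiableAt (by simp)), add_apply, smul_apply, smul_apply, smul_eq_mul,
          smul_eq_mul]
        have h2 := mvfderiv_pow_apply hρd k (F l p)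
        rw [hw.dual p hp.1 l] at h2
        rw [h2]
        ring
      rw [h1]
      split_ifs with hl
      · subst hl
        rcases k with _ | k
        · simp
        · simp only [weight, Sum.elim_inl, Nat.add_sub_cancel]
          ring
      · ring
  refine ⟨U, hw.isOpen, hqU, f, hf, hfeq, ?_⟩
  rw [hfb _ hqU (h.apply_boundary q) (hb q hqU).1, sum_weight, if_pos rfl, h.apply_boundary]
  simp only [weight, Sum.elim_inl]
  push_cast
  ring

end IsACHCollar

end Global

/-! ### Normalization by a contact form as a boundary condition -/

section Normalization

theorem SmoothOneForm.contMDiff_apply {d : ℕ} {H : Type*} [TopologicalSpace H]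
    {I : ModelWithCorners ℝ (EuclideanSpace ℝ (Fin d)) H}
    {N : Type*} [TopologicalSpace N] [ChartedSpace H N] [IsManifold I ∞ N]
    {θ : ∀ p : N, TangentSpace I p →L[ℝ] ℝ} (hθ : SmoothOneForm I θ)
    {V : ∀ p : N, TangentSpace I p} (hV : SmoothVF I Set.univ V) :
    ContMDiff I 𝓘(ℝ, ℝ) ∞ (fun p => θ p (V p)) := by
  intro p
  have : ContMDiffAt I (I.prod 𝓘(ℝ)) ∞
      (fun m ↦ TotalSpace.mk' ℝ (E := Bundle.Trivial N ℝ) m (θ m (V m))) p := by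
    apply ContMDiffAt.clm_bundle_apply (F₁ := EuclideanSpace ℝ (Fin d))
    · exact hθ p
    · exact (contMDiffOn_univ.1 hV) p
  simp only [contMDiffAt_totalSpace] at this
  exact this.2

variable {n : ℕ} {X : Type*} [TopologicalSpace X]
  [ChartedSpace (EuclideanHalfSpace (2 * n + 2)) X] [IsManifold (𝓡∂ (2 * n + 2)) ∞ X]
  {M : Type*} [TopologicalSpace M]
  [ChartedSpace (EuclideanSpace ℝ (Fin (2 * n + 1))) M] [IsManifold (𝓡 (2 * n + 1)) ∞ M]
  {ι : M → X} {Θ : ∀ q : M, TangentSpace (𝓡∂ (2 * n + 2)) (ι q) →L[ℝ] ℝ}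
  {g : ∀ p : X, TangentSpace (𝓡∂ (2 * n + 2)) p →L[ℝ] TangentSpace (𝓡∂ (2 * n + 2)) p →L[ℝ] ℝ}
  {T10 : ∀ q : M, Submodule ℂ (ℂ ⊗[ℝ] TangentSpace (𝓡 (2 * n + 1)) q)}
  {θ : ∀ q : M, TangentSpace (𝓡 (2 * n + 1)) q →L[ℝ] ℝ}
  {T : ∀ q : M, TangentSpace (𝓡 (2 * n + 1)) q}
  {Ψ : PartialDiffeomorph (collarModel n) (𝓡∂ (2 * n + 2)) (EuclideanHalfSpace 1 × M) X ∞}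
  {V : Set X} {ρ : X → ℝ}

omit [IsManifold (𝓡∂ (2 * n + 2)) ∞ X] in
/-- Contact forms are multiples of each other. -/
theorem IsContactForm.apply_eq_mul (hcr : IsPartiallyIntegrableCR T10) (hθ : IsContactForm T10 θ)
    (hT : IsReeb θ T) {θ' : ∀ q : M, TangentSpace (𝓡 (2 * n + 1)) q →L[ℝ] ℝ}
    (hθ' : IsContactForm T10 θ') (q : M) (v : TangentSpace (𝓡 (2 * n + 1)) q) :
    θ' q v = θ' q (T q) * θ q v := by
  obtain ⟨O, hO, hq, Y, hYs, hYθ, hli, hYs'⟩ := hcr.exists_real_frame hθ hT q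
  have hYθ' : ∀ i, θ' q (Y i q) = 0 := by
    intro i
    obtain ⟨A, B, hs, rfl | rfl⟩ := hYs' i
    · exact hθ'.annihilates q _ _ (hs.mem q hq)
    · exact map_im_eq_zero (φ := (θ' q).toLinearMap) (hθ'.annihilates q) (hs.mem q hq)
  have : FiniteDimensional ℝ (TangentSpace (𝓡 (2 * n + 1)) q) :=
    inferInstanceAs (FiniteDimensional ℝ (EuclideanSpace ℝ (Fin (2 * n + 1))))
  have hspan := (hli q hq).span_eq_top_of_card_eq_finrank' (by
    have h1 : Module.finrank ℝ (TangentSpace (𝓡 (2 * n + 1)) q) = 2 * n + 1 :=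
      finrank_euclideanSpace_fin
    rw [h1]
    simp only [Fintype.card_sum, Fintype.card_unit, Fintype.card_fin]
    omega)
  have hv : v ∈ Submodule.span ℝ (Set.range (Sum.elim (fun _ : Unit => T q) fun i => Y i q)) := by
    rw [hspan]
    trivial
  obtain ⟨c, rfl⟩ := (Submodule.mem_span_range_iff_exists_fun ℝ).1 hv
  simp [Fintype.sum_sum_type, hYθ', hYθ q hq, hT.apply_self q, mul_comm]

theorem IsContactForm.apply_reeb_ne_zero (hcr : IsPartiallyIntegrableCR T10)
    (hθ : IsContactForm T10 θ) (hT : IsReeb θ T)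
    {θ' : ∀ q : M, TangentSpace (𝓡 (2 * n + 1)) q →L[ℝ] ℝ}
    (hθ' : IsContactForm T10 θ') (q : M) : θ' q (T q) ≠ 0 := by
  intro h0
  refine hθ'.ne_zero q (ContinuousLinearMap.ext fun v => ?_)
  rw [hθ.apply_eq_mul hcr hT hθ' q v, h0, zero_mul]
  rfl

namespace IsCollarFunction

variable (h : IsCollarFunction ι Ψ V ρ)
include h

omit [IsManifold (𝓡∂ (2 * n + 2)) ∞ X] [IsManifold (𝓡 (2 * n + 1)) ∞ M] in
theorem mvfderiv_mul {k : X → ℝ} (hk : ContMDiff (𝓡∂ (2 * n + 2)) 𝓘(ℝ, ℝ) ∞ k) (q : M) :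
    mvfderiv (𝓡∂ (2 * n + 2)) (fun p => ρ p * k p) (ι q) =
      k (ι q) • mvfderiv (𝓡∂ (2 * n + 2)) ρ (ι q) := by
  rw [mvfderiv_fun_mul (h.smooth.mdifferentiableAt (by simp)) (hk.mdifferentiableAt (by simp)),
    h.apply_boundary, zero_smul, zero_add]

omit [IsManifold (𝓡∂ (2 * n + 2)) ∞ X] [IsManifold (𝓡 (2 * n + 1)) ∞ M] in
theorem isDefiningFunction_mul_exp {u : X → ℝ} (hu : ContMDiff (𝓡∂ (2 * n + 2)) 𝓘(ℝ, ℝ) ∞ u) :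
    IsDefiningFunction (n := n) (fun p => ρ p * Real.exp (u p)) := by
  have he : ContMDiff (𝓡∂ (2 * n + 2)) 𝓘(ℝ, ℝ) ∞ (fun p => Real.exp (u p)) :=
    Real.contDiff_exp.contMDiff.comp hu
  refine ⟨h.smooth.mul he, fun p => ?_, fun p hp => ?_⟩
  · rw [mul_pos_iff_of_pos_right (Real.exp_pos _)]
    exact h.isDefiningFunction.pos_iff p
  · have h0 := h.isDefiningFunction.deriv_ne_zero p hp
    rw [← h.range_eq] at hp
    obtain ⟨q, rfl⟩ := hp
    rw [h.mvfderiv_mul he]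
    exact smul_ne_zero (Real.exp_pos _).ne' h0

omit [IsManifold (𝓡∂ (2 * n + 2)) ∞ X] [IsManifold (𝓡 (2 * n + 1)) ∞ M] in
theorem nonneg_of_pos_interior {f : X → ℝ} (hf : Continuous f)
    (hpos : ∀ p ∈ (𝓡∂ (2 * n + 2)).interior X, 0 < f p) (q : M) : 0 ≤ f (ι q) := by
  have := h.neBot_nhdsWithin q
  have h1 : Tendsto f (𝓝[(𝓡∂ (2 * n + 2)).interior X] (ι q)) (𝓝 (f (ι q))) :=
    hf.continuousAt.tendsto.mono_left nhdsWithin_le_nhds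
  refine ge_of_tendsto h1 ?_
  filter_upwards [self_mem_nhdsWithin] with p hp using (hpos p hp).le

/-- Defining functions differ by positive factors. -/
theorem exists_eq_mul_exp {ρ' : X → ℝ} (hρ' : IsDefiningFunction (n := n) ρ') :
    ∃ u : X → ℝ, ContMDiff (𝓡∂ (2 * n + 2)) 𝓘(ℝ, ℝ) ∞ u ∧ ∀ p, ρ' p = ρ p * Real.exp (u p) := by
  have hb : ∀ q, ¬ (𝓡∂ (2 * n + 2)).IsInteriorPoint (ι q) := fun q =>
    ((𝓡∂ (2 * n + 2)).isBoundaryPoint_iff_not_isInteriorPoint _).1 (h.isBoundaryPoint q)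
  have h0 : ∀ q, ρ' (ι q) = 0 := fun q => le_antisymm
    (not_lt.1 fun hlt => hb q ((hρ'.pos_iff _).1 hlt))
    (h.nonneg_of_pos_interior hρ'.smooth.continuous (fun p hp => (hρ'.pos_iff p).2 hp) q)
  obtain ⟨k, hk, hkeq⟩ := h.exists_eq_mul hρ'.smooth h0
  have hkint : ∀ p ∈ (𝓡∂ (2 * n + 2)).interior X, 0 < k p := by
    intro p hp
    have h1 := (hρ'.pos_iff p).2 hp
    rw [hkeq] at h1
    exact (mul_pos_iff_of_pos_left (h.pos p hp)).1 h1
  have hkpos : ∀ p, 0 < k p := by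
    intro p
    rcases (𝓡∂ (2 * n + 2)).isInteriorPoint_or_isBoundaryPoint p with hi | hbp
    · exact hkint p hi
    -- On the boundary `k ≥ 0` by continuity, and `k = 0` would force the differential of `ρ'` to
    -- vanish there.
    · have h2 := hρ'.deriv_ne_zero p hbp
      have : p ∈ Set.range ι := h.range_eq ▸ hbp
      obtain ⟨q, rfl⟩ := this
      refine lt_of_le_of_ne (h.nonneg_of_pos_interior hk.continuous hkint q) fun hk0 => h2 ?_
      rw [funext hkeq, h.mvfderiv_mul hk, ← hk0, zero_smul]
  refine ⟨fun p => Real.log (k p), fun p => ?_, fun p => ?_⟩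
  · exact (Real.contDiffAt_log.2 (hkpos p).ne').contMDiffAt.comp p (hk p)
  · rw [Real.exp_log (hkpos p), hkeq]

end IsCollarFunction

namespace IsACHCollar

variable (h : IsACHCollar ι Θ g T10 θ T Ψ V ρ)
include h

/-- In the weighted frame `ρ⁴ g(A, B)` is a sum of terms with a factor `ρ ^ (4 - w i - w j)`. On `M`
only the `T`-`T` term survives, and its coefficients are the values of `θ`. -/
theorem tendsto_metric : IsNormalizedBy ι g ρ θ := by
  intro q v w W hW hq A B hA hB hAv hBw
  obtain ⟨U, F, G, hqU, hw, hb⟩ := h.exists_isWeightedFrame q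
  obtain ⟨hb1, hb2, hb3, hb4⟩ := hb q hqU
  have hco := (hW.inter hw.isOpen)
  have hframe : IsLocalFrameOn (𝓡∂ (2 * n + 2)) (EuclideanSpace ℝ (Fin (2 * n + 2))) ∞ F (W ∩ U) :=
    hw.frame.mono Set.inter_subset_right
  have hAc := fun k => hframe.contMDiffOn_coeff hco (hA.mono Set.inter_subset_left) k
  have hBc := fun k => hframe.contMDiffOn_coeff hco (hB.mono Set.inter_subset_left) k
  have hlim : ∀ f : X → ℝ, ContMDiffOn (𝓡∂ (2 * n + 2)) 𝓘(ℝ, ℝ) ∞ f (W ∩ U) →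
      Tendsto f (𝓝[(𝓡∂ (2 * n + 2)).interior X] (ι q)) (𝓝 (f (ι q))) := fun f hf =>
    (hf.continuousOn.continuousAt (hco.mem_nhds ⟨hq, hqU⟩)).tendsto.mono_left nhdsWithin_le_nhds
  -- This keeps the natural subtraction `4 - weight i - weight j` from being truncated.
  have hw2 : ∀ k : FrameIndex n, weight k ≤ 2 := by rintro (⟨⟩ | ⟨⟩ | k) <;> simp [weight]
  have hsmooth : ContMDiffOn (𝓡∂ (2 * n + 2)) 𝓘(ℝ, ℝ) ∞ (fun p => ∑ i, ∑ j,
      hframe.coeff i p (A p) * hframe.coeff j p (B p) *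
        (ρ p ^ (4 - weight i - weight j) * G p i j)) (W ∩ U) :=
    contMDiffOn_finsetSum fun i _ => contMDiffOn_finsetSum fun j _ => ((hAc i).mul (hBc j)).mul
      ((h.smooth.pow _).contMDiffOn.mul ((hw.smooth_gram i j).mono Set.inter_subset_right))
  have h1 := hlim _ hsmooth
  have hval : ∑ i, ∑ j, hframe.coeff i (ι q) (A (ι q)) * hframe.coeff j (ι q) (B (ι q)) *
        (ρ (ι q) ^ (4 - weight i - weight j) * G (ι q) i j) = θ q v * θ q w := by
    have hAT := hb4 v (fun k => hframe.coeff k (ι q) (A (ι q)))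
      (hAv ▸ hframe.coeff_sum_eq A ⟨hq, hqU⟩)
    have hBT := hb4 w (fun k => hframe.coeff k (ι q) (B (ι q)))
      (hBw ▸ hframe.coeff_sum_eq B ⟨hq, hqU⟩)
    rw [← hAT, ← hBT, h.apply_boundary]
    simp [Fintype.sum_sum_type, weight, hb2]
  rw [hval] at h1
  refine h1.congr' ?_
  filter_upwards [self_mem_nhdsWithin, mem_nhdsWithin_of_mem_nhds (hco.mem_nhds ⟨hq, hqU⟩)]
    with p hpi hp
  have h2 : g p (A p) (B p) = g p (∑ i, hframe.coeff i p (A p) • F i p)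
      (∑ j, hframe.coeff j p (B p) • F j p) := by
    rw [← hframe.coeff_sum_eq A hp, ← hframe.coeff_sum_eq B hp]
  rw [h2]
  simp only [map_sum, map_smul, sum_apply, smul_apply, smul_eq_mul, Finset.mul_sum]
  rw [Finset.sum_comm]
  refine Finset.sum_congr rfl fun j _ => Finset.sum_congr rfl fun i _ => ?_
  rw [hw.gram_eq p ⟨hp.2, hpi⟩]
  simp only [map_smul, smul_apply, smul_eq_mul]
  have h3 : ρ p ^ 4 = ρ p ^ (4 - weight i - weight j) * (ρ p ^ weight i * ρ p ^ weight j) := by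
    rw [← pow_add, ← pow_add]
    congr 1
    have := hw2 i
    have := hw2 j
    omega
  rw [h3]
  ring

theorem isNormalizedBy_mul_exp {u : X → ℝ} (hu : ContMDiff (𝓡∂ (2 * n + 2)) 𝓘(ℝ, ℝ) ∞ u)
    {θ' : ∀ q : M, TangentSpace (𝓡 (2 * n + 1)) q →L[ℝ] ℝ} {l : M → ℝ}
    (hl : ∀ q v, θ' q v = l q * θ q v) (hul : ∀ q, Real.exp (4 * u (ι q)) = l q ^ 2) :
    IsNormalizedBy ι g (fun p => ρ p * Real.exp (u p)) θ' := by
  intro q v w W hW hq A B hA hB hAv hBw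
  have h1 : Tendsto (fun p => Real.exp (4 * u p)) (𝓝[(𝓡∂ (2 * n + 2)).interior X] (ι q))
      (𝓝 (l q ^ 2)) := by
    rw [← hul q]
    have hc : Continuous fun p => Real.exp (4 * u p) :=
      Real.continuous_exp.comp (continuous_const.mul hu.continuous)
    exact hc.continuousAt.tendsto.mono_left nhdsWithin_le_nhds
  have h2 := h1.mul (h.tendsto_metric q v w W hW hq A B hA hB hAv hBw)
  rw [hl, hl]
  convert h2 using 2
  · rw [mul_pow, ← Real.exp_nat_mul]
    push_cast
    ring
  · ring

/-- A normalized function has a prescribed `u` on `M`; this starts the uniqueness argument. -/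
theorem exp_eq_of_isNormalizedBy {u : X → ℝ} (hu : ContMDiff (𝓡∂ (2 * n + 2)) 𝓘(ℝ, ℝ) ∞ u)
    {θ' : ∀ q : M, TangentSpace (𝓡 (2 * n + 1)) q →L[ℝ] ℝ}
    (hN : IsNormalizedBy ι g (fun p => ρ p * Real.exp (u p)) θ') (q : M) :
    Real.exp (4 * u (ι q)) = θ' q (T q) ^ 2 := by
  obtain ⟨U, F, G, hqU, hw, hb⟩ := h.exists_isWeightedFrame q
  have hF := hw.frame.contMDiffOn (Sum.inr (Sum.inl ()))
  have hFT := (hb q hqU).2.2.1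
  have := h.neBot_nhdsWithin q
  -- The function `ρ e^u` is normalized by `e^(2u) θ` in any case. Evaluating on the Reeb field and
  -- comparing limits gives the equation.
  have h1 := h.isNormalizedBy_mul_exp hu (θ' := fun q => Real.exp (2 * u (ι q)) • θ q)
    (fun q v => rfl) (fun q => by rw [← Real.exp_nat_mul]; push_cast; ring_nf)
    q (T q) (T q) U hw.isOpen hqU _ _ hF hF hFT hFT
  have h2 := hN q (T q) (T q) U hw.isOpen hqU _ _ hF hF hFT hFT
  have h3 := tendsto_nhds_unique h1 h2
  rw [pow_two, ← h3]
  simp only [smul_apply, h.reeb.apply_self, smul_eq_mul, mul_one]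
  rw [← Real.exp_add]
  ring_nf

end IsACHCollar

end Normalization

/-! ### Solving and comparing order by order -/

section Solution

/-- A smooth quotient is needed to pass from `u₁ - u₂ = O(σ^(2n+2))` to the same order for `e^(u₁) -
e^(u₂)` with a smooth factor. -/
theorem exists_exp_sub_one_eq_mul : ∃ φ : ℝ → ℝ, ContDiff ℝ ∞ φ ∧ ∀ t, Real.exp t - 1 = t * φ t := by
  obtain ⟨h, hh, heq⟩ := exists_contDiffOn_eq_apply (E₁ := ℝ) (E₂ := ℝ) (s := Set.univ) convex_univ
    uniqueDiffOn_univ (fun _ _ _ _ => trivial) (f := fun y => Real.exp y.1 - 1)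
    ((Real.contDiff_exp.comp contDiff_fst).sub contDiff_const).contDiffOn (by simp) 1
  refine ⟨fun t => h (t, 0), ?_, fun t => heq (t, 0) trivial t (by simp)⟩
  exact (contDiffOn_univ.1 hh).comp (contDiff_id.prodMk contDiff_const)

theorem two_mul_sq_rpow (k : ℕ) {r : ℝ} (hr : 0 < r) :
    (2 * r ^ 2) ^ ((k : ℝ) / 2) = 2 ^ ((k : ℝ) / 2) * r ^ k := by
  rw [Real.mul_rpow (by norm_num) (by positivity), ← Real.rpow_natCast r 2, ← Real.rpow_mul hr.le,
    ← Real.rpow_natCast r k]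
  congr 2
  push_cast
  ring

variable {n : ℕ} {X : Type*} [TopologicalSpace X]
  [ChartedSpace (EuclideanHalfSpace (2 * n + 2)) X] [IsManifold (𝓡∂ (2 * n + 2)) ∞ X]
  {M : Type*} [TopologicalSpace M]
  [ChartedSpace (EuclideanSpace ℝ (Fin (2 * n + 1))) M] [IsManifold (𝓡 (2 * n + 1)) ∞ M]
  {ι : M → X} {Θ : ∀ q : M, TangentSpace (𝓡∂ (2 * n + 2)) (ι q) →L[ℝ] ℝ}
  {g : ∀ p : X, TangentSpace (𝓡∂ (2 * n + 2)) p →L[ℝ] TangentSpace (𝓡∂ (2 * n + 2)) p →L[ℝ] ℝ}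
  {T10 : ∀ q : M, Submodule ℂ (ℂ ⊗[ℝ] TangentSpace (𝓡 (2 * n + 1)) q)}
  {θ : ∀ q : M, TangentSpace (𝓡 (2 * n + 1)) q →L[ℝ] ℝ}
  {T : ∀ q : M, TangentSpace (𝓡 (2 * n + 1)) q}
  {Ψ : PartialDiffeomorph (collarModel n) (𝓡∂ (2 * n + 2)) (EuclideanHalfSpace 1 × M) X ∞}
  {V : Set X} {ρ : X → ℝ}

/-- Two defining functions differ by a factor `e^v`, so `(2 ρ'²)^(k/2)` is `ρ ^ k` times a smooth
positive function. All order statements thus reduce to natural powers of one collar function. -/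
theorem IsCollarFunction.isOPow_iff (h : IsCollarFunction ι Ψ V ρ) {ρ' : X → ℝ}
    (hρ' : IsDefiningFunction (n := n) ρ') (k : ℕ) {φ : X → ℝ} :
    IsOPow n ρ' ((k : ℝ) / 2) φ ↔ ∃ f : X → ℝ, ContMDiff (𝓡∂ (2 * n + 2)) 𝓘(ℝ, ℝ) ∞ f ∧
      ∀ p ∈ (𝓡∂ (2 * n + 2)).interior X, φ p = ρ p ^ k * f p := by
  obtain ⟨v, hv, hveq⟩ := h.exists_eq_mul_exp hρ'
  have hexp : ∀ c : ℝ, ContMDiff (𝓡∂ (2 * n + 2)) 𝓘(ℝ, ℝ) ∞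
      (fun p => 2 ^ (c / 2) * Real.exp (c * v p)) := fun c =>
    contMDiff_const.mul (Real.contDiff_exp.contMDiff.comp (contMDiff_const.mul hv))
  have hx : ∀ p ∈ (𝓡∂ (2 * n + 2)).interior X, (2 * ρ' p ^ 2) ^ ((k : ℝ) / 2) =
      2 ^ ((k : ℝ) / 2) * (ρ p ^ k * Real.exp (k * v p)) := by
    intro p hp
    rw [two_mul_sq_rpow k ((hρ'.pos_iff p).2 hp), hveq, mul_pow, ← Real.exp_nat_mul]
  constructor
  · rintro ⟨f, hf, hfeq⟩
    refine ⟨fun p => 2 ^ ((k : ℝ) / 2) * Real.exp (k * v p) * f p, (hexp k).mul hf, fun p hp => ?_⟩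
    rw [hfeq p hp, hx p hp]
    ring
  · rintro ⟨f, hf, hfeq⟩
    refine ⟨fun p => 2 ^ ((-k : ℝ) / 2) * Real.exp (-k * v p) * f p, (hexp (-k)).mul hf,
      fun p hp => ?_⟩
    rw [hfeq p hp, hx p hp]
    have h1 : (2 : ℝ) ^ ((k : ℝ) / 2) * 2 ^ ((-k : ℝ) / 2) = 1 := by
      rw [← Real.rpow_add (by norm_num)]
      simp [neg_div]
    have h2 : Real.exp (k * v p) * Real.exp (-k * v p) = 1 := by
      rw [← Real.exp_add]
      simp
    linear_combination (-(ρ p ^ k * f p)) * h1 - (ρ p ^ k * f p) *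
      (2 : ℝ) ^ ((k : ℝ) / 2) * 2 ^ ((-k : ℝ) / 2) * h2

namespace IsACHCollar

variable (h : IsACHCollar ι Θ g T10 θ T Ψ V ρ)
include h

theorem laplacian_log_eq {u : X → ℝ} (hu : ContMDiff (𝓡∂ (2 * n + 2)) 𝓘(ℝ, ℝ) ∞ u) {p : X}
    (hp : p ∈ (𝓡∂ (2 * n + 2)).interior X) :
    laplacian (𝓡∂ (2 * n + 2)) g (fun q => Real.log (2 * (ρ q * Real.exp (u q)) ^ 2)) p =
      2 * laplacian (𝓡∂ (2 * n + 2)) g (fun q => Real.log (ρ q)) p +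
        2 * laplacian (𝓡∂ (2 * n + 2)) g u p := by
  refine h.metric.interior.laplacian_eq_of_eqOn (isOpen_interior n X) h.contMDiffOn_log
    hu.contMDiffOn (c := Real.log 2) (fun q hq => ?_) hp
  have hρ := (h.pos q hq).ne'
  have he := (Real.exp_pos (u q)).ne'
  rw [Real.log_mul (by norm_num) (by positivity), Real.log_pow, Real.log_mul hρ he, Real.log_exp]
  push_cast
  ring

/-- Adding `ρ ^ (j + 1) * b` changes the error at that order by a multiple of `b` on `M`, nonzero as
long as `j + 1` is not an indicial root. The bound on `j` stops the corrections just before the root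
`2n+2`. -/
theorem exists_approximate_solution {c : X → ℝ} (hc : ContMDiff (𝓡∂ (2 * n + 2)) 𝓘(ℝ, ℝ) ∞ c)
    (j : ℕ) (hj : j ≤ 2 * n + 1) :
    ∃ u : X → ℝ, ContMDiff (𝓡∂ (2 * n + 2)) 𝓘(ℝ, ℝ) ∞ u ∧ (∀ q, u (ι q) = c (ι q)) ∧
      ∃ f : X → ℝ, ContMDiff (𝓡∂ (2 * n + 2)) 𝓘(ℝ, ℝ) ∞ f ∧
        ∀ p ∈ (𝓡∂ (2 * n + 2)).interior X,
          laplacian (𝓡∂ (2 * n + 2)) g (fun q => Real.log (2 * (ρ q * Real.exp (u q)) ^ 2)) p -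
            (n + 1) = ρ p ^ (j + 1) * f p := by
  induction j with
  | zero =>
    -- Twice the boundary value of `Δ log ρ` is `n + 1`, and `Δ c` vanishes on `M` because `0` is an
    -- indicial root. So any boundary value `c` is allowed.
    obtain ⟨f₁, hf₁, hf₁eq, hf₁b⟩ := h.exists_laplacian_log
    obtain ⟨f₂, hf₂, hf₂eq, hf₂b⟩ := h.exists_laplacian_pow_mul 0 hc
    simp only [pow_zero, one_mul] at hf₂eq
    obtain ⟨f, hf, hfeq⟩ := h.exists_eq_mul (f := fun p => 2 * f₁ p + 2 * f₂ p - (n + 1))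
      (((contMDiff_const.mul hf₁).add (contMDiff_const.mul hf₂)).sub contMDiff_const)
      (fun q => by rw [hf₁b, hf₂b]; push_cast; ring)
    refine ⟨c, hc, fun q => rfl, f, hf, fun p hp => ?_⟩
    rw [h.laplacian_log_eq hc hp, hf₁eq p hp, hf₂eq p hp, zero_add, pow_one, ← hfeq]
  | succ j ih =>
    obtain ⟨u, hu, hub, e, he, heq⟩ := ih (by omega)
    let a : ℝ := (j + 1) * (j + 1 - (2 * n + 2))
    have ha : a ≠ 0 := by
      have h1 : (j : ℝ) + 1 ≤ 2 * n + 1 := by exact_mod_cast hj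
      refine mul_ne_zero (by positivity) ?_
      linarith
    -- Doubling the indicial factor `-a/4` gives the condition `e - (a/2) b = 0` on `M`.
    let b : X → ℝ := fun p => 2 / a * e p
    have hb : ContMDiff (𝓡∂ (2 * n + 2)) 𝓘(ℝ, ℝ) ∞ b := contMDiff_const.mul he
    obtain ⟨f₂, hf₂, hf₂eq, hf₂b⟩ := h.exists_laplacian_pow_mul (j + 1) hb
    have hs : ContMDiff (𝓡∂ (2 * n + 2)) 𝓘(ℝ, ℝ) ∞ (fun p => ρ p ^ (j + 1) * b p) :=
      (h.smooth.pow _).mul hb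
    have hu' : ContMDiff (𝓡∂ (2 * n + 2)) 𝓘(ℝ, ℝ) ∞ (fun p => u p + ρ p ^ (j + 1) * b p) :=
      hu.add hs
    obtain ⟨f, hf, hfeq⟩ := h.exists_eq_mul (f := fun p => e p + 2 * f₂ p)
      (he.add (contMDiff_const.mul hf₂)) (fun q => by
        rw [hf₂b]
        simp only [b]
        have h1 : ((j + 1 : ℕ) : ℝ) * (((j + 1 : ℕ) : ℝ) - (2 * n + 2)) = a := by
          simp only [a]
          push_cast
          ring
        rw [h1]
        field_simp
        ring)
    refine ⟨_, hu', fun q => ?_, f, hf, fun p hp => ?_⟩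
    · simp only [h.apply_boundary, hub]
      simp
    · have h1 := h.metric.interior.laplacian_eq_of_eqOn (isOpen_interior n X) hu.contMDiffOn
        hs.contMDiffOn (w := fun p => u p + ρ p ^ (j + 1) * b p) (c := 0) (a := 1) (b := 1)
        (fun q hq => by ring) hp
      have h2 := heq p hp
      rw [h.laplacian_log_eq hu hp] at h2
      rw [h.laplacian_log_eq hu' hp, h1, hf₂eq p hp, pow_succ _ (j + 1), mul_assoc, ← hfeq]
      linear_combination h2

/-- If `w = ρ ^ (j + 1) * a` with `0 < j + 1 < 2n+2`, then on `M` the leading coefficient of `Δ w`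
is a nonzero multiple of `a`. It vanishes by hypothesis, so `a` is divisible by `ρ`. -/
theorem exists_eq_pow_mul_of_laplacian {w f : X → ℝ}
    (hw : ContMDiff (𝓡∂ (2 * n + 2)) 𝓘(ℝ, ℝ) ∞ w) (hw0 : ∀ q, w (ι q) = 0)
    (hf : ContMDiff (𝓡∂ (2 * n + 2)) 𝓘(ℝ, ℝ) ∞ f)
    (hwf : ∀ p ∈ (𝓡∂ (2 * n + 2)).interior X,
      laplacian (𝓡∂ (2 * n + 2)) g w p = ρ p ^ (2 * n + 2) * f p)
    (j : ℕ) (hj : j ≤ 2 * n + 1) :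
    ∃ a : X → ℝ, ContMDiff (𝓡∂ (2 * n + 2)) 𝓘(ℝ, ℝ) ∞ a ∧ ∀ p, w p = ρ p ^ (j + 1) * a p := by
  induction j with
  | zero =>
    obtain ⟨a, ha, haeq⟩ := h.exists_eq_mul hw hw0
    exact ⟨a, ha, fun p => by rw [haeq, zero_add, pow_one]⟩
  | succ j ih =>
    obtain ⟨a, ha, haeq⟩ := ih (by omega)
    obtain ⟨f₂, hf₂, hf₂eq, hf₂b⟩ := h.exists_laplacian_pow_mul (j + 1) ha
    rw [← funext haeq] at hf₂eq
    -- The power `ρ ^ (j + 1)` can be cancelled only in the interior; density carries the identity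
    -- to `M`. The remaining exponent is positive, so `f₂` vanishes there.
    have h1 : Set.EqOn f₂ (fun p => ρ p ^ (2 * n + 1 - j) * f p) Set.univ := by
      refine h.eqOn_of_eqOn_interior isOpen_univ hf₂.continuous.continuousOn
        ((h.smooth.pow _).mul hf).continuous.continuousOn fun p hp => ?_
      have h2 := (hwf p hp.2).symm.trans (hf₂eq p hp.2)
      have h3 : ρ p ^ (2 * n + 2) = ρ p ^ (j + 1) * ρ p ^ (2 * n + 1 - j) := by
        rw [← pow_add]
        congr 1
        omega
      rw [h3, mul_assoc] at h2
      exact (mul_left_cancel₀ (pow_pos (h.pos p hp.2) _).ne' h2).symm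
    obtain ⟨a', ha', haeq'⟩ := h.exists_eq_mul ha fun q => by
      have h2 := hf₂b q
      have h3 : f₂ (ι q) = 0 := by
        rw [h1 (Set.mem_univ _)]
        simp only [h.apply_boundary]
        rw [zero_pow (by omega), zero_mul]
      rw [h3] at h2
      have h4 : ((j + 1 : ℕ) : ℝ) ≤ 2 * n + 1 := by exact_mod_cast hj
      have h5 : (0 : ℝ) < (j + 1 : ℕ) := by positivity
      have h6 : -(((j + 1 : ℕ) : ℝ) * (((j + 1 : ℕ) : ℝ) - (2 * n + 2))) / 4 ≠ 0 := by
        refine div_ne_zero (neg_ne_zero.2 (mul_ne_zero h5.ne' ?_)) (by norm_num)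
        linarith
      exact (mul_eq_zero.1 h2.symm).resolve_left h6
    exact ⟨a', ha', fun p => by rw [haeq, haeq', pow_succ _ (j + 1), mul_assoc]⟩

end IsACHCollar

end Solution

/-! ### Existence and uniqueness in terms of `u` -/

section Main

variable {n : ℕ} {X : Type*} [TopologicalSpace X]
  [ChartedSpace (EuclideanHalfSpace (2 * n + 2)) X] [IsManifold (𝓡∂ (2 * n + 2)) ∞ X]
  {M : Type*} [TopologicalSpace M]
  [ChartedSpace (EuclideanSpace ℝ (Fin (2 * n + 1))) M] [IsManifold (𝓡 (2 * n + 1)) ∞ M]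
  {ι : M → X} {Θ : ∀ q : M, TangentSpace (𝓡∂ (2 * n + 2)) (ι q) →L[ℝ] ℝ}
  {g : ∀ p : X, TangentSpace (𝓡∂ (2 * n + 2)) p →L[ℝ] TangentSpace (𝓡∂ (2 * n + 2)) p →L[ℝ] ℝ}
  {T10 : ∀ q : M, Submodule ℂ (ℂ ⊗[ℝ] TangentSpace (𝓡 (2 * n + 1)) q)}
  {θ θ' : ∀ q : M, TangentSpace (𝓡 (2 * n + 1)) q →L[ℝ] ℝ}
  {T : ∀ q : M, TangentSpace (𝓡 (2 * n + 1)) q}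
  {Ψ : PartialDiffeomorph (collarModel n) (𝓡∂ (2 * n + 2)) (EuclideanHalfSpace 1 × M) X ∞}
  {V : Set X} {ρ : X → ℝ}

namespace IsACHCollar

variable (h : IsACHCollar ι Θ g T10 θ T Ψ V ρ)
include h

theorem exists_normalized_solution [T2Space X] [SigmaCompactSpace X]
    (hθ' : IsContactForm T10 θ') :
    ∃ u : X → ℝ, ContMDiff (𝓡∂ (2 * n + 2)) 𝓘(ℝ, ℝ) ∞ u ∧
      IsNormalizedBy ι g (fun p => ρ p * Real.exp (u p)) θ' ∧
      ∃ f : X → ℝ, ContMDiff (𝓡∂ (2 * n + 2)) 𝓘(ℝ, ℝ) ∞ f ∧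
        ∀ p ∈ (𝓡∂ (2 * n + 2)).interior X,
          laplacian (𝓡∂ (2 * n + 2)) g (fun q => Real.log (2 * (ρ q * Real.exp (u q)) ^ 2)) p -
            (n + 1) = ρ p ^ (2 * n + 2) * f p := by
  have hl0 : ∀ q, θ' q (T q) ≠ 0 := h.contact.apply_reeb_ne_zero h.cr h.reeb hθ'
  have hls := hθ'.smooth.contMDiff_apply h.reeb.smooth
  -- This boundary value solves `e^(4c) = θ'(T)²`. Since `Real.log` depends only on the absolute
  -- value, the sign of `θ'(T)` plays no role.
  obtain ⟨c, hc, hcb⟩ := h.exists_contMDiff_extension (c := fun q => Real.log (θ' q (T q)) / 2)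
    fun q => ((Real.contDiffAt_log.2 (hl0 q)).contMDiffAt.comp q (hls q)).div_const 2
  obtain ⟨u, hu, hub, hf⟩ := h.exists_approximate_solution hc (2 * n + 1) le_rfl
  refine ⟨u, hu, h.isNormalizedBy_mul_exp hu (h.contact.apply_eq_mul h.cr h.reeb hθ') fun q => ?_,
    hf⟩
  rw [hub, hcb, ← Real.exp_log (sq_pos_of_ne_zero (hl0 q)), Real.log_pow]
  push_cast
  ring_nf

theorem exists_sub_eq_pow_mul {u₁ u₂ f₁ f₂ : X → ℝ}
    (hu₁ : ContMDiff (𝓡∂ (2 * n + 2)) 𝓘(ℝ, ℝ) ∞ u₁)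
    (hu₂ : ContMDiff (𝓡∂ (2 * n + 2)) 𝓘(ℝ, ℝ) ∞ u₂)
    (hN₁ : IsNormalizedBy ι g (fun p => ρ p * Real.exp (u₁ p)) θ')
    (hN₂ : IsNormalizedBy ι g (fun p => ρ p * Real.exp (u₂ p)) θ')
    (hf₁ : ContMDiff (𝓡∂ (2 * n + 2)) 𝓘(ℝ, ℝ) ∞ f₁)
    (hf₂ : ContMDiff (𝓡∂ (2 * n + 2)) 𝓘(ℝ, ℝ) ∞ f₂)
    (hΔ₁ : ∀ p ∈ (𝓡∂ (2 * n + 2)).interior X,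
      laplacian (𝓡∂ (2 * n + 2)) g (fun q => Real.log (2 * (ρ q * Real.exp (u₁ q)) ^ 2)) p -
        (n + 1) = ρ p ^ (2 * n + 2) * f₁ p)
    (hΔ₂ : ∀ p ∈ (𝓡∂ (2 * n + 2)).interior X,
      laplacian (𝓡∂ (2 * n + 2)) g (fun q => Real.log (2 * (ρ q * Real.exp (u₂ q)) ^ 2)) p -
        (n + 1) = ρ p ^ (2 * n + 2) * f₂ p) :
    ∃ a : X → ℝ, ContMDiff (𝓡∂ (2 * n + 2)) 𝓘(ℝ, ℝ) ∞ a ∧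
      ∀ p, ρ p * Real.exp (u₁ p) - ρ p * Real.exp (u₂ p) = ρ p ^ (2 * n + 3) * a p := by
  obtain ⟨a, ha, haeq⟩ := h.exists_eq_pow_mul_of_laplacian (hu₁.sub hu₂)
    (fun q => by
      have h1 := (h.exp_eq_of_isNormalizedBy hu₁ hN₁ q).trans
        (h.exp_eq_of_isNormalizedBy hu₂ hN₂ q).symm
      have h2 := Real.exp_injective h1
      linarith)
    (f := fun p => (f₁ p - f₂ p) / 2) ((hf₁.sub hf₂).div_const 2)
    (fun p hp => by
      have h1 := hΔ₁ p hp
      have h2 := hΔ₂ p hp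
      rw [h.laplacian_log_eq hu₁ hp] at h1
      rw [h.laplacian_log_eq hu₂ hp] at h2
      rw [h.metric.interior.laplacian_eq_of_eqOn (isOpen_interior n X) hu₁.contMDiffOn
        hu₂.contMDiffOn (c := 0) (a := 1) (b := -1)
        (fun q hq => by ring) hp]
      linear_combination (h1 - h2) / 2) (2 * n + 1) le_rfl
  obtain ⟨φ, hφ, hφeq⟩ := exists_exp_sub_one_eq_mul
  refine ⟨fun p => Real.exp (u₂ p) * (a p * φ (u₁ p - u₂ p)),
    (Real.contDiff_exp.contMDiff.comp hu₂).mul (ha.mul (hφ.contMDiff.comp (hu₁.sub hu₂))),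
    fun p => ?_⟩
  have h1 := hφeq (u₁ p - u₂ p)
  have h2 : u₁ p - u₂ p = ρ p ^ (2 * n + 1 + 1) * a p := haeq p
  have h3 : Real.exp (u₁ p) = Real.exp (u₂ p) * Real.exp (u₁ p - u₂ p) := by
    rw [← Real.exp_add]
    ring_nf
  have h4 : Real.exp (u₁ p - u₂ p) = 1 + ρ p ^ (2 * n + 1 + 1) * a p * φ (u₁ p - u₂ p) := by
    rw [← h2, ← h1]
    ring
  rw [h3, h4]
  ring

end IsACHCollar

end Main

end

end ACH

theorem proposition2p5 {n : ℕ} (hn : 1 ≤ n)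
    {X : Type*} [TopologicalSpace X] [T2Space X] [SigmaCompactSpace X]
    [ChartedSpace (EuclideanHalfSpace (2 * n + 2)) X] [IsManifold (𝓡∂ (2 * n + 2)) ∞ X]
    {M : Type*} [TopologicalSpace M]
    [ChartedSpace (EuclideanSpace ℝ (Fin (2 * n + 1))) M] [IsManifold (𝓡 (2 * n + 1)) ∞ M]
    (ι : M → X) (hι : ACH.IsBoundaryInclusion (n := n) ι)
    (Θ : ∀ q : M, TangentSpace (𝓡∂ (2 * n + 2)) (ι q) →L[ℝ] ℝ)
    (hΘ : ACH.IsThetaStructure ι Θ)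
    (g : ∀ p : X, TangentSpace (𝓡∂ (2 * n + 2)) p →L[ℝ]
      TangentSpace (𝓡∂ (2 * n + 2)) p →L[ℝ] ℝ)
    (T10 : ∀ q : M, Submodule ℂ (ℂ ⊗[ℝ] TangentSpace (𝓡 (2 * n + 1)) q))
    (hg : ACH.IsACHMetric ι Θ g T10)
    (θ : ∀ q : M, TangentSpace (𝓡 (2 * n + 1)) q →L[ℝ] ℝ)
    (hθ : ACH.IsContactForm T10 θ) (m : ℕ) (hm : m = n + 1) :
    -- existence
    (∃ ρ' : X → ℝ, ACH.IsDefiningFunction (n := n) ρ' ∧ ACH.IsNormalizedBy ι g ρ' θ ∧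
      ∀ ρ : X → ℝ, ACH.IsDefiningFunction (n := n) ρ →
        ACH.IsOPow n ρ m
          (fun p => ACH.laplacian (𝓡∂ (2 * n + 2)) g (fun q => Real.log (2 * ρ' q ^ 2)) p - m)) ∧
    -- uniqueness
    (∀ ρ : X → ℝ, ACH.IsDefiningFunction (n := n) ρ →
      ∀ ρ₁ ρ₂ : X → ℝ,
      ACH.IsDefiningFunction (n := n) ρ₁ → ACH.IsNormalizedBy ι g ρ₁ θ →
      ACH.IsOPow n ρ m
        (fun p => ACH.laplacian (𝓡∂ (2 * n + 2)) g (fun q => Real.log (2 * ρ₁ q ^ 2)) p - m) →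
      ACH.IsDefiningFunction (n := n) ρ₂ → ACH.IsNormalizedBy ι g ρ₂ θ →
      ACH.IsOPow n ρ m
        (fun p => ACH.laplacian (𝓡∂ (2 * n + 2)) g (fun q => Real.log (2 * ρ₂ q ^ 2)) p - m) →
      ACH.IsOPow n ρ ((2 * m + 1) / 2) (fun p => ρ₁ p - ρ₂ p) ∧
      ACH.IsOPow n ρ (m + 1) (fun p => 2 * ρ₁ p ^ 2 - 2 * ρ₂ p ^ 2)) := by
  subst hm
  obtain ⟨θ₀, T, Ψ, V, σ, h⟩ := hg.exists_isACHCollar hι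
  have hm2 : (((2 * n + 2 : ℕ) : ℝ)) / 2 = ((n + 1 : ℕ) : ℝ) := by
    push_cast
    ring
  refine ⟨?_, fun ρ hρ ρ₁ ρ₂ hρ₁ hN₁ hΔ₁ hρ₂ hN₂ hΔ₂ => ?_⟩
  · obtain ⟨u, hu, hN, f, hf, hfeq⟩ := h.exists_normalized_solution hθ
    refine ⟨_, h.isDefiningFunction_mul_exp hu, hN, fun ρ hρ => ?_⟩
    rw [← hm2, h.isOPow_iff hρ]
    refine ⟨f, hf, fun p hp => ?_⟩
    rw [← hfeq p hp]
    push_cast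
    ring
  · obtain ⟨u₁, hu₁, hu₁eq⟩ := h.exists_eq_mul_exp hρ₁
    obtain ⟨u₂, hu₂, hu₂eq⟩ := h.exists_eq_mul_exp hρ₂
    obtain rfl := funext hu₁eq
    obtain rfl := funext hu₂eq
    rw [← hm2, h.isOPow_iff hρ] at hΔ₁ hΔ₂
    obtain ⟨f₁, hf₁, hf₁eq⟩ := hΔ₁
    obtain ⟨f₂, hf₂, hf₂eq⟩ := hΔ₂
    have hcast : ((2 * n + 2 : ℕ) : ℝ) / 2 = (n : ℝ) + 1 := by
      push_cast
      ring
    simp only [hcast] at hf₁eq hf₂eq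
    obtain ⟨a, ha, haeq⟩ := h.exists_sub_eq_pow_mul hu₁ hu₂ hN₁ hN₂ hf₁ hf₂ hf₁eq hf₂eq
    have h3 : (2 * ((n + 1 : ℕ) : ℝ) + 1) / 2 = ((2 * n + 3 : ℕ) : ℝ) / 2 := by
      push_cast
      ring
    have h4 : ((n + 1 : ℕ) : ℝ) + 1 = ((2 * n + 4 : ℕ) : ℝ) / 2 := by
      push_cast
      ring
    rw [h3, h4, h.isOPow_iff hρ, h.isOPow_iff hρ]
    -- The difference of squares gains one order over `ρ₁ - ρ₂`, because `ρ₁ + ρ₂ = σ (e^(u₁) +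
    -- e^(u₂))`.
    refine ⟨⟨a, ha, fun p _ => haeq p⟩,
      fun p => 2 * a p * (Real.exp (u₁ p) + Real.exp (u₂ p)), ?_, fun p _ => ?_⟩
    · exact (contMDiff_const.mul ha).mul ((Real.contDiff_exp.contMDiff.comp hu₁).add
        (Real.contDiff_exp.contMDiff.comp hu₂))
    · linear_combination 2 * σ p * (Real.exp (u₁ p) + Real.exp (u₂ p)) * haeq p
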